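/- Let $M$ be a connected smooth four-manifold with a smooth Lorentzian metric $g$ of signature $(-,+,+,+)$ which is ultra-static with respect to a vector field $K$: around every point of $M$ there are coordinates $(t,x^1,x^2,x^3)$ in which $K=\partial/\partial t$ and $g=-dt^2+h$, where $h=h_{ij}(x)\,dx^i dx^j$ is a smooth Riemannian metric not depending on $t$. Call a smooth vector field $X$ on $M$ an HSO timelike Killing field if $g(X,X)<0$ everywhere, $\mathcal L_X g=0$, and the one-form $X^\flat=g(X,\cdot)$ satisfies $X^\flat\wedge dX^\flat=0$. If around a point there are coordinates $(\bar t,\bar x)$ with $X=\partial/\partial\bar t$ and $g=V(\bar x)^2(-d\bar t^2+\bar h)$, where $V>0$ is a smooth function and $\bar h$ a Riemannian metric in the variables $\bar x$ only, then $\bar h$ is called the optical metric of $X$ there. Suppose that $g$ admits an HSO timelike Killing field $\xi$ on $M$ which is not a constant multiple of $K$. (No assumption is made on the dimension of the orbits of the group generated by $K$ and $\xi$.) Then at least one of the following holds. 1. $g$ is flat: around every point of $M$ there are coordinates $(T,X,Y,Z)$ with $K=\partial/\partial T$ and $g=-dT^2+dX^2+dY^2+dZ^2$. 2. Around every point $p$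 of $M$ there are coordinates $(t,r,x,y)$ with $K=\partial/\partial t$ and $$g=-dt^2+dr^2+\gamma_1,$$ where $\gamma_1$ is a smooth Riemannian metric in the two variables $(x,y)$, such that every HSO timelike Killing field $\zeta$ on $M$ (in particular $\zeta=\xi$) becomes, after multiplication by a suitable nonzero constant (which may depend on $p$), the field $\partial/\partial\bar t$ of coordinates $(\bar t,\bar r,x,y)$ around $p$, with the same $x,y$ and $\gamma_1$, in which either $$g=-d\bar t^2+d\bar r^2+\gamma_1,\quad\text{with optical metric } d\bar r^2+\gamma_1,$$ or $$\bar r>0,\quad g=\bar r^2\big(-d\bar t^2+\bar h\big),\quad\text{with optical metric } \bar h=\bar r^{-2}\big(d\bar r^2+\gamma_1\big).$$ -/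

import Mathlib

open scoped Manifold ContDiff

attribute [-instance] TopCat.of.chartedSpace TopCat.of.hasGroupoid

/-- The coordinate space of `(t, r, x, y)`, the model space of our four-manifolds. Points of it are
written `(t, X)` with `X = (r, x, y)` the spatial coordinates. -/
abbrev Coord4 : Type := ℝ × ℝ × ℝ × ℝ

/-- The spatial coordinate space of `X = (r, x, y)`. -/
abbrev Coord3 : Type := ℝ × ℝ × ℝ

/-- The coordinate space of `(x, y)`. -/
abbrev Coord2 : Type := ℝ × ℝ

/-- `h` is a smooth Riemannian metric on the subset `Ω` of the coordinate space `F`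
(the values of `h` outside `Ω` are irrelevant). -/
structure IsRiemannianOn {F : Type*} [NormedAddCommGroup F] [NormedSpace ℝ F]
    (h : F → F →L[ℝ] F →L[ℝ] ℝ) (Ω : Set F) : Prop where
  symm : ∀ x ∈ Ω, ∀ u v, h x u v = h x v u
  pos : ∀ x ∈ Ω, ∀ u, u ≠ 0 → 0 < h x u u
  smooth : ContDiffOn ℝ ∞ h Ω

/-- A smooth Lorentzian metric, of signature `(-,+,+,+)`, on a four-manifold. -/
structure LorentzMetric (M : Type*) [TopologicalSpace M] [ChartedSpace Coord4 M]
    [IsManifold 𝓘(ℝ, Coord4) ∞ M] where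
  /-- The bilinear form on each tangent space. -/
  val : ∀ p : M, TangentSpace 𝓘(ℝ, Coord4) p →L[ℝ] TangentSpace 𝓘(ℝ, Coord4) p →L[ℝ] ℝ
  symm : ∀ (p : M) (u v : TangentSpace 𝓘(ℝ, Coord4) p), val p u v = val p v u
  signature : ∀ p : M, ∃ b : Module.Basis (Fin 4) ℝ (TangentSpace 𝓘(ℝ, Coord4) p),
    ∀ i j, val p (b i) (b j) = if i = j then (if i = 0 then -1 else 1) else 0
  smooth : ContMDiff 𝓘(ℝ, Coord4) (𝓘(ℝ, Coord4).prod 𝓘(ℝ, Coord4 →L[ℝ] Coord4 →L[ℝ] ℝ)) ∞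
    (fun p ↦ Bundle.TotalSpace.mk' (Coord4 →L[ℝ] Coord4 →L[ℝ] ℝ)
      (E := fun p : M ↦ TangentSpace 𝓘(ℝ, Coord4) p →L[ℝ] TangentSpace 𝓘(ℝ, Coord4) p →L[ℝ] ℝ)
      p (val p))

noncomputable section

variable {M : Type*} [TopologicalSpace M] [ChartedSpace Coord4 M]
  [IsManifold 𝓘(ℝ, Coord4) ∞ M]

/-- The components of the metric `g` in the chart `φ`, a field of bilinear forms on `φ.target`. -/
def LorentzMetric.inChart (g : LorentzMetric M) (φ : OpenPartialHomeomorph M Coord4)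
    (z : Coord4) : Coord4 →L[ℝ] Coord4 →L[ℝ] ℝ :=
  let B : Coord4 →L[ℝ] Coord4 →L[ℝ] ℝ := g.val (φ.symm z)
  let A : Coord4 →L[ℝ] Coord4 := mfderiv 𝓘(ℝ, Coord4) 𝓘(ℝ, Coord4) φ.symm z
  B.bilinearComp A A

/-- The components of the vector field `X` in the chart `φ`, a vector field on `φ.target`. -/
def fieldInChart (X : ∀ p : M, TangentSpace 𝓘(ℝ, Coord4) p) (φ : OpenPartialHomeomorph M Coord4)
    (z : Coord4) : Coord4 :=
  mfderiv 𝓘(ℝ, Coord4) 𝓘(ℝ, Coord4) φ (φ.symm z) (X (φ.symm z))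

/-- `X` is a Killing vector field of `g`: in every smooth chart, the components of the Lie
derivative of `g` along `X` vanish. -/
def IsKillingField (g : LorentzMetric M) (X : ∀ p : M, TangentSpace 𝓘(ℝ, Coord4) p) : Prop :=
  ∀ φ ∈ IsManifold.maximalAtlas 𝓘(ℝ, Coord4) ∞ M, ∀ z ∈ φ.target, ∀ u v : Coord4,
    fderiv ℝ (g.inChart φ) z (fieldInChart X φ z) u v
      + g.inChart φ z (fderiv ℝ (fieldInChart X φ) z u) v
      + g.inChart φ z u (fderiv ℝ (fieldInChart X φ) z v) = 0

/-- The one-form `g(X, ·)` in the chart `φ`. -/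
def dualFormInChart (g : LorentzMetric M) (X : ∀ p : M, TangentSpace 𝓘(ℝ, Coord4) p)
    (φ : OpenPartialHomeomorph M Coord4) (z : Coord4) : Coord4 →L[ℝ] ℝ :=
  g.inChart φ z (fieldInChart X φ z)

/-- The exterior derivative `dα` of a one-form `α` on the coordinate space. -/
def extDerivOneForm (α : Coord4 → Coord4 →L[ℝ] ℝ) (z u v : Coord4) : ℝ :=
  fderiv ℝ α z u v - fderiv ℝ α z v u

/-- `X` is hypersurface orthogonal: the one-form `α = g(X, ·)` satisfies `α ∧ dα = 0`,
in every smooth chart. -/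
def IsHypersurfaceOrthogonal (g : LorentzMetric M)
    (X : ∀ p : M, TangentSpace 𝓘(ℝ, Coord4) p) : Prop :=
  ∀ φ ∈ IsManifold.maximalAtlas 𝓘(ℝ, Coord4) ∞ M, ∀ z ∈ φ.target, ∀ u v w : Coord4,
    dualFormInChart g X φ z u * extDerivOneForm (dualFormInChart g X φ) z v w
      + dualFormInChart g X φ z v * extDerivOneForm (dualFormInChart g X φ) z w u
      + dualFormInChart g X φ z w * extDerivOneForm (dualFormInChart g X φ) z u v = 0

/-- `X` is a (smooth) hypersurface-orthogonal timelike Killing vector field of `g`. -/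
structure IsHSOTimelikeKilling (g : LorentzMetric M)
    (X : ∀ p : M, TangentSpace 𝓘(ℝ, Coord4) p) : Prop where
  smooth : ContMDiff 𝓘(ℝ, Coord4) 𝓘(ℝ, Coord4).tangent ∞
    (fun p ↦ (⟨p, X p⟩ : TangentBundle 𝓘(ℝ, Coord4) M))
  timelike : ∀ p, g.val p (X p) (X p) < 0
  killing : IsKillingField g X
  hypersurfaceOrthogonal : IsHypersurfaceOrthogonal g X

/-- `φ = (t, X)` is a smooth chart in which `K = ∂/∂t` and `g = V(X)² (-dt² + h(X))`, where `V` is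
a positive function and `h` a Riemannian metric of the spatial coordinates `X` alone.
Then `h` is the optical metric of `K` in the domain of this chart. -/
structure IsStaticChart (g : LorentzMetric M) (K : ∀ p : M, TangentSpace 𝓘(ℝ, Coord4) p)
    (φ : OpenPartialHomeomorph M Coord4) (V : Coord3 → ℝ)
    (h : Coord3 → Coord3 →L[ℝ] Coord3 →L[ℝ] ℝ) : Prop where
  mem_atlas : φ ∈ IsManifold.maximalAtlas 𝓘(ℝ, Coord4) ∞ M
  field_eq : ∀ z ∈ φ.target, fieldInChart K φ z = (1, 0)
  metric_eq : ∀ z ∈ φ.target, ∀ u v : Coord4,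
    g.inChart φ z u v = V z.2 ^ 2 * (-(u.1 * v.1) + h z.2 u.2 v.2)
  potential_pos : ∀ z ∈ φ.target, 0 < V z.2
  potential_smooth : ContDiffOn ℝ ∞ V (Prod.snd '' φ.target)
  riemannian : IsRiemannianOn h (Prod.snd '' φ.target)

/-- `g` is ultra-static with respect to `K`: around every point there are coordinates in which
`K = ∂/∂t` and `g = -dt² + h`, with `h` a Riemannian metric of the spatial coordinates. -/
def IsUltraStatic (g : LorentzMetric M) (K : ∀ p : M, TangentSpace 𝓘(ℝ, Coord4) p) : Prop :=
  ∀ p : M, ∃ (φ : OpenPartialHomeomorph M Coord4) (h : Coord3 → Coord3 →L[ℝ] Coord3 →L[ℝ] ℝ),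
    p ∈ φ.source ∧ IsStaticChart g K φ (fun _ ↦ 1) h

/-- The metric `dr² + γ(x, y)`. -/
def productMetric (γ : Coord2 → Coord2 →L[ℝ] Coord2 →L[ℝ] ℝ) (X : Coord3) :
    Coord3 →L[ℝ] Coord3 →L[ℝ] ℝ :=
  (ContinuousLinearMap.mul ℝ ℝ).bilinearComp
      (ContinuousLinearMap.fst ℝ ℝ Coord2) (ContinuousLinearMap.fst ℝ ℝ Coord2)
    + (γ X.2).bilinearComp (ContinuousLinearMap.snd ℝ ℝ Coord2) (ContinuousLinearMap.snd ℝ ℝ Coord2)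

/-- The metric `r⁻² (dr² + γ(x, y))`. -/
def boostOpticalMetric (γ : Coord2 → Coord2 →L[ℝ] Coord2 →L[ℝ] ℝ) (X : Coord3) :
    Coord3 →L[ℝ] Coord3 →L[ℝ] ℝ :=
  (X.1 ^ 2)⁻¹ • productMetric γ X

/-- The Euclidean metric `dx² + dy²`. -/
def euclideanMetric2 (_ : Coord2) : Coord2 →L[ℝ] Coord2 →L[ℝ] ℝ :=
  (ContinuousLinearMap.mul ℝ ℝ).bilinearComp
      (ContinuousLinearMap.fst ℝ ℝ ℝ) (ContinuousLinearMap.fst ℝ ℝ ℝ)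
    + (ContinuousLinearMap.mul ℝ ℝ).bilinearComp
      (ContinuousLinearMap.snd ℝ ℝ ℝ) (ContinuousLinearMap.snd ℝ ℝ ℝ)

theorem productMetric_apply (γ : Coord2 → Coord2 →L[ℝ] Coord2 →L[ℝ] ℝ) (X u v : Coord3) :
    productMetric γ X u v = u.1 * v.1 + γ X.2 u.2 v.2 := rfl

theorem euclideanMetric2_apply (X u v : Coord2) :
    euclideanMetric2 X u v = u.1 * v.1 + u.2 * v.2 := rfl

/-- `(M, g)` is locally Minkowski space, with `K` its time translation: around every point there
are coordinates in which `K = ∂/∂T` and `g = -dT² + dX² + dY² + dZ²`. -/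
def IsLocallyMinkowski (g : LorentzMetric M) (K : ∀ p : M, TangentSpace 𝓘(ℝ, Coord4) p) : Prop :=
  ∀ p : M, ∃ φ : OpenPartialHomeomorph M Coord4,
    p ∈ φ.source ∧ IsStaticChart g K φ (fun _ ↦ 1) (productMetric euclideanMetric2)

end

/-! A Killing field `X` has skew covariant derivative, and closedness of `X♭` makes that derivative
symmetric. A Killing field with closed dual form is therefore parallel, and this pair of first-order
conditions stands in for a connection throughout. `K` is such a field, since `K♭ = -dt`. Inner
products of parallel fields are constant (`IsParallel.val_eq`). Bracketing with a Killing field `ζ`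
sends parallel fields to parallel fields (`IsParallel.mlieBracket`) and acts on them
skew-symmetrically (`IsParallel.val_mlieBracket_add`).

A parallel unit field `R` orthogonal to `K` exists (`exists_isUnitParallel`). If `[ξ, K] ≠ 0`, this
bracket is parallel and orthogonal to `K`, and is normalised. If `[ξ, K] = 0`, then `dξ♭(K, ·) =
-2[ξ, K]♭ = 0`; inserting `K` into `ξ♭ ∧ dξ♭ = 0` leaves `g(ξ, K) dξ♭ = 0` with `g(ξ, K) ≠ 0`. So
`ξ` is parallel, and its part orthogonal to `K` is nonzero because `ξ` is not a multiple of `K`.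
Straightening `R` splits the metric locally as `-dt² + dr² + γ(x, y)` (`exists_isSplitChart`).

If a second parallel unit field is orthogonal to `K` and `R`, it gives a unit Killing field with
closed dual form for `γ`. Primitives of its dual form and of the Hodge dual are then Euclidean
coordinates (`isLocallyMinkowski_of_isUnitParallel`).

Otherwise `K` and `R` span the parallel fields, and skewness forces `[ζ, K] = -aR` and `[ζ, R] =
-aK` for every admissible `ζ`. Integration gives `ζ = (a r + b) ∂_t + (a t + c) ∂_r` plus an `(x,
y)` part, which hypersurface orthogonality removes (`IsHSOTimelikeKilling.exists_fieldInChart_eq`).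
For `a = 0` a Lorentz boost makes `ζ` a multiple of a time translation; for `a ≠ 0` Rindler
coordinates about the centre of the boost give the second optical metric. -/

/-! ### Smooth dependence of flows on initial data -/

section Analysis

open Set Metric
open scoped Topology unitInterval

/-- The inverse function theorem on a whole neighbourhood, for `C^∞` maps of Banach spaces. -/
theorem exists_openPartialHomeomorph_of_contDiffOn {E F : Type*} [NormedAddCommGroup E]
    [NormedSpace ℝ E] [CompleteSpace E] [NormedAddCommGroup F] [NormedSpace ℝ F]
    {f : E → F} {U : Set E} (hU : IsOpen U) (hf : ContDiffOn ℝ ∞ f U) {p : E} (hp : p ∈ U)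
    (f' : E ≃L[ℝ] F) (hf' : HasFDerivAt f (f' : E →L[ℝ] F) p) :
    ∃ e : OpenPartialHomeomorph E F, p ∈ e.source ∧ e.source ⊆ U ∧ (e : E → F) = f ∧
      ContDiffOn ℝ ∞ e.symm e.target := by
  have hfp : ContDiffAt ℝ ∞ f p := hf.contDiffAt (hU.mem_nhds hp)
  set e₀ := hfp.toOpenPartialHomeomorph f hf' (by simp) with he₀
  have hcont : ContinuousOn (fderiv ℝ f) U := hf.continuousOn_fderiv_of_isOpen hU (by simp)
  -- Restricting to points where the derivative is invertible makes the inverse smooth on the whole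
  -- target, not only at the image of `p`.
  set N := {x ∈ U | fderiv ℝ f x ∈ interior (range ((↑) : (E ≃L[ℝ] F) → E →L[ℝ] F))} with hN
  have hNo : IsOpen N := hcont.isOpen_inter_preimage hU isOpen_interior
  have hpN : p ∈ N := by
    refine ⟨hp, ?_⟩
    rw [hf'.fderiv]
    exact mem_interior_iff_mem_nhds.2 f'.nhds
  refine ⟨e₀.restrOpen N hNo, ⟨ContDiffAt.mem_toOpenPartialHomeomorph_source _ _ _, hpN⟩,
    fun x hx ↦ hx.2.1, rfl, ?_⟩
  intro y hy
  have hy' := (e₀.restrOpen N hNo).map_target hy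
  obtain ⟨hxU, hxN⟩ := hy'.2
  obtain ⟨g, hg⟩ := interior_subset hxN
  have hfx : ContDiffAt ℝ ∞ f ((e₀.restrOpen N hNo).symm y) := hf.contDiffAt (hU.mem_nhds hxU)
  refine (OpenPartialHomeomorph.contDiffAt_symm (e₀.restrOpen N hNo) (f₀' := g) hy ?_ hfx
    ).contDiffWithinAt
  rw [hg]
  exact (hfx.differentiableAt (by simp)).hasFDerivAt

/-- Pointwise application of a continuous family of linear maps to a continuous function. -/
noncomputable def ContinuousMap.clmApplyL (K E F : Type*) [TopologicalSpace K] [CompactSpace K]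
    [NormedAddCommGroup E] [NormedSpace ℝ E] [NormedAddCommGroup F] [NormedSpace ℝ F] :
    C(K, E →L[ℝ] F) →L[ℝ] C(K, E) →L[ℝ] C(K, F) :=
  LinearMap.mkContinuous₂
    (LinearMap.mk₂ ℝ (fun (A : C(K, E →L[ℝ] F)) (c : C(K, E)) ↦
        (⟨fun s ↦ A s (c s), by fun_prop⟩ : C(K, F)))
      (fun _ _ _ ↦ by ext; simp) (fun _ _ _ ↦ by ext; simp)
      (fun _ _ _ ↦ by ext; simp) (fun _ _ _ ↦ by ext; simp)) 1
    (fun A c ↦ by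
      rw [one_mul, ContinuousMap.norm_le _ (by positivity)]
      exact fun s ↦ (A s).le_of_opNorm_le_of_le (A.norm_coe_le_norm s) (c.norm_coe_le_norm s))

/-- The mean value inequality is applied on each segment from `c s` to `c s + η s`. The bound is
uniform in `s` because `d ↦ f' ∘ d` is continuous for the sup norm. -/
theorem ContinuousMap.hasFDerivAt_postcomp {K E F : Type*} [TopologicalSpace K] [CompactSpace K]
    [NormedAddCommGroup E] [NormedSpace ℝ E] [NormedAddCommGroup F] [NormedSpace ℝ F]
    (f : C(E, F)) (f' : C(E, E →L[ℝ] F)) (hf : ∀ x, HasFDerivAt f (f' x) x) (c : C(K, E)) :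
    HasFDerivAt (fun c : C(K, E) ↦ f.comp c) (clmApplyL K E F (f'.comp c)) c := by
  rw [hasFDerivAt_iff_isLittleO_nhds_zero, Asymptotics.isLittleO_iff]
  intro ε hε
  have hcont : ContinuousAt (fun d : C(K, E) ↦ f'.comp d) c :=
    (ContinuousMap.continuous_postcomp f').continuousAt
  obtain ⟨δ, hδ, hδε⟩ := Metric.continuousAt_iff (α := C(K, E)) (β := C(K, E →L[ℝ] F)) |>.1
    hcont ε hε
  filter_upwards [Metric.ball_mem_nhds (0 : C(K, E)) hδ] with η hη
  rw [mem_ball_zero_iff] at hη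
  rw [ContinuousMap.norm_le _ (by positivity)]
  intro s
  have key : ∀ y ∈ segment ℝ (c s) (c s + η s), ‖f' y - f' (c s)‖ ≤ ε := by
    intro y hy
    rw [segment_eq_image'] at hy
    obtain ⟨θ, hθ, rfl⟩ := hy
    have h1 : dist (c + θ • η) c < δ := by
      rw [dist_eq_norm, add_sub_cancel_left, norm_smul, Real.norm_of_nonneg hθ.1]
      exact (mul_le_of_le_one_left (norm_nonneg _) hθ.2).trans_lt hη
    have h2 := (ContinuousMap.dist_apply_le_dist s).trans (hδε h1).le
    rw [dist_eq_norm] at h2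
    simpa using h2
  have h3 := (convex_segment (c s) (c s + η s)).norm_image_sub_le_of_norm_hasFDerivWithin_le'
    (fun y _ ↦ (hf y).hasFDerivWithinAt) key (left_mem_segment ℝ _ _) (right_mem_segment ℝ _ _)
  rw [add_sub_cancel_left] at h3
  exact h3.trans (by gcongr; exact η.norm_coe_le_norm s)

/-- The derivative is again a postcomposition, by `f'`, followed by a bounded linear map, so the
order drops by one. `E` and `F` share a universe so that the induction hypothesis applies to the
target `E →L[ℝ] F`. -/
theorem ContinuousMap.contDiff_postcomp.{u} {K : Type*} [TopologicalSpace K] [CompactSpace K]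
    {E : Type u} [NormedAddCommGroup E] [NormedSpace ℝ E] (n : ℕ) :
    ∀ {F : Type u} [NormedAddCommGroup F] [NormedSpace ℝ F] (f : C(E, F)), ContDiff ℝ n f →
      ContDiff ℝ n (fun c : C(K, E) ↦ f.comp c) := by
  induction n with
  | zero =>
    intro F _ _ f _
    exact contDiff_zero.2 (ContinuousMap.continuous_postcomp f)
  | succ n ih =>
    intro F _ _ f hf
    obtain ⟨f', hf', hd⟩ := contDiff_succ_iff_hasFDerivAt.1 hf
    let f'c : C(E, E →L[ℝ] F) := ⟨f', hf'.continuous⟩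
    refine contDiff_succ_iff_hasFDerivAt.2 ⟨fun c ↦ clmApplyL K E F (f'c.comp c), ?_,
      fun c ↦ hasFDerivAt_postcomp f f'c hd c⟩
    exact (clmApplyL K E F).contDiff.comp (ih f'c hf')

/-- The primitive vanishing at `0` of a continuous function on the unit interval. -/
noncomputable def ContinuousMap.primitiveL (E : Type*) [NormedAddCommGroup E] [NormedSpace ℝ E] :
    C(I, E) →L[ℝ] C(I, E) :=
  LinearMap.mkContinuous
    { toFun := fun c ↦ ⟨fun s ↦ ∫ x in (0 : ℝ)..s, Set.IccExtend zero_le_one c x, by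
        exact (intervalIntegral.continuous_primitive (fun a b ↦
          (c.continuous.Icc_extend' (h := zero_le_one)).intervalIntegrable a b) 0).comp
            continuous_subtype_val⟩
      map_add' := fun c d ↦ by
        ext s
        exact intervalIntegral.integral_add
          ((c.continuous.Icc_extend' (h := zero_le_one)).intervalIntegrable _ _)
          ((d.continuous.Icc_extend' (h := zero_le_one)).intervalIntegrable _ _)
      map_smul' := fun a c ↦ by
        ext s
        exact intervalIntegral.integral_smul a _ } 1
    (fun c ↦ by
      rw [one_mul, ContinuousMap.norm_le _ (by positivity)]
      intro s
      refine (intervalIntegral.norm_integral_le_of_norm_le_const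
        (fun x _ ↦ c.norm_coe_le_norm (projIcc 0 1 zero_le_one x))).trans ?_
      rw [sub_zero, abs_of_nonneg s.2.1]
      exact mul_le_of_le_one_right (norm_nonneg _) s.2.2)

theorem ContinuousMap.primitiveL_apply {E : Type*} [NormedAddCommGroup E] [NormedSpace ℝ E]
    (c : C(I, E)) (s : I) :
    primitiveL E c s = ∫ x in (0 : ℝ)..s, Set.IccExtend zero_le_one c x := rfl

/-- The local flow of a `C^∞` vector field on a Banach space is `C^∞`. -/
theorem exists_contDiffOn_flow {E : Type*} [NormedAddCommGroup E] [NormedSpace ℝ E]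
    [CompleteSpace E] {v : E → E} (hv : ContDiff ℝ ∞ v) (p : E) :
    ∃ (α : E × ℝ → E), ∃ m > 0, ContDiffOn ℝ ∞ α (ball p m ×ˢ ball 0 m) ∧
      (∀ x ∈ ball p m, α (x, 0) = x) ∧
      ∀ x ∈ ball p m, ∀ t ∈ ball (0 : ℝ) m,
        HasDerivAt (fun s ↦ α (x, s)) (v (α (x, t))) t := by
  obtain ⟨ε, hε, a, r, _, _, hr, hpl⟩ :=
    IsPicardLindelof.of_contDiffAt_one (hv.contDiffAt (x := p) |>.of_le (by simp))
  obtain ⟨α, hα, hαc⟩ :=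
    (hpl 0).exists_forall_mem_closedBall_eq_hasDerivWithinAt_continuousOn
  simp only [zero_sub, zero_add] at hα hαc
  have hr' : (0 : ℝ) < r := hr
  let vc : C(E, E) := ⟨v, hv.continuous⟩
  let cst : E →L[ℝ] C(I, E) := ContinuousLinearMap.const ℝ I
  -- The rescaled orbit `c(s) = α(x, st)` solves `c = x + t ∫ v(c)`, that is, `P (x, t, c) = (x, t,
  -- 0)`. Inverting `P` near the constant curve at `t = 0` gives `c` smoothly in `(x, t)`, and `α(x,
  -- t) = c(1)`.
  let P : E × ℝ × C(I, E) → E × ℝ × C(I, E) := fun q ↦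
    (q.1, q.2.1, q.2.2 - cst q.1 - q.2.1 • ContinuousMap.primitiveL E (vc.comp q.2.2))
  have hcomp : ContDiff ℝ ∞ (fun c : C(I, E) ↦ vc.comp c) :=
    contDiff_infty.2 fun n ↦ ContinuousMap.contDiff_postcomp n vc (hv.of_le (by exact_mod_cast le_top))
  have hP : ContDiff ℝ ∞ P := by
    refine contDiff_fst.prodMk (contDiff_snd.fst.prodMk ?_)
    refine (contDiff_snd.snd.sub (cst.contDiff.comp contDiff_fst)).sub (contDiff_snd.fst.smul ?_)
    exact (ContinuousMap.primitiveL E).contDiff.comp (hcomp.comp contDiff_snd.snd)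
  set w := ContinuousMap.primitiveL E (vc.comp (cst p)) with hw
  let π₁ := ContinuousLinearMap.fst ℝ E (ℝ × C(I, E))
  let π₂ := (ContinuousLinearMap.fst ℝ ℝ C(I, E)).comp (ContinuousLinearMap.snd ℝ E (ℝ × C(I, E)))
  let π₃ := (ContinuousLinearMap.snd ℝ ℝ C(I, E)).comp (ContinuousLinearMap.snd ℝ E (ℝ × C(I, E)))
  -- At `t = 0` the derivative of `t ∫ v(c)` only sees the increment of `t`, so the derivative of
  -- `P` is a shear with explicit inverse.
  let P' : (E × ℝ × C(I, E)) ≃L[ℝ] (E × ℝ × C(I, E)) := ContinuousLinearEquiv.equivOfInverse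
    (π₁.prod (π₂.prod (π₃ - cst.comp π₁ - π₂.smulRight w)))
    (π₁.prod (π₂.prod (π₃ + cst.comp π₁ + π₂.smulRight w)))
    (fun q ↦ Prod.ext rfl (Prod.ext rfl (by simp [π₁, π₂, π₃]; abel)))
    (fun q ↦ Prod.ext rfl (Prod.ext rfl (by simp [π₁, π₂, π₃]; abel)))
  have hP' : HasFDerivAt P (P' : (E × ℝ × C(I, E)) →L[ℝ] (E × ℝ × C(I, E))) (p, 0, cst p) := by
    refine π₁.hasFDerivAt.prodMk (π₂.hasFDerivAt.prodMk
      ((π₃.hasFDerivAt.sub (cst.comp π₁).hasFDerivAt).sub ?_))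
    have h1 : HasFDerivAt (fun q : E × ℝ × C(I, E) ↦ ContinuousMap.primitiveL E (vc.comp q.2.2))
        _ (p, 0, cst p) :=
      (((ContinuousMap.primitiveL E).contDiff.comp (hcomp.comp contDiff_snd.snd)).differentiable
        (by simp) _).hasFDerivAt
    have h2 := π₂.hasFDerivAt (x := (p, 0, cst p)).smul h1
    refine h2.congr_fderiv ?_
    ext q <;> simp [π₂, hw]
  obtain ⟨e, hpe, -, heP, hes⟩ := exists_openPartialHomeomorph_of_contDiffOn isOpen_univ
    hP.contDiffOn (mem_univ _) P' hP'
  obtain ⟨δ, hδ, hδe⟩ := Metric.isOpen_iff.1 e.open_source _ hpe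
  have hεm : (p, (0 : ℝ)) ∈ closedBall p r ×ˢ Icc (-ε) ε :=
    ⟨mem_closedBall_self hr'.le, by constructor <;> linarith⟩
  -- Orbits starting near `p` must lie in the region where `P` is injective. Asking for `δ / 2`
  -- keeps the supremum over the curve strictly below `δ`.
  obtain ⟨η, hη, hηδ⟩ := Metric.continuousWithinAt_iff.1 (hαc _ hεm) (δ / 2) (by positivity)
  have hαp : α (p, 0) = p := (hα p (mem_closedBall_self hr'.le)).1
  set m := min (min η δ) (min r ε) with hm
  have hm0 : 0 < m := by positivity
  have hmη : m ≤ η := (min_le_left _ _).trans (min_le_left _ _)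
  have hmδ : m ≤ δ := (min_le_left _ _).trans (min_le_right _ _)
  have hmr : m ≤ r := (min_le_right _ _).trans (min_le_left _ _)
  have hmε : m ≤ ε := (min_le_right _ _).trans (min_le_right _ _)
  have hder : ∀ x ∈ ball p m, ∀ t ∈ ball (0 : ℝ) m,
      HasDerivAt (fun s ↦ α (x, s)) (v (α (x, t))) t := by
    intro x hx t ht
    rw [mem_ball_zero_iff, Real.norm_eq_abs, abs_lt] at ht
    exact ((hα x (ball_subset_closedBall (ball_subset_ball hmr hx))).2 t
      ⟨by linarith [ht.1], by linarith [ht.2]⟩).hasDerivAt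
        (Icc_mem_nhds (by linarith [ht.1]) (by linarith [ht.2]))
  have hinit : ∀ x ∈ ball p m, α (x, 0) = x := fun x hx ↦
    (hα x (ball_subset_closedBall (ball_subset_ball hmr hx))).1
  have hscale : ∀ t ∈ ball (0 : ℝ) m, ∀ s ∈ Icc (0 : ℝ) 1, s * t ∈ ball (0 : ℝ) m := by
    intro t ht s hs
    rw [mem_ball_zero_iff] at ht ⊢
    rw [norm_mul, Real.norm_of_nonneg hs.1]
    exact (mul_le_of_le_one_left (norm_nonneg _) hs.2).trans_lt ht
  have hcurve : ∀ x ∈ ball p m, ∀ t ∈ ball (0 : ℝ) m,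
      (x, t, (0 : C(I, E))) ∈ e.target ∧
        (e.symm (x, t, 0)).2.2 1 = α (x, t) := by
    intro x hx t ht
    have hd : ∀ s ∈ Icc (0 : ℝ) 1,
        HasDerivAt (fun s ↦ α (x, s * t)) (t • v (α (x, s * t))) s := fun s hs ↦ by
      have := (hder x hx _ (hscale t ht s hs)).scomp s (hasDerivAt_mul_const t)
      exact this
    let c : C(I, E) := ⟨fun s ↦ α (x, s * t), by
      rw [continuous_iff_continuousAt]
      intro s
      exact (hd s s.2).continuousAt.comp continuous_subtype_val.continuousAt⟩
    have hce : (x, t, c) ∈ e.source := by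
      apply hδe
      rw [mem_ball, Prod.dist_eq, Prod.dist_eq]
      refine max_lt (hx.trans_le hmδ) (max_lt (lt_of_lt_of_le ht hmδ) ?_)
      refine lt_of_le_of_lt ?_ (half_lt_self hδ)
      rw [ContinuousMap.dist_le (by positivity)]
      intro s
      have hst := hscale t ht s s.2
      have h1 : (x, (s : ℝ) * t) ∈ closedBall p r ×ˢ Icc (-ε) ε := by
        refine ⟨ball_subset_closedBall (ball_subset_ball hmr hx), ?_⟩
        rw [mem_ball_zero_iff, Real.norm_eq_abs, abs_lt] at hst
        exact ⟨by linarith [hst.1], by linarith [hst.2]⟩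
      have h2 : dist (x, (s : ℝ) * t) (p, 0) < η := by
        rw [Prod.dist_eq]
        exact max_lt (lt_of_lt_of_le hx hmη) (lt_of_lt_of_le hst hmη)
      have h3 := hηδ h1 h2
      rw [hαp] at h3
      exact h3.le
    have hPc : e (x, t, c) = (x, t, 0) := by
      rw [heP]
      refine Prod.ext rfl (Prod.ext rfl ?_)
      ext s
      change α (x, s * t) - x - t • ContinuousMap.primitiveL E (vc.comp c) s = 0
      rw [ContinuousMap.primitiveL_apply, ← intervalIntegral.integral_smul]
      have hsub : ∀ y ∈ uIcc (0 : ℝ) s, y ∈ Icc (0 : ℝ) 1 := fun y hy ↦ by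
        rw [uIcc_of_le s.2.1] at hy
        exact ⟨hy.1, hy.2.trans s.2.2⟩
      have hFTC := intervalIntegral.integral_eq_sub_of_hasDerivAt
        (f := fun s ↦ α (x, s * t))
        (f' := fun y ↦ t • IccExtend zero_le_one (vc.comp c) y) (a := 0) (b := s)
        (fun y hy ↦ by
          have := hd y (hsub y hy)
          rwa [IccExtend_of_mem _ _ (hsub y hy)])
        (((vc.comp c).continuous.Icc_extend' (h := zero_le_one)).const_smul t
          |>.intervalIntegrable _ _)
      rw [hFTC]
      simp [hinit x hx]
    have hsymm : e.symm (x, t, 0) = (x, t, c) := by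
      rw [← hPc, e.left_inv hce]
    refine ⟨hPc ▸ e.map_source hce, ?_⟩
    rw [hsymm]
    simp [c]
  refine ⟨α, m, hm0, ?_, hinit, hder⟩
  have hsm : ContDiffOn ℝ ∞ (fun q : E × ℝ ↦ (e.symm (q.1, q.2, 0)).2.2 1)
      (ball p m ×ˢ ball 0 m) := by
    have h1 : ContDiffOn ℝ ∞ (fun q : E × ℝ ↦ e.symm (q.1, q.2, 0)) (ball p m ×ˢ ball 0 m) :=
      hes.comp (contDiff_fst.prodMk (contDiff_snd.prodMk contDiff_const)).contDiffOn
        fun q hq ↦ (hcurve q.1 hq.1 q.2 hq.2).1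
    exact (ContinuousMap.evalCLM ℝ (1 : I)).contDiff.comp_contDiffOn h1.snd.snd
  exact hsm.congr fun q hq ↦ ((hcurve q.1 hq.1 q.2 hq.2).2).symm

end Analysis

/-! ### Local flows and straightening of vector fields -/

section Analysis

open Set Metric
open scoped Topology

/-- A `C^∞` vector field on an open set agrees near a point with a globally defined one. -/
theorem exists_contDiff_eqOn_closedBall {E F : Type*} [NormedAddCommGroup E] [NormedSpace ℝ E]
    [FiniteDimensional ℝ E] [NormedAddCommGroup F] [NormedSpace ℝ F] {R : E → F} {U : Set E}
    (hU : IsOpen U) (hR : ContDiffOn ℝ ∞ R U) {p : E} (hp : p ∈ U) :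
    ∃ v : E → F, ContDiff ℝ ∞ v ∧ ∃ δ > 0, closedBall p δ ⊆ U ∧ EqOn v R (closedBall p δ) := by
  obtain ⟨r, hr, hrU⟩ := Metric.nhds_basis_closedBall.mem_iff.1 (hU.mem_nhds hp)
  let χ : ContDiffBump p := ⟨r / 2, r, by positivity, by linarith⟩
  refine ⟨fun z ↦ χ z • R z, ?_, r / 2, by positivity,
    (closedBall_subset_closedBall (by linarith)).trans hrU, fun z hz ↦ ?_⟩
  · rw [contDiff_iff_contDiffAt]
    intro z
    by_cases hz : z ∈ U
    · exact χ.contDiff.contDiffAt.smul (hR.contDiffAt (hU.mem_nhds hz))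
    · have hz' : z ∉ tsupport χ := by
        rw [χ.tsupport_eq]
        exact fun h ↦ hz (hrU h)
      refine (contDiffAt_const (c := (0 : F))).congr_of_eventuallyEq ?_
      filter_upwards [(isClosed_tsupport χ).isOpen_compl.mem_nhds hz'] with y hy
      rw [image_eq_zero_of_notMem_tsupport hy, zero_smul]
  · simp only
    rw [χ.one_of_mem_closedBall hz, one_smul]

/-- The `C^∞` local flow of a `C^∞` vector field on an open set. -/
theorem exists_contDiffOn_localFlow {E : Type*} [NormedAddCommGroup E] [NormedSpace ℝ E]
    [FiniteDimensional ℝ E] {R : E → E} {U : Set E} (hU : IsOpen U) (hR : ContDiffOn ℝ ∞ R U)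
    {p : E} (hp : p ∈ U) :
    ∃ α : E × ℝ → E, ∃ m > 0, ContDiffOn ℝ ∞ α (ball p m ×ˢ ball 0 m) ∧
      (∀ x ∈ ball p m, α (x, 0) = x) ∧
      ∀ x ∈ ball p m, ∀ t ∈ ball (0 : ℝ) m,
        α (x, t) ∈ U ∧ HasDerivAt (fun s ↦ α (x, s)) (R (α (x, t))) t := by
  have : CompleteSpace E := FiniteDimensional.complete ℝ E
  obtain ⟨v, hv, δ, hδ, hδU, hvR⟩ := exists_contDiff_eqOn_closedBall hU hR hp
  obtain ⟨α, m, hm, hα, hα0, hαd⟩ := exists_contDiffOn_flow hv p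
  have hopen : IsOpen (ball p m ×ˢ ball (0 : ℝ) m) := isOpen_ball.prod isOpen_ball
  have hmem : (p, (0 : ℝ)) ∈ ball p m ×ˢ ball (0 : ℝ) m := ⟨mem_ball_self hm, mem_ball_self hm⟩
  have hN : α ⁻¹' (ball p δ) ∈ 𝓝 (p, (0 : ℝ)) := by
    refine (hα.continuousOn.continuousAt (hopen.mem_nhds hmem)).preimage_mem_nhds ?_
    rw [hα0 p hmem.1]
    exact ball_mem_nhds p hδ
  obtain ⟨m', hm', hm'N⟩ := Metric.mem_nhds_iff.1 hN
  rw [← ball_prod_same] at hm'N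
  have hsub : ∀ {F : Type _} [NormedAddCommGroup F] (x : F), ball x (min m m') ⊆ ball x m :=
    fun x ↦ ball_subset_ball (min_le_left _ _)
  refine ⟨α, min m m', lt_min hm hm', hα.mono (prod_mono (hsub _)
    (ball_subset_ball (min_le_left _ _))), fun x hx ↦ hα0 x (hsub _ hx), fun x hx t ht ↦ ?_⟩
  have hin : α (x, t) ∈ closedBall p δ := ball_subset_closedBall
    (hm'N ⟨ball_subset_ball (min_le_right _ _) hx, ball_subset_ball (min_le_right _ _) ht⟩)
  refine ⟨hδU hin, ?_⟩
  rw [← hvR hin]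
  exact hαd x (hsub _ hx) t (ball_subset_ball (min_le_left _ _) ht)

/-- Straightening of a vector field `R`: near every point there are coordinates `(r, u)` in which
`R = ∂/∂r`, where `r` is a given function with `dr(R) = 1`. -/
theorem exists_straightening {F : Type*} [NormedAddCommGroup F] [NormedSpace ℝ F]
    [FiniteDimensional ℝ F] {R : ℝ × F → ℝ × F} {ρ : ℝ × F → ℝ} {U : Set (ℝ × F)} (hU : IsOpen U)
    (hR : ContDiffOn ℝ ∞ R U) (hρ : ContDiffOn ℝ ∞ ρ U)
    (hρR : ∀ z ∈ U, fderiv ℝ ρ z (R z) = 1) {p : ℝ × F} (hp : p ∈ U) :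
    ∃ e : OpenPartialHomeomorph (ℝ × F) (ℝ × F), p ∈ e.source ∧ e.source ⊆ U ∧
      ContDiffOn ℝ ∞ e e.source ∧ ContDiffOn ℝ ∞ e.symm e.target ∧
      (∀ z ∈ e.source, (e z).1 = ρ z) ∧
      ∀ z ∈ e.target, fderiv ℝ e.symm z (1, 0) = R (e.symm z) := by
  obtain ⟨α, m, hm, hα, hα0, hαd⟩ := exists_contDiffOn_localFlow hU hR hp
  have hmU : ball p m ⊆ U := fun x hx ↦ by
    have := (hαd x hx 0 (mem_ball_self hm)).1
    rwa [hα0 x hx] at this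
  have hρd : ∀ z ∈ U, HasFDerivAt ρ (fderiv ℝ ρ z) z := fun z hz ↦
    ((hρ.contDiffAt (hU.mem_nhds hz)).differentiableAt (by simp)).hasFDerivAt
  have hRp : R p ≠ 0 := by
    intro h
    have := hρR p hp
    rw [h, map_zero] at this
    exact zero_ne_one this
  -- Since `A (1, 0) = R p`, the slice `p + A (0, u)` is transverse to `R` at `p`.
  obtain ⟨A, hA⟩ := SeparatingDual.exists_continuousLinearEquiv_apply_eq (R := ℝ)
    (x := ((1, 0) : ℝ × F)) (y := R p) (by simp) hRp
  have hρα : ∀ x ∈ ball p m, ∀ t ∈ ball (0 : ℝ) m, ρ (α (x, t)) = ρ x + t := by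
    intro x hx t ht
    have hd : ∀ s ∈ ball (0 : ℝ) m, HasDerivAt (fun s ↦ ρ (α (x, s)) - s) 0 s := by
      intro s hs
      have h1 := (hρd _ (hαd x hx s hs).1).comp_hasDerivAt s (hαd x hx s hs).2
      rw [hρR _ (hαd x hx s hs).1] at h1
      have h2 := h1.sub (hasDerivAt_id s)
      rw [sub_self] at h2
      exact h2
    have := isOpen_ball.is_const_of_deriv_eq_zero (convex_ball (0 : ℝ) m).isPreconnected
      (fun s hs ↦ (hd s hs).differentiableAt.differentiableWithinAt)
      (fun s hs ↦ (hd s hs).deriv) ht (mem_ball_self hm)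
    simp only [hα0 x hx] at this
    linarith
  let σ : ℝ × F → ℝ × F := fun q ↦ p + A (0, q.2)
  have hσ : ContDiff ℝ ∞ σ := contDiff_const.add (A.contDiff.comp (contDiff_const.prodMk contDiff_snd))
  set V := σ ⁻¹' ball p m with hV
  have hVo : IsOpen V := isOpen_ball.preimage hσ.continuous
  have hρσ : ContDiffOn ℝ ∞ (fun q ↦ q.1 - ρ (σ q)) V :=
    contDiffOn_fst.sub (hρ.comp hσ.contDiffOn fun q hq ↦ hmU hq)
  set Ω := V ∩ (fun q ↦ q.1 - ρ (σ q)) ⁻¹' ball 0 m with hΩ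
  have hΩo : IsOpen Ω := hρσ.continuousOn.isOpen_inter_preimage hVo isOpen_ball
  -- Flow from the slice point `σ` for time `r - ρ(σ)`. As `ρ` grows at unit speed along `R`, this
  -- gives `ρ ∘ Ψ = r`; the required coordinates are a local inverse of `Ψ`.
  let Ψ : ℝ × F → ℝ × F := fun q ↦ α (σ q, q.1 - ρ (σ q))
  have hΨ : ContDiffOn ℝ ∞ Ψ Ω :=
    hα.comp (hσ.contDiffOn.prodMk (hρσ.mono inter_subset_left)) fun q hq ↦ ⟨hq.1, hq.2⟩
  set q₀ : ℝ × F := (ρ p, 0) with hq₀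
  have hσ0 : σ q₀ = p := by simp [σ, q₀]
  have hq₀Ω : q₀ ∈ Ω := by
    refine ⟨?_, ?_⟩
    · rw [hV, mem_preimage, hσ0]
      exact mem_ball_self hm
    · simp [hσ0, q₀, hm]
  have hΨ0 : Ψ q₀ = p := by
    simp only [Ψ, hσ0, q₀, sub_self]
    exact hα0 p (mem_ball_self hm)
  let l : F →L[ℝ] ℝ := (fderiv ℝ ρ p).comp ((A : (ℝ × F) →L[ℝ] ℝ × F).comp
    (ContinuousLinearMap.inr ℝ ℝ F))
  -- The derivative of `Ψ` at the base point is `A` after this shear; the shear comes from the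
  -- variation of `ρ` along the slice.
  let S : (ℝ × F) ≃L[ℝ] (ℝ × F) := ContinuousLinearEquiv.equivOfInverse
    ((ContinuousLinearMap.fst ℝ ℝ F - l.comp (ContinuousLinearMap.snd ℝ ℝ F)).prod
      (ContinuousLinearMap.snd ℝ ℝ F))
    ((ContinuousLinearMap.fst ℝ ℝ F + l.comp (ContinuousLinearMap.snd ℝ ℝ F)).prod
      (ContinuousLinearMap.snd ℝ ℝ F))
    (fun q ↦ Prod.ext (by simp) rfl) (fun q ↦ Prod.ext (by simp) rfl)
  have hΨ' : HasFDerivAt Ψ ((S.trans A : (ℝ × F) ≃L[ℝ] (ℝ × F)) : (ℝ × F) →L[ℝ] ℝ × F) q₀ := by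
    have hαd0 : HasFDerivAt α (fderiv ℝ α (p, 0)) (p, 0) :=
      ((hα.contDiffAt ((isOpen_ball.prod isOpen_ball).mem_nhds
        ⟨mem_ball_self hm, mem_ball_self hm⟩)).differentiableAt (by simp)).hasFDerivAt
    have hD1 : ∀ x', fderiv ℝ α (p, 0) (x', 0) = x' := by
      have h1 : HasFDerivAt (fun x ↦ α (x, 0)) ((fderiv ℝ α (p, 0)).comp
          ((ContinuousLinearMap.id ℝ (ℝ × F)).prod 0)) p :=
        hαd0.comp p ((hasFDerivAt_id p).prodMk (hasFDerivAt_const (0 : ℝ) p))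
      have h2 : HasFDerivAt (fun x ↦ α (x, 0)) (ContinuousLinearMap.id ℝ (ℝ × F)) p := by
        refine (hasFDerivAt_id p).congr_of_eventuallyEq ?_
        filter_upwards [ball_mem_nhds p hm] with x hx using hα0 x hx
      intro x'
      simpa using DFunLike.congr_fun (h1.unique h2) x'
    have hD2 : fderiv ℝ α (p, 0) (0, 1) = R p := by
      have h1 := hαd0.comp_hasDerivAt (0 : ℝ)
        ((hasDerivAt_const (0 : ℝ) p).prodMk (hasDerivAt_id (0 : ℝ)))
      have h2 := (hαd p (mem_ball_self hm) 0 (mem_ball_self hm)).2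
      rw [hα0 p (mem_ball_self hm)] at h2
      exact h1.unique h2
    have hD : ∀ x' t', fderiv ℝ α (p, 0) (x', t') = x' + t' • R p := by
      intro x' t'
      have : ((x', t') : (ℝ × F) × ℝ) = (x', 0) + t' • (0, 1) := by simp
      rw [this, map_add, map_smul, hD1, hD2]
    have hσd : HasFDerivAt σ ((A : (ℝ × F) →L[ℝ] ℝ × F).comp
        ((0 : (ℝ × F) →L[ℝ] ℝ).prod (ContinuousLinearMap.snd ℝ ℝ F))) q₀ :=
      ((A : (ℝ × F) →L[ℝ] ℝ × F).hasFDerivAt.comp q₀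
        ((hasFDerivAt_const (0 : ℝ) q₀).prodMk hasFDerivAt_snd)).const_add p
    have hρd0 : HasFDerivAt ρ (fderiv ℝ ρ p) (σ q₀) := by
      rw [hσ0]
      exact hρd p hp
    have hin := hσd.prodMk (hasFDerivAt_fst.sub (hρd0.comp q₀ hσd))
    have hα1 : HasFDerivAt α (fderiv ℝ α (p, 0)) (σ q₀, q₀.1 - ρ (σ q₀)) := by
      rw [hσ0, hq₀, sub_self]
      exact hαd0
    refine (hα1.comp q₀ hin).congr_fderiv (ContinuousLinearMap.ext fun q ↦ ?_)
    have hAq : ∀ r u, A (r, u) = r • R p + A (0, u) := by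
      intro r u
      rw [← hA, ← map_smul, ← map_add]
      simp
    change fderiv ℝ α (p, 0) (A (0, q.2), q.1 - fderiv ℝ ρ p (A (0, q.2))) =
      A (q.1 - fderiv ℝ ρ p (A (0, q.2)), q.2)
    rw [hD, hAq (q.1 - _)]
    abel
  obtain ⟨e, hqe, heΩ, heΨ, hes⟩ := exists_openPartialHomeomorph_of_contDiffOn hΩo hΨ hq₀Ω _ hΨ'
  have hΨm : ∀ q ∈ Ω, Ψ q ∈ U ∧ HasDerivAt (fun s ↦ Ψ (s, q.2)) (R (Ψ q)) q.1 ∧ ρ (Ψ q) = q.1 := by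
    intro q hq
    obtain ⟨h1, h2⟩ := hαd (σ q) hq.1 _ hq.2
    refine ⟨h1, ?_, ?_⟩
    · exact h2.comp_sub_const q.1 (ρ (σ q))
    · simp only [Ψ]
      rw [hρα _ hq.1 _ hq.2]
      ring
  refine ⟨e.symm, ?_, ?_, hes, ?_, ?_, ?_⟩
  · rw [← hΨ0, ← heΨ]
    exact e.map_source hqe
  · intro z hz
    have := (hΨm _ (heΩ (e.map_target hz))).1
    rwa [← heΨ, e.right_inv hz] at this
  · rw [OpenPartialHomeomorph.symm_symm, heΨ]
    exact hΨ.mono heΩ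
  · intro z hz
    have := (hΨm _ (heΩ (e.map_target hz))).2.2
    rw [← heΨ, e.right_inv hz] at this
    exact this.symm
  · intro q hq
    rw [OpenPartialHomeomorph.symm_symm, heΨ]
    have hqΩ := heΩ hq
    have h1 : HasFDerivAt Ψ (fderiv ℝ Ψ q) (q.1, q.2) :=
      ((hΨ.contDiffAt (hΩo.mem_nhds hqΩ)).differentiableAt (by simp)).hasFDerivAt
    have h2 : HasDerivAt (fun s : ℝ ↦ (s, q.2)) ((1, 0) : ℝ × F) q.1 :=
      (hasDerivAt_id q.1).prodMk (hasDerivAt_const q.1 q.2)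
    have h3 : HasDerivAt (fun s ↦ Ψ (s, q.2)) (fderiv ℝ Ψ q (1, 0)) q.1 :=
      HasFDerivAt.comp_hasDerivAt (f := fun s : ℝ ↦ (s, q.2)) q.1 h1 h2
    exact h3.unique (hΨm q hqΩ).2.1

end Analysis

/-! ### Killing fields and closed dual forms in coordinates -/

section CoordinateKilling

open Set
open scoped Topology

variable {E : Type*} [NormedAddCommGroup E] [NormedSpace ℝ E]

/-- The Killing equation for the vector field `X` and the metric `B` on the set `U`. -/
def KillingOn (B : E → E →L[ℝ] E →L[ℝ] ℝ) (X : E → E) (U : Set E) : Prop :=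
  ∀ z ∈ U, ∀ u v, fderiv ℝ B z (X z) u v + B z (fderiv ℝ X z u) v + B z u (fderiv ℝ X z v) = 0

/-- The one-form `B(X, ·)` is closed on the set `U`. -/
def ClosedOn (B : E → E →L[ℝ] E →L[ℝ] ℝ) (X : E → E) (U : Set E) : Prop :=
  ∀ z ∈ U, ∀ u v, fderiv ℝ (fun z ↦ B z (X z)) z u v = fderiv ℝ (fun z ↦ B z (X z)) z v u

/-- `B` is a smooth field of symmetric bilinear forms on the open set `U`. -/
structure SymmFieldOn (B : E → E →L[ℝ] E →L[ℝ] ℝ) (U : Set E) : Prop where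
  isOpen : IsOpen U
  smooth : ContDiffOn ℝ ∞ B U
  symm : ∀ z ∈ U, ∀ u v, B z u v = B z v u

variable {B : E → E →L[ℝ] E →L[ℝ] ℝ} {X P Q ζ : E → E} {U : Set E}

theorem ContDiffOn.hasFDerivAt_of_isOpen {F : Type*} [NormedAddCommGroup F] [NormedSpace ℝ F]
    {f : E → F} (hf : ContDiffOn ℝ ∞ f U) (hU : IsOpen U) {z : E} (hz : z ∈ U) :
    HasFDerivAt f (fderiv ℝ f z) z :=
  ((hf.contDiffAt (hU.mem_nhds hz)).differentiableAt (by simp)).hasFDerivAt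

theorem ContDiffOn.smooth_fderiv {F : Type*} [NormedAddCommGroup F] [NormedSpace ℝ F]
    {f : E → F} (hf : ContDiffOn ℝ ∞ f U) (hU : IsOpen U) : ContDiffOn ℝ ∞ (fderiv ℝ f) U :=
  hf.fderiv_of_isOpen hU (by simp)

theorem ContDiffOn.fderiv_fderiv_symm {F : Type*} [NormedAddCommGroup F] [NormedSpace ℝ F]
    {f : E → F} (hf : ContDiffOn ℝ ∞ f U) (hU : IsOpen U) {z : E} (hz : z ∈ U) (u v : E) :
    fderiv ℝ (fderiv ℝ f) z u v = fderiv ℝ (fderiv ℝ f) z v u :=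
  ((hf.contDiffAt (hU.mem_nhds hz)).isSymmSndFDerivAt (by
    rw [minSmoothness_of_isRCLikeNormedField]
    exact WithTop.coe_le_coe.2 (le_top : (2 : ℕ∞) ≤ ⊤))) u v

theorem SymmFieldOn.fderiv_symm (hB : SymmFieldOn B U) {z : E} (hz : z ∈ U) (w u v : E) :
    fderiv ℝ B z w u v = fderiv ℝ B z w v u := by
  have hd := hB.smooth.hasFDerivAt_of_isOpen hB.isOpen hz
  have h1 := (hd.clm_apply (hasFDerivAt_const u z)).clm_apply (hasFDerivAt_const v z)
  have h2 := (hd.clm_apply (hasFDerivAt_const v z)).clm_apply (hasFDerivAt_const u z)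
  have h3 := h1.unique (h2.congr_of_eventuallyEq (by
    filter_upwards [hB.isOpen.mem_nhds hz] with y hy using hB.symm y hy u v))
  simpa using DFunLike.congr_fun h3 w

theorem SymmFieldOn.fderiv_dual (hB : SymmFieldOn B U) (hX : ContDiffOn ℝ ∞ X U) {z : E}
    (hz : z ∈ U) (u v : E) :
    fderiv ℝ (fun z ↦ B z (X z)) z u v = fderiv ℝ B z u (X z) v + B z (fderiv ℝ X z u) v := by
  rw [((hB.smooth.hasFDerivAt_of_isOpen hB.isOpen hz).clm_apply
    (hX.hasFDerivAt_of_isOpen hB.isOpen hz)).fderiv]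
  simp [add_comm]

theorem SymmFieldOn.fderiv_apply (hB : SymmFieldOn B U) (hX : ContDiffOn ℝ ∞ X U)
    (hP : ContDiffOn ℝ ∞ P U) {z : E} (hz : z ∈ U) (u : E) :
    fderiv ℝ (fun z ↦ B z (X z) (P z)) z u =
      fderiv ℝ B z u (X z) (P z) + B z (fderiv ℝ X z u) (P z) + B z (X z) (fderiv ℝ P z u) := by
  rw [(((hB.smooth.hasFDerivAt_of_isOpen hB.isOpen hz).clm_apply
    (hX.hasFDerivAt_of_isOpen hB.isOpen hz)).clm_apply
    (hP.hasFDerivAt_of_isOpen hB.isOpen hz)).fderiv]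
  simp
  ring

theorem SymmFieldOn.smooth_apply (hB : SymmFieldOn B U) (hX : ContDiffOn ℝ ∞ X U)
    (hP : ContDiffOn ℝ ∞ P U) : ContDiffOn ℝ ∞ (fun z ↦ B z (X z) (P z)) U :=
  (hB.smooth.clm_apply hX).clm_apply hP

/-- `[ζ, P]♭ = d(g(ζ, P))` for a Killing field `ζ` and a field `P` with closed dual form. -/
theorem KillingOn.dual_lieBracket (hB : SymmFieldOn B U) (hζ : ContDiffOn ℝ ∞ ζ U)
    (hP : ContDiffOn ℝ ∞ P U) (kζ : KillingOn B ζ U) (cP : ClosedOn B P U) {z : E} (hz : z ∈ U)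
    (u : E) :
    B z (VectorField.lieBracket ℝ ζ P z) u = fderiv ℝ (fun z ↦ B z (ζ z) (P z)) z u := by
  have h1 := kζ z hz u (P z)
  have h2 := cP z hz (ζ z) u
  rw [hB.fderiv_dual hP hz, hB.fderiv_dual hP hz] at h2
  rw [hB.fderiv_apply hζ hP hz, VectorField.lieBracket, map_sub, sub_apply]
  have h3 := hB.fderiv_symm hz (ζ z) u (P z)
  have h4 := hB.fderiv_symm hz u (ζ z) (P z)
  have h5 := hB.symm z hz (fderiv ℝ ζ z (P z)) u
  have h6 := hB.symm z hz (fderiv ℝ P z u) (ζ z)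
  linarith

/-- By `KillingOn.dual_lieBracket` the dual form of the bracket is exact, so closedness is symmetry
of second derivatives. -/
theorem ClosedOn.lieBracket (hB : SymmFieldOn B U) (hζ : ContDiffOn ℝ ∞ ζ U)
    (hP : ContDiffOn ℝ ∞ P U) (kζ : KillingOn B ζ U) (cP : ClosedOn B P U) :
    ClosedOn B (VectorField.lieBracket ℝ ζ P) U := by
  intro z hz u v
  have h1 : (fun z ↦ B z (VectorField.lieBracket ℝ ζ P z)) =ᶠ[𝓝 z]
      fderiv ℝ (fun z ↦ B z (ζ z) (P z)) := by
    filter_upwards [hB.isOpen.mem_nhds hz] with y hy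
    ext w
    exact KillingOn.dual_lieBracket hB hζ hP kζ cP hy w
  rw [h1.fderiv_eq]
  exact (hB.smooth_apply hζ hP).fderiv_fderiv_symm hB.isOpen hz u v

-- The Killing equation differentiated in the direction `w`, the input for brackets of Killing
-- fields.
set_option maxSynthPendingDepth 5 in
theorem KillingOn.fderiv_eq_zero (hB : SymmFieldOn B U) (hX : ContDiffOn ℝ ∞ X U)
    (kX : KillingOn B X U) {z : E} (hz : z ∈ U) (w u v : E) :
    fderiv ℝ (fderiv ℝ B) z w (X z) u v + fderiv ℝ B z (fderiv ℝ X z w) u v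
      + (fderiv ℝ B z w (fderiv ℝ X z u) v + B z (fderiv ℝ (fderiv ℝ X) z w u) v)
      + (fderiv ℝ B z w u (fderiv ℝ X z v) + B z u (fderiv ℝ (fderiv ℝ X) z w v)) = 0 := by
  have dB := hB.smooth.hasFDerivAt_of_isOpen hB.isOpen hz
  have dX := hX.hasFDerivAt_of_isOpen hB.isOpen hz
  have ddB := (hB.smooth.smooth_fderiv hB.isOpen).hasFDerivAt_of_isOpen hB.isOpen hz
  have ddX := (hX.smooth_fderiv hB.isOpen).hasFDerivAt_of_isOpen hB.isOpen hz
  have cu := hasFDerivAt_const (𝕜 := ℝ) u z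
  have cv := hasFDerivAt_const (𝕜 := ℝ) v z
  have h1 := (((ddB.clm_apply dX).clm_apply cu).clm_apply cv).add
    ((dB.clm_apply (ddX.clm_apply cu)).clm_apply cv) |>.add
    ((dB.clm_apply cu).clm_apply (ddX.clm_apply cv))
  have h2 := h1.unique ((hasFDerivAt_const (0 : ℝ) z).congr_of_eventuallyEq (by
    filter_upwards [hB.isOpen.mem_nhds hz] with y hy using kX y hy u v))
  have h3 := DFunLike.congr_fun h2 w
  simp at h3
  linarith

-- Coordinate form of `L_[X,P] B = L_X L_P B - L_P L_X B`. The Killing equation of `P` is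
-- differentiated along `X` and that of `X` along `P`; in the difference the second derivatives of
-- `B` cancel, and the leftover first-order terms are Killing equations on other arguments.
set_option maxSynthPendingDepth 5 in
theorem KillingOn.lieBracket (hB : SymmFieldOn B U) (hX : ContDiffOn ℝ ∞ X U)
    (hP : ContDiffOn ℝ ∞ P U) (kX : KillingOn B X U) (kP : KillingOn B P U) :
    KillingOn B (VectorField.lieBracket ℝ X P) U := by
  intro z hz u v
  have dX := hX.hasFDerivAt_of_isOpen hB.isOpen hz
  have dP := hP.hasFDerivAt_of_isOpen hB.isOpen hz
  have ddX := (hX.smooth_fderiv hB.isOpen).hasFDerivAt_of_isOpen hB.isOpen hz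
  have ddP := (hP.smooth_fderiv hB.isOpen).hasFDerivAt_of_isOpen hB.isOpen hz
  have hW : ∀ w, fderiv ℝ (VectorField.lieBracket ℝ X P) z w =
      fderiv ℝ (fderiv ℝ P) z w (X z) + fderiv ℝ P z (fderiv ℝ X z w)
        - (fderiv ℝ (fderiv ℝ X) z w (P z) + fderiv ℝ X z (fderiv ℝ P z w)) := by
    intro w
    have h1 : HasFDerivAt (VectorField.lieBracket ℝ X P) _ z :=
      (ddP.clm_apply dX).sub (ddX.clm_apply dP)
    rw [h1.fderiv]
    simp
    abel
  rw [hW, hW, VectorField.lieBracket]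
  have hXX := kX.fderiv_eq_zero hB hX hz (P z) u v
  have hPP := kP.fderiv_eq_zero hB hP hz (X z) u v
  have hs := hB.smooth.fderiv_fderiv_symm hB.isOpen hz (X z) (P z)
  rw [hs] at hPP
  have k1 := kX z hz (fderiv ℝ P z u) v
  have k2 := kX z hz u (fderiv ℝ P z v)
  have k3 := kP z hz (fderiv ℝ X z u) v
  have k4 := kP z hz u (fderiv ℝ X z v)
  have s1 := hX.fderiv_fderiv_symm hB.isOpen hz u (P z)
  have s2 := hX.fderiv_fderiv_symm hB.isOpen hz v (P z)
  have s3 := hP.fderiv_fderiv_symm hB.isOpen hz u (X z)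
  have s4 := hP.fderiv_fderiv_symm hB.isOpen hz v (X z)
  rw [s1, s2, s3, s4]
  simp only [map_sub, map_add, sub_apply, add_apply]
  linarith

/-- `g([ζ, P], Q) + g(P, [ζ, Q]) = ζ(g(P, Q))` for a Killing field `ζ`. -/
theorem KillingOn.lieBracket_add (hB : SymmFieldOn B U)
    (hP : ContDiffOn ℝ ∞ P U) (hQ : ContDiffOn ℝ ∞ Q U) (kζ : KillingOn B ζ U) {z : E}
    (hz : z ∈ U) :
    B z (VectorField.lieBracket ℝ ζ P z) (Q z) + B z (P z) (VectorField.lieBracket ℝ ζ Q z) =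
      fderiv ℝ (fun z ↦ B z (P z) (Q z)) z (ζ z) := by
  have h1 := kζ z hz (P z) (Q z)
  rw [hB.fderiv_apply hP hQ hz, VectorField.lieBracket, VectorField.lieBracket]
  simp only [map_sub, sub_apply]
  linarith

/-- Two fields that are Killing with closed dual forms have constant inner product. -/
theorem KillingOn.fderiv_apply_eq_zero (hB : SymmFieldOn B U) (hP : ContDiffOn ℝ ∞ P U)
    (hQ : ContDiffOn ℝ ∞ Q U) (kP : KillingOn B P U) (kQ : KillingOn B Q U) (cP : ClosedOn B P U)
    (cQ : ClosedOn B Q U) {z : E} (hz : z ∈ U) (u : E) :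
    fderiv ℝ (fun z ↦ B z (P z) (Q z)) z u = 0 := by
  -- Both `[P, Q]♭` and `[Q, P]♭` equal `d(g(P, Q))`, while they are opposite to each other.
  have h1 := KillingOn.dual_lieBracket hB hP hQ kP cQ hz u
  have h2 := KillingOn.dual_lieBracket hB hQ hP kQ cP hz u
  have h3 : (fun z ↦ B z (P z) (Q z)) =ᶠ[𝓝 z] fun z ↦ B z (Q z) (P z) := by
    filter_upwards [hB.isOpen.mem_nhds hz] with y hy using hB.symm y hy _ _
  have h4 : VectorField.lieBracket ℝ P Q z = -VectorField.lieBracket ℝ Q P z := by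
    simp [VectorField.lieBracket]
  rw [h3.fderiv_eq] at h1
  rw [h4, map_neg, neg_apply] at h1
  rw [h3.fderiv_eq]
  linarith

/-- The dual form of the bracket is the differential of a constant inner product, and the metric is
nondegenerate. -/
theorem KillingOn.lieBracket_eq_zero (hB : SymmFieldOn B U) (hP : ContDiffOn ℝ ∞ P U)
    (hQ : ContDiffOn ℝ ∞ Q U) (kP : KillingOn B P U) (kQ : KillingOn B Q U) (cP : ClosedOn B P U)
    (cQ : ClosedOn B Q U) {z : E} (hz : z ∈ U) (hnd : ∀ w, (∀ u, B z w u = 0) → w = 0) :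
    VectorField.lieBracket ℝ P Q z = 0 :=
  hnd _ fun u ↦ by
    rw [KillingOn.dual_lieBracket hB hP hQ kP cQ hz u,
      KillingOn.fderiv_apply_eq_zero hB hP hQ kP kQ cP cQ hz u]

theorem KillingOn.congr (kX : KillingOn B X U) (hU : IsOpen U) (h : EqOn P X U) :
    KillingOn B P U := fun z hz u v ↦ by
  have h1 : P =ᶠ[𝓝 z] X := h.eventuallyEq_of_mem (hU.mem_nhds hz)
  rw [h1.fderiv_eq, h hz]
  exact kX z hz u v

theorem ClosedOn.congr (cX : ClosedOn B X U) (hU : IsOpen U) (h : EqOn P X U) :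
    ClosedOn B P U := fun z hz u v ↦ by
  have h1 : (fun z ↦ B z (P z)) =ᶠ[𝓝 z] fun z ↦ B z (X z) := by
    filter_upwards [hU.mem_nhds hz] with y hy
    rw [h hy]
  rw [h1.fderiv_eq]
  exact cX z hz u v

/-- `dζ♭(P, ·) = -2 [ζ, P]♭` for a Killing field `ζ` and a Killing field `P` with closed dual
form. -/
theorem KillingOn.extDeriv_dual (hB : SymmFieldOn B U) (hζ : ContDiffOn ℝ ∞ ζ U)
    (hP : ContDiffOn ℝ ∞ P U) (kζ : KillingOn B ζ U) (kP : KillingOn B P U) (cP : ClosedOn B P U)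
    {z : E} (hz : z ∈ U) (v : E) :
    fderiv ℝ (fun z ↦ B z (ζ z)) z (P z) v - fderiv ℝ (fun z ↦ B z (ζ z)) z v (P z) =
      -2 * B z (VectorField.lieBracket ℝ ζ P z) v := by
  have h1 := KillingOn.dual_lieBracket hB hζ hP kζ cP hz v
  rw [hB.fderiv_apply hζ hP hz] at h1
  rw [hB.fderiv_dual hζ hz, hB.fderiv_dual hζ hz]
  have h2 := kP z hz (ζ z) v
  have h3 : B z (VectorField.lieBracket ℝ ζ P z) v =
      B z (fderiv ℝ P z (ζ z)) v - B z (fderiv ℝ ζ z (P z)) v := by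
    rw [VectorField.lieBracket, map_sub, sub_apply]
  linarith

end CoordinateKilling

/-! ### Passage between the manifold and its charts -/

noncomputable section

set_option linter.unusedSectionVars false

section Charts

open Set
open scoped Topology

variable {M : Type*} [TopologicalSpace M] [ChartedSpace Coord4 M]
  [IsManifold 𝓘(ℝ, Coord4) ∞ M] {φ : OpenPartialHomeomorph M Coord4} {g : LorentzMetric M}
  {X Y : ∀ p : M, TangentSpace 𝓘(ℝ, Coord4) p}

theorem mdifferentiableAt_chart (hφ : φ ∈ IsManifold.maximalAtlas 𝓘(ℝ, Coord4) ∞ M)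
    {q : M} (hq : q ∈ φ.source) : MDifferentiableAt 𝓘(ℝ, Coord4) 𝓘(ℝ, Coord4) φ q :=
  (contMDiffAt_of_mem_maximalAtlas hφ hq).mdifferentiableAt (by simp)

theorem mdifferentiableAt_chart_symm
    (hφ : φ ∈ IsManifold.maximalAtlas 𝓘(ℝ, Coord4) ∞ M) {z : Coord4} (hz : z ∈ φ.target) :
    MDifferentiableAt 𝓘(ℝ, Coord4) 𝓘(ℝ, Coord4) φ.symm z :=
  (contMDiffAt_symm_of_mem_maximalAtlas hφ hz).mdifferentiableAt (by simp)

theorem mfderiv_comp_mfderiv_symm (hφ : φ ∈ IsManifold.maximalAtlas 𝓘(ℝ, Coord4) ∞ M)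
    {z : Coord4} (hz : z ∈ φ.target) :
    (mfderiv 𝓘(ℝ, Coord4) 𝓘(ℝ, Coord4) φ (φ.symm z)).comp
      (mfderiv 𝓘(ℝ, Coord4) 𝓘(ℝ, Coord4) φ.symm z) =
        ContinuousLinearMap.id ℝ (TangentSpace 𝓘(ℝ, Coord4) z) := by
  rw [← mfderiv_comp z (mdifferentiableAt_chart hφ (φ.map_target hz))
    (mdifferentiableAt_chart_symm hφ hz)]
  have h : (φ ∘ φ.symm) =ᶠ[𝓝 z] id := by
    filter_upwards [φ.open_target.mem_nhds hz] with y hy using φ.right_inv hy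
  rw [h.mfderiv_eq]
  exact mfderiv_id

theorem mfderiv_symm_comp_mfderiv (hφ : φ ∈ IsManifold.maximalAtlas 𝓘(ℝ, Coord4) ∞ M)
    {q : M} (hq : q ∈ φ.source) :
    (mfderiv 𝓘(ℝ, Coord4) 𝓘(ℝ, Coord4) φ.symm (φ q)).comp
      (mfderiv 𝓘(ℝ, Coord4) 𝓘(ℝ, Coord4) φ q) =
        ContinuousLinearMap.id ℝ (TangentSpace 𝓘(ℝ, Coord4) q) := by
  rw [← mfderiv_comp q (mdifferentiableAt_chart_symm hφ (φ.map_source hq))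
    (mdifferentiableAt_chart hφ hq)]
  have h : (φ.symm ∘ φ) =ᶠ[𝓝 q] id := by
    filter_upwards [φ.open_source.mem_nhds hq] with y hy using φ.left_inv hy
  rw [h.mfderiv_eq]
  exact mfderiv_id

theorem mfderiv_symm_fieldInChart (hφ : φ ∈ IsManifold.maximalAtlas 𝓘(ℝ, Coord4) ∞ M)
    {z : Coord4} (hz : z ∈ φ.target) :
    mfderiv 𝓘(ℝ, Coord4) 𝓘(ℝ, Coord4) φ.symm z (fieldInChart X φ z) = X (φ.symm z) := by
  have h := mfderiv_symm_comp_mfderiv hφ (φ.map_target hz)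
  rw [φ.right_inv hz] at h
  exact DFunLike.congr_fun h (X (φ.symm z))

theorem inChart_fieldInChart (hφ : φ ∈ IsManifold.maximalAtlas 𝓘(ℝ, Coord4) ∞ M)
    {z : Coord4} (hz : z ∈ φ.target) :
    g.inChart φ z (fieldInChart X φ z) (fieldInChart Y φ z) =
      g.val (φ.symm z) (X (φ.symm z)) (Y (φ.symm z)) := by
  change g.val (φ.symm z) (mfderiv 𝓘(ℝ, Coord4) 𝓘(ℝ, Coord4) φ.symm z (fieldInChart X φ z))
    (mfderiv 𝓘(ℝ, Coord4) 𝓘(ℝ, Coord4) φ.symm z (fieldInChart Y φ z)) = _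
  rw [mfderiv_symm_fieldInChart hφ hz, mfderiv_symm_fieldInChart hφ hz]

theorem val_eq_inChart (hφ : φ ∈ IsManifold.maximalAtlas 𝓘(ℝ, Coord4) ∞ M)
    {q : M} (hq : q ∈ φ.source) :
    g.val q (X q) (Y q) =
      g.inChart φ (φ q) (fieldInChart X φ (φ q)) (fieldInChart Y φ (φ q)) := by
  rw [inChart_fieldInChart hφ (φ.map_source hq), φ.left_inv hq]

theorem isInvertible_mfderiv_symm (hφ : φ ∈ IsManifold.maximalAtlas 𝓘(ℝ, Coord4) ∞ M)
    {z : Coord4} (hz : z ∈ φ.target) :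
    (mfderiv 𝓘(ℝ, Coord4) 𝓘(ℝ, Coord4) φ.symm z).IsInvertible := by
  have h := mfderiv_symm_comp_mfderiv hφ (φ.map_target hz)
  rw [φ.right_inv hz] at h
  exact ⟨ContinuousLinearEquiv.equivOfInverse' _ _ h (mfderiv_comp_mfderiv_symm hφ hz), rfl⟩

/-- Gives access to smoothness of pulled-back fields and to naturality of the Lie bracket. -/
theorem fieldInChart_eq_mpullback (hφ : φ ∈ IsManifold.maximalAtlas 𝓘(ℝ, Coord4) ∞ M)
    {z : Coord4} (hz : z ∈ φ.target) :
    fieldInChart X φ z = VectorField.mpullback 𝓘(ℝ, Coord4) 𝓘(ℝ, Coord4) φ.symm X z := by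
  have h := mfderiv_symm_comp_mfderiv hφ (φ.map_target hz)
  rw [φ.right_inv hz] at h
  rw [VectorField.mpullback_apply,
    ContinuousLinearMap.inverse_eq h (mfderiv_comp_mfderiv_symm hφ hz)]
  rfl

/-- A smooth vector field on `M`. -/
abbrev IsSmoothField (X : ∀ p : M, TangentSpace 𝓘(ℝ, Coord4) p) : Prop :=
  ContMDiff 𝓘(ℝ, Coord4) 𝓘(ℝ, Coord4).tangent ∞
    (fun p ↦ (⟨p, X p⟩ : TangentBundle 𝓘(ℝ, Coord4) M))

theorem IsSmoothField.contDiffOn_fieldInChart (hX : IsSmoothField X)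
    (hφ : φ ∈ IsManifold.maximalAtlas 𝓘(ℝ, Coord4) ∞ M) :
    ContDiffOn ℝ ∞ (fieldInChart X φ) φ.target := by
  have : IsManifold 𝓘(ℝ, Coord4) 1 M := IsManifold.of_le (n := ∞) (by simp)
  intro z hz
  have h1 := ContMDiffAt.mpullback_vectorField_preimage (m := ∞) (n := ∞) (f := φ.symm) (x₀ := z)
    (V := X) (hX.contMDiffAt) (contMDiffAt_symm_of_mem_maximalAtlas hφ hz)
    (isInvertible_mfderiv_symm hφ hz) (by simp)
  have h2 := contMDiffWithinAt_vectorSpace_iff_contDiffWithinAt.1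
    (h1.contMDiffWithinAt (s := φ.target))
  exact h2.congr (fun y hy ↦ fieldInChart_eq_mpullback hφ hy) (fieldInChart_eq_mpullback hφ hz)

theorem fieldInChart_mlieBracket (hX : IsSmoothField X) (hY : IsSmoothField Y)
    (hφ : φ ∈ IsManifold.maximalAtlas 𝓘(ℝ, Coord4) ∞ M) {z : Coord4} (hz : z ∈ φ.target) :
    fieldInChart (VectorField.mlieBracket 𝓘(ℝ, Coord4) X Y) φ z =
      VectorField.lieBracket ℝ (fieldInChart X φ) (fieldInChart Y φ) z := by
  have : IsManifold 𝓘(ℝ, Coord4) (minSmoothness ℝ 3) M := by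
    rw [minSmoothness_of_isRCLikeNormedField]
    exact IsManifold.of_le (n := ∞) (WithTop.coe_le_coe.2 (le_top : (3 : ℕ∞) ≤ ⊤))
  have key : ∀ V W : ∀ z : Coord4, TangentSpace 𝓘(ℝ, Coord4) z,
      VectorField.mlieBracket 𝓘(ℝ, Coord4) V W z =
        VectorField.lieBracket ℝ (V : Coord4 → Coord4) (W : Coord4 → Coord4) z := fun V W ↦ by
    rw [← VectorField.mlieBracketWithin_univ]
    exact (congrFun VectorField.mlieBracketWithin_eq_lieBracketWithin z).trans
      (congrFun VectorField.lieBracketWithin_univ z)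
  rw [fieldInChart_eq_mpullback hφ hz, VectorField.mpullback_mlieBracket (n := ∞)
    (hX.mdifferentiableAt (by simp)) (hY.mdifferentiableAt (by simp))
    (contMDiffAt_symm_of_mem_maximalAtlas hφ hz) (by
      rw [minSmoothness_of_isRCLikeNormedField]
      exact WithTop.coe_le_coe.2 (le_top : (2 : ℕ∞) ≤ ⊤)), key]
  have h : ∀ V : ∀ p : M, TangentSpace 𝓘(ℝ, Coord4) p,
      VectorField.mpullback 𝓘(ℝ, Coord4) 𝓘(ℝ, Coord4) φ.symm V =ᶠ[𝓝 z] fieldInChart V φ :=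
    fun V ↦ by
      filter_upwards [φ.open_target.mem_nhds hz] with y hy
        using (fieldInChart_eq_mpullback hφ hy).symm
  exact (h X).lieBracket_vectorField_eq (h Y)

theorem IsSmoothField.mlieBracket (hX : IsSmoothField X) (hY : IsSmoothField Y) :
    IsSmoothField (VectorField.mlieBracket 𝓘(ℝ, Coord4) X Y) := by
  have h1 : ((⊤ : ℕ∞) : WithTop ℕ∞) + 1 = ∞ := rfl
  have : IsManifold 𝓘(ℝ, Coord4) (((⊤ : ℕ∞) : WithTop ℕ∞) + 1) M := by
    rw [h1]; infer_instance
  have : IsManifold 𝓘(ℝ, Coord4) (minSmoothness ℝ 2) M := by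
    rw [minSmoothness_of_isRCLikeNormedField]
    exact IsManifold.of_le (n := ∞) (WithTop.coe_le_coe.2 (le_top : (2 : ℕ∞) ≤ ⊤))
  refine ContDiff.mlieBracket_vectorField (m := ⊤) (n := ⊤) hX hY ?_
  rw [minSmoothness_of_isRCLikeNormedField, h1]

theorem trans_mem_maximalAtlas (hφ : φ ∈ IsManifold.maximalAtlas 𝓘(ℝ, Coord4) ∞ M)
    {e : OpenPartialHomeomorph Coord4 Coord4} (he : ContDiffOn ℝ ∞ e e.source)
    (he' : ContDiffOn ℝ ∞ e.symm e.target) :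
    φ.trans e ∈ IsManifold.maximalAtlas 𝓘(ℝ, Coord4) ∞ M := by
  refine OpenPartialHomeomorph.mem_maximalAtlas_of_contMDiffOn _ ?_ ?_
  · exact (he.contMDiffOn).comp ((contMDiffOn_of_mem_maximalAtlas hφ).mono (by
      rw [OpenPartialHomeomorph.trans_source]; exact inter_subset_left)) (fun q hq ↦ hq.2)
  · exact (contMDiffOn_symm_of_mem_maximalAtlas hφ).comp ((he'.contMDiffOn).mono (by
      rw [OpenPartialHomeomorph.trans_target]; exact inter_subset_left)) (fun q hq ↦ hq.2)

theorem fieldInChart_trans (hφ : φ ∈ IsManifold.maximalAtlas 𝓘(ℝ, Coord4) ∞ M)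
    {e : OpenPartialHomeomorph Coord4 Coord4} (he : ContDiffOn ℝ ∞ e e.source)
    {z : Coord4} (hz : z ∈ (φ.trans e).target) :
    fieldInChart X (φ.trans e) z = fderiv ℝ e (e.symm z) (fieldInChart X φ (e.symm z)) := by
  have h1 : e.symm z ∈ e.source := e.map_target hz.1
  have h2 : φ (φ.symm (e.symm z)) = e.symm z := φ.right_inv hz.2
  have hd : MDifferentiableAt 𝓘(ℝ, Coord4) 𝓘(ℝ, Coord4) e (φ (φ.symm (e.symm z))) := by
    rw [h2]
    exact (he.hasFDerivAt_of_isOpen e.open_source h1).differentiableAt.mdifferentiableAt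
  have h3 := mfderiv_comp (φ.symm (e.symm z)) hd
    (mdifferentiableAt_chart hφ (φ.map_target hz.2))
  rw [h2, mfderiv_eq_fderiv] at h3
  exact DFunLike.congr_fun h3 (X (φ.symm (e.symm z)))

theorem inChart_trans (hφ : φ ∈ IsManifold.maximalAtlas 𝓘(ℝ, Coord4) ∞ M)
    {e : OpenPartialHomeomorph Coord4 Coord4} (he' : ContDiffOn ℝ ∞ e.symm e.target)
    {z : Coord4} (hz : z ∈ (φ.trans e).target) (u v : Coord4) :
    g.inChart (φ.trans e) z u v =
      g.inChart φ (e.symm z) (fderiv ℝ e.symm z u) (fderiv ℝ e.symm z v) := by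
  have hd : MDifferentiableAt 𝓘(ℝ, Coord4) 𝓘(ℝ, Coord4) e.symm z :=
    (he'.hasFDerivAt_of_isOpen e.open_target hz.1).differentiableAt.mdifferentiableAt
  have h3 := mfderiv_comp z (mdifferentiableAt_chart_symm hφ hz.2) hd
  rw [mfderiv_eq_fderiv] at h3
  have h4 : ∀ w : Coord4, mfderiv 𝓘(ℝ, Coord4) 𝓘(ℝ, Coord4) (φ.trans e).symm z w =
      mfderiv 𝓘(ℝ, Coord4) 𝓘(ℝ, Coord4) φ.symm (e.symm z) (fderiv ℝ e.symm z w) :=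
    fun w ↦ DFunLike.congr_fun h3 w
  change g.val (φ.symm (e.symm z)) (mfderiv 𝓘(ℝ, Coord4) 𝓘(ℝ, Coord4) (φ.trans e).symm z u)
    (mfderiv 𝓘(ℝ, Coord4) 𝓘(ℝ, Coord4) (φ.trans e).symm z v) = _
  rw [h4, h4]
  rfl

end Charts

end

/-! ### Parallel fields -/

noncomputable section
set_option linter.unusedSectionVars false

section Parallel

open Set
open scoped Topology

variable {M : Type*} [TopologicalSpace M] [ChartedSpace Coord4 M]
  [IsManifold 𝓘(ℝ, Coord4) ∞ M] {φ : OpenPartialHomeomorph M Coord4} {g : LorentzMetric M}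
  {K X Y ζ : ∀ p : M, TangentSpace 𝓘(ℝ, Coord4) p}

/-- `φ` is a chart in which `K = ∂/∂t` and `g = -dt² + h(X)`. -/
def IsUltraStaticChart (g : LorentzMetric M) (K : ∀ p : M, TangentSpace 𝓘(ℝ, Coord4) p)
    (φ : OpenPartialHomeomorph M Coord4) : Prop :=
  ∃ h, IsStaticChart g K φ (fun _ ↦ 1) h

theorem IsUltraStaticChart.mem_atlas (hφ : IsUltraStaticChart g K φ) :
    φ ∈ IsManifold.maximalAtlas 𝓘(ℝ, Coord4) ∞ M := hφ.choose_spec.mem_atlas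

theorem IsUltraStaticChart.field_eq (hφ : IsUltraStaticChart g K φ) {z : Coord4}
    (hz : z ∈ φ.target) : fieldInChart K φ z = (1, 0) := hφ.choose_spec.field_eq z hz

theorem LorentzMetric.inChart_symm (g : LorentzMetric M) (φ : OpenPartialHomeomorph M Coord4)
    (z u v : Coord4) : g.inChart φ z u v = g.inChart φ z v u := by
  change g.val (φ.symm z) (mfderiv 𝓘(ℝ, Coord4) 𝓘(ℝ, Coord4) φ.symm z u)
    (mfderiv 𝓘(ℝ, Coord4) 𝓘(ℝ, Coord4) φ.symm z v) = g.val (φ.symm z)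
    (mfderiv 𝓘(ℝ, Coord4) 𝓘(ℝ, Coord4) φ.symm z v) (mfderiv 𝓘(ℝ, Coord4) 𝓘(ℝ, Coord4) φ.symm z u)
  exact g.symm _ _ _

theorem IsUltraStaticChart.symmFieldOn (hφ : IsUltraStaticChart g K φ) :
    SymmFieldOn (g.inChart φ) φ.target := by
  obtain ⟨h, hφ⟩ := hφ
  refine ⟨φ.open_target, ?_, fun z _ u v ↦ g.inChart_symm φ z u v⟩
  refine contDiffOn_clm_apply.2 fun u ↦ contDiffOn_clm_apply.2 fun v ↦ ?_
  have h1 : ContDiffOn ℝ ∞ (fun z : Coord4 ↦ h z.2) φ.target :=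
    hφ.riemannian.smooth.comp contDiffOn_snd fun z hz ↦ mem_image_of_mem _ hz
  have h2 : ContDiffOn ℝ ∞ (fun z : Coord4 ↦ -(u.1 * v.1) + h z.2 u.2 v.2) φ.target :=
    contDiffOn_const.add ((h1.clm_apply contDiffOn_const).clm_apply contDiffOn_const)
  refine h2.congr fun z hz ↦ ?_
  rw [hφ.metric_eq z hz]
  ring

theorem IsUltraStaticChart.inChart_right (hφ : IsUltraStaticChart g K φ) {z : Coord4}
    (hz : z ∈ φ.target) (u : Coord4) : g.inChart φ z u (1, 0) = -u.1 := by
  rw [hφ.choose_spec.metric_eq z hz]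
  simp

theorem IsUltraStaticChart.inChart_pos (hφ : IsUltraStaticChart g K φ) {z : Coord4}
    (hz : z ∈ φ.target) {u : Coord4} (hu : u.1 = 0) (hu' : u ≠ 0) : 0 < g.inChart φ z u u := by
  obtain ⟨h, hφ⟩ := hφ
  rw [hφ.metric_eq z hz, hu]
  have := hφ.riemannian.pos z.2 (mem_image_of_mem _ hz) u.2 fun h ↦ hu' (Prod.ext hu h)
  simpa using this

theorem IsUltraStaticChart.nondegenerate (hφ : IsUltraStaticChart g K φ) {z : Coord4}
    (hz : z ∈ φ.target) (w : Coord4) (hw : ∀ u, g.inChart φ z w u = 0) : w = 0 := by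
  by_contra hne
  have h1 : w.1 = 0 := by
    have := hφ.inChart_right hz w
    rw [hw] at this
    linarith
  exact (hφ.inChart_pos hz h1 hne).ne' (hw w)

theorem IsUltraStaticChart.fderiv_inChart (hφ : IsUltraStaticChart g K φ) {z : Coord4}
    (hz : z ∈ φ.target) (u v : Coord4) : fderiv ℝ (g.inChart φ) z (1, 0) u v = 0 := by
  have hB := hφ.symmFieldOn.smooth.hasFDerivAt_of_isOpen φ.open_target hz
  have h1 := ((hB.clm_apply (hasFDerivAt_const u z)).clm_apply
    (hasFDerivAt_const v z)).hasLineDerivAt (1, 0)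
  obtain ⟨h, hφ⟩ := hφ
  have hc : (fun s : ℝ ↦ g.inChart φ (z + s • (1, 0)) u v) =ᶠ[𝓝 0]
      fun _ ↦ g.inChart φ z u v := by
    have hcont : ContinuousAt (fun s : ℝ ↦ z + s • ((1, 0) : Coord4)) 0 := by fun_prop
    have hnear : (fun s : ℝ ↦ z + s • ((1, 0) : Coord4)) ⁻¹' φ.target ∈ 𝓝 0 :=
      hcont.preimage_mem_nhds (φ.open_target.mem_nhds (by simpa using hz))
    filter_upwards [hnear] with s hs
    rw [hφ.metric_eq _ hs, hφ.metric_eq _ hz]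
    simp
  have h2 := HasDerivAt.unique h1 ((hasDerivAt_const (0 : ℝ) _).congr_of_eventuallyEq hc)
  simpa using h2

/-- `X` is parallel: in every ultra-static chart it is a Killing field with closed dual form. -/
structure IsParallel (g : LorentzMetric M) (K X : ∀ p : M, TangentSpace 𝓘(ℝ, Coord4) p) :
    Prop where
  smooth : IsSmoothField X
  killing : ∀ φ, IsUltraStaticChart g K φ →
    KillingOn (g.inChart φ) (fieldInChart X φ) φ.target
  closed : ∀ φ, IsUltraStaticChart g K φ → ClosedOn (g.inChart φ) (fieldInChart X φ) φ.target

theorem IsParallel.contDiffOn (hX : IsParallel g K X) (hφ : IsUltraStaticChart g K φ) :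
    ContDiffOn ℝ ∞ (fieldInChart X φ) φ.target :=
  hX.smooth.contDiffOn_fieldInChart hφ.mem_atlas

theorem fieldInChart_lincomb (a b : ℝ) (φ : OpenPartialHomeomorph M Coord4) :
    fieldInChart (fun p ↦ a • X p + b • Y p) φ =
      fun z ↦ a • fieldInChart X φ z + b • fieldInChart Y φ z := by
  ext1 z
  change mfderiv 𝓘(ℝ, Coord4) 𝓘(ℝ, Coord4) φ (φ.symm z)
    (a • X (φ.symm z) + b • Y (φ.symm z)) = _
  rw [map_add, map_smul, map_smul]
  rfl

theorem fieldInChart_smul (a : ℝ) (φ : OpenPartialHomeomorph M Coord4) (z : Coord4) :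
    fieldInChart (fun p ↦ a • X p) φ z = a • fieldInChart X φ z := by
  change mfderiv 𝓘(ℝ, Coord4) 𝓘(ℝ, Coord4) φ (φ.symm z) (a • X (φ.symm z)) = _
  rw [map_smul]
  rfl

theorem IsParallel.lincomb (hX : IsParallel g K X) (hY : IsParallel g K Y) (a b : ℝ) :
    IsParallel g K (fun p ↦ a • X p + b • Y p) := by
  refine ⟨(hX.smooth.const_smul_section (a := a)).add_section (hY.smooth.const_smul_section (a := b)),
    fun φ hφ z hz u v ↦ ?_, fun φ hφ z hz u v ↦ ?_⟩
  all_goals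
    have dX := (hX.contDiffOn hφ).hasFDerivAt_of_isOpen φ.open_target hz
    have dY := (hY.contDiffOn hφ).hasFDerivAt_of_isOpen φ.open_target hz
    rw [fieldInChart_lincomb]
  · have h1 := hX.killing φ hφ z hz u v
    have h2 := hY.killing φ hφ z hz u v
    have h3 := ((dX.const_smul a).add (dY.const_smul b)).fderiv
    change fderiv ℝ (fun z ↦ a • fieldInChart X φ z + b • fieldInChart Y φ z) z = _ at h3
    rw [h3]
    simp only [map_add, map_smul, add_apply, smul_apply, smul_eq_mul]
    linear_combination a * h1 + b * h2
  · have h1 := hX.closed φ hφ z hz u v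
    have h2 := hY.closed φ hφ z hz u v
    have hB := hφ.symmFieldOn
    rw [hB.fderiv_dual (hX.contDiffOn hφ) hz, hB.fderiv_dual (hX.contDiffOn hφ) hz] at h1
    rw [hB.fderiv_dual (hY.contDiffOn hφ) hz, hB.fderiv_dual (hY.contDiffOn hφ) hz] at h2
    have hs := ((hX.contDiffOn hφ).const_smul a).add ((hY.contDiffOn hφ).const_smul b)
    rw [hB.fderiv_dual hs hz, hB.fderiv_dual hs hz]
    have h3 := ((dX.const_smul a).add (dY.const_smul b)).fderiv
    change fderiv ℝ (fun z ↦ a • fieldInChart X φ z + b • fieldInChart Y φ z) z = _ at h3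
    rw [h3]
    simp only [map_add, map_smul, add_apply, smul_apply, smul_eq_mul]
    linear_combination a * h1 + b * h2

/-- The coefficients of `g` do not depend on `t`, and `K♭ = -dt` is closed. Smoothness of `K` is
deduced as well: locally `K` is the pullback of a constant field. -/
theorem isParallel_of_isUltraStatic (hK : IsUltraStatic g K) : IsParallel g K K := by
  refine ⟨fun p ↦ ?_, fun φ hφ z hz u v ↦ ?_, fun φ hφ z hz u v ↦ ?_⟩
  · have : IsManifold 𝓘(ℝ, Coord4) 1 M := IsManifold.of_le (n := ∞) (by simp)
    obtain ⟨φ, h, hp, hφ⟩ := hK p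
    have hinv : ∀ q ∈ φ.source, (mfderiv 𝓘(ℝ, Coord4) 𝓘(ℝ, Coord4) φ q).IsInvertible ∧
        (mfderiv 𝓘(ℝ, Coord4) 𝓘(ℝ, Coord4) φ q).inverse =
          mfderiv 𝓘(ℝ, Coord4) 𝓘(ℝ, Coord4) φ.symm (φ q) := by
      intro q hq
      have h1 := mfderiv_comp_mfderiv_symm hφ.mem_atlas (φ.map_source hq)
      rw [φ.left_inv hq] at h1
      have h2 := mfderiv_symm_comp_mfderiv hφ.mem_atlas hq
      exact ⟨⟨ContinuousLinearEquiv.equivOfInverse' _ _ h1 h2, rfl⟩,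
        ContinuousLinearMap.inverse_eq h1 h2⟩
    let V : ∀ z : Coord4, TangentSpace 𝓘(ℝ, Coord4) z := fun _ ↦ ((1, 0) : Coord4)
    have hV : ContMDiffAt 𝓘(ℝ, Coord4) 𝓘(ℝ, Coord4).tangent ∞
        (fun z ↦ (⟨z, V z⟩ : TangentBundle 𝓘(ℝ, Coord4) Coord4)) (φ p) :=
      contMDiffWithinAt_univ.1 (contMDiffWithinAt_vectorSpace_iff_contDiffWithinAt.2
        contDiffWithinAt_const)
    have h1 := ContMDiffAt.mpullback_vectorField_preimage (m := ∞) (n := ∞) hV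
      (contMDiffAt_of_mem_maximalAtlas hφ.mem_atlas hp) (hinv p hp).1 (by simp)
    refine h1.congr_of_eventuallyEq ?_
    filter_upwards [φ.open_source.mem_nhds hp] with q hq
    have h2 : VectorField.mpullback 𝓘(ℝ, Coord4) 𝓘(ℝ, Coord4) φ V q = K q := by
      rw [VectorField.mpullback_apply, (hinv q hq).2]
      have h3 := mfderiv_symm_fieldInChart (X := K) hφ.mem_atlas (φ.map_source hq)
      rw [hφ.field_eq _ (φ.map_source hq), φ.left_inv hq] at h3
      exact h3
    rw [h2]
  · have hKc : fieldInChart K φ =ᶠ[𝓝 z] fun _ ↦ (1, 0) := by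
      filter_upwards [φ.open_target.mem_nhds hz] with y hy using hφ.field_eq hy
    rw [hKc.fderiv_eq, hKc.eq_of_nhds, hφ.fderiv_inChart hz]
    simp
  · have hα : (fun y ↦ g.inChart φ y (fieldInChart K φ y)) =ᶠ[𝓝 z]
        fun _ ↦ -ContinuousLinearMap.fst ℝ ℝ Coord3 := by
      filter_upwards [φ.open_target.mem_nhds hz] with y hy
      refine ContinuousLinearMap.ext fun w ↦ ?_
      rw [hφ.field_eq hy, g.inChart_symm, hφ.inChart_right hy]
      rfl
    rw [hα.fderiv_eq]
    simp

/-- Infinitesimally, the flow of `ζ` preserves `g` and hence the set of parallel fields. -/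
theorem IsParallel.mlieBracket (hζ : IsSmoothField ζ) (kζ : IsKillingField g ζ)
    (hX : IsParallel g K X) : IsParallel g K (VectorField.mlieBracket 𝓘(ℝ, Coord4) ζ X) := by
  have hcongr : ∀ φ, IsUltraStaticChart g K φ → EqOn
      (fieldInChart (VectorField.mlieBracket 𝓘(ℝ, Coord4) ζ X) φ)
      (VectorField.lieBracket ℝ (fieldInChart ζ φ) (fieldInChart X φ)) φ.target :=
    fun φ hφ z hz ↦ fieldInChart_mlieBracket hζ hX.smooth hφ.mem_atlas hz
  refine ⟨hζ.mlieBracket hX.smooth, fun φ hφ ↦ ?_, fun φ hφ ↦ ?_⟩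
  · exact (KillingOn.lieBracket hφ.symmFieldOn (hζ.contDiffOn_fieldInChart hφ.mem_atlas)
      (hX.contDiffOn hφ) (kζ φ hφ.mem_atlas) (hX.killing φ hφ)).congr φ.open_target (hcongr φ hφ)
  · exact (ClosedOn.lieBracket hφ.symmFieldOn (hζ.contDiffOn_fieldInChart hφ.mem_atlas)
      (hX.contDiffOn hφ) (kζ φ hφ.mem_atlas) (hX.closed φ hφ)).congr φ.open_target (hcongr φ hφ)

/-- The inner product of two parallel fields is constant. -/
theorem IsParallel.val_eq [PreconnectedSpace M] (hK : IsUltraStatic g K) (hX : IsParallel g K X)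
    (hY : IsParallel g K Y) (p q : M) : g.val p (X p) (Y p) = g.val q (X q) (Y q) := by
  refine IsLocallyConstant.apply_eq_of_preconnectedSpace
    (f := fun p ↦ g.val p (X p) (Y p)) ?_ p q
  rw [IsLocallyConstant.iff_eventually_eq]
  intro p
  obtain ⟨φ, h, hp, hφ⟩ := hK p
  have hU : IsUltraStaticChart g K φ := ⟨h, hφ⟩
  obtain ⟨ε, hε, hball⟩ := Metric.isOpen_iff.1 φ.open_target _ (φ.map_source hp)
  set f : Coord4 → ℝ := fun z ↦ g.inChart φ z (fieldInChart X φ z) (fieldInChart Y φ z) with hf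
  have hfs : ContDiffOn ℝ ∞ f φ.target :=
    hU.symmFieldOn.smooth_apply (hX.contDiffOn hU) (hY.contDiffOn hU)
  have hnear : φ.source ∩ φ ⁻¹' Metric.ball (φ p) ε ∈ 𝓝 p :=
    (φ.isOpen_inter_preimage Metric.isOpen_ball).mem_nhds ⟨hp, Metric.mem_ball_self hε⟩
  filter_upwards [hnear] with q hq
  rw [val_eq_inChart hφ.mem_atlas hq.1, val_eq_inChart hφ.mem_atlas hp]
  refine Metric.isOpen_ball.is_const_of_fderiv_eq_zero (𝕜 := ℝ) (f := f)
    (convex_ball (φ p) ε).isPreconnected ((hfs.mono hball).differentiableOn (by simp))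
    (fun z hz ↦ ?_) hq.2 (Metric.mem_ball_self hε)
  refine ContinuousLinearMap.ext fun u ↦ ?_
  exact KillingOn.fderiv_apply_eq_zero hU.symmFieldOn (hX.contDiffOn hU) (hY.contDiffOn hU)
    (hX.killing φ hU) (hY.killing φ hU) (hX.closed φ hU) (hY.closed φ hU) (hball hz) u

/-- `g([ζ, X], Y) + g(X, [ζ, Y]) = 0` for a Killing field `ζ` and parallel fields `X`, `Y`. -/
theorem IsParallel.val_mlieBracket_add (hK : IsUltraStatic g K) (hX : IsParallel g K X)
    (hY : IsParallel g K Y) (hζ : IsSmoothField ζ) (kζ : IsKillingField g ζ) (p : M) :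
    g.val p (VectorField.mlieBracket 𝓘(ℝ, Coord4) ζ X p) (Y p) +
      g.val p (X p) (VectorField.mlieBracket 𝓘(ℝ, Coord4) ζ Y p) = 0 := by
  obtain ⟨φ, h, hp, hφ⟩ := hK p
  have hU : IsUltraStaticChart g K φ := ⟨h, hφ⟩
  have hz := φ.map_source hp
  rw [val_eq_inChart hφ.mem_atlas hp, val_eq_inChart (X := X) hφ.mem_atlas hp,
    fieldInChart_mlieBracket hζ hX.smooth hφ.mem_atlas hz,
    fieldInChart_mlieBracket hζ hY.smooth hφ.mem_atlas hz,
    KillingOn.lieBracket_add hU.symmFieldOn (hX.contDiffOn hU) (hY.contDiffOn hU)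
      (kζ φ hφ.mem_atlas) hz]
  exact KillingOn.fderiv_apply_eq_zero hU.symmFieldOn (hX.contDiffOn hU) (hY.contDiffOn hU)
    (hX.killing φ hU) (hY.killing φ hU) (hX.closed φ hU) (hY.closed φ hU) hz _

/-- A field orthogonal to `K` is spacelike. -/
theorem IsUltraStatic.val_nonneg (hK : IsUltraStatic g K) {p : M} {u : TangentSpace 𝓘(ℝ, Coord4) p}
    (hu : g.val p u (K p) = 0) : 0 ≤ g.val p u u ∧ (g.val p u u = 0 → u = 0) := by
  obtain ⟨φ, h, hp, hφ⟩ := hK p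
  have hU : IsUltraStaticChart g K φ := ⟨h, hφ⟩
  have hz := φ.map_source hp
  set w : Coord4 := mfderiv 𝓘(ℝ, Coord4) 𝓘(ℝ, Coord4) φ p u with hw
  -- All tangent spaces are modelled on `Coord4`, so `u` extends to an arbitrary field; only its
  -- value at `p` is used.
  let X : ∀ q : M, TangentSpace 𝓘(ℝ, Coord4) q := fun q ↦ (u : Coord4)
  have hX : fieldInChart X φ (φ p) = w := by
    have h1 := φ.left_inv hp
    rw [fieldInChart, h1]
  have h1 := val_eq_inChart (g := g) (X := X) (Y := K) hφ.mem_atlas hp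
  have h2 := val_eq_inChart (g := g) (X := X) (Y := X) hφ.mem_atlas hp
  rw [hX, hU.field_eq hz, hU.inChart_right hz] at h1
  rw [hX] at h2
  have hw1 : w.1 = 0 := by
    have : g.val p (X p) (K p) = 0 := hu
    linarith
  by_cases hw0 : w = 0
  · have h3 := DFunLike.congr_fun (mfderiv_symm_comp_mfderiv hφ.mem_atlas hp) u
    have hu0 : u = 0 := by
      rw [← show _ = u from h3]
      change mfderiv 𝓘(ℝ, Coord4) 𝓘(ℝ, Coord4) φ.symm (φ p) w = 0
      rw [hw0]
      exact map_zero _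
    subst hu0
    simp
  · have h3 := hU.inChart_pos hz hw1 hw0
    rw [← h2] at h3
    exact ⟨h3.le, fun h ↦ absurd h h3.ne'⟩

end Parallel

end

/-! ### Existence of a parallel unit field orthogonal to `K` -/

noncomputable section
set_option linter.unusedSectionVars false

section UnitParallel

open Set
open scoped Topology

variable {M : Type*} [TopologicalSpace M] [ChartedSpace Coord4 M]
  [IsManifold 𝓘(ℝ, Coord4) ∞ M] {φ : OpenPartialHomeomorph M Coord4} {g : LorentzMetric M}
  {K R X Y ζ ξ : ∀ p : M, TangentSpace 𝓘(ℝ, Coord4) p}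

theorem IsUltraStatic.val_self (hK : IsUltraStatic g K) (p : M) : g.val p (K p) (K p) = -1 := by
  obtain ⟨φ, h, hp, hφ⟩ := hK p
  have hU : IsUltraStaticChart g K φ := ⟨h, hφ⟩
  rw [val_eq_inChart hφ.mem_atlas hp, hU.field_eq (φ.map_source hp),
    hU.inChart_right (φ.map_source hp)]

/-- A timelike field is not orthogonal to `K`. -/
theorem IsHSOTimelikeKilling.val_ne_zero (hK : IsUltraStatic g K) (hζ : IsHSOTimelikeKilling g ζ)
    (p : M) : g.val p (ζ p) (K p) ≠ 0 := fun h ↦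
  absurd (hζ.timelike p) (not_lt.2 (hK.val_nonneg h).1)

/-- A hypersurface-orthogonal Killing field which commutes with `K` is parallel. -/
theorem IsHSOTimelikeKilling.isParallel (hK : IsUltraStatic g K) (hζ : IsHSOTimelikeKilling g ζ)
    (hcomm : ∀ p, VectorField.mlieBracket 𝓘(ℝ, Coord4) ζ K p = 0) : IsParallel g K ζ := by
  have pK := isParallel_of_isUltraStatic hK
  refine ⟨hζ.smooth, fun φ hφ ↦ hζ.killing φ hφ.mem_atlas, fun φ hφ z hz v w ↦ ?_⟩
  have hζs := IsSmoothField.contDiffOn_fieldInChart hζ.smooth hφ.mem_atlas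
  -- This is `dζ♭(K, ·) = -2[ζ, K]♭`, which vanishes because the fields commute.
  have hext : ∀ v, extDerivOneForm (dualFormInChart g ζ φ) z (fieldInChart K φ z) v = 0 := by
    intro v
    have h1 := KillingOn.extDeriv_dual hφ.symmFieldOn hζs (pK.contDiffOn hφ)
      (hζ.killing φ hφ.mem_atlas) (pK.killing φ hφ) (pK.closed φ hφ) hz v
    rw [← fieldInChart_mlieBracket hζ.smooth pK.smooth hφ.mem_atlas hz] at h1
    have h2 : fieldInChart (VectorField.mlieBracket 𝓘(ℝ, Coord4) ζ K) φ z = 0 := by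
      rw [fieldInChart, hcomm]
      exact map_zero _
    rw [h2, map_zero, zero_apply, mul_zero] at h1
    exact h1
  have hanti : ∀ u v, extDerivOneForm (dualFormInChart g ζ φ) z u v =
      -extDerivOneForm (dualFormInChart g ζ φ) z v u := fun u v ↦ by
    simp [extDerivOneForm]
  -- On `(K, v, w)` the identity `ζ♭ ∧ dζ♭ = 0` reduces to `ζ♭(K) dζ♭(v, w) = 0`.
  have h3 := hζ.hypersurfaceOrthogonal φ hφ.mem_atlas z hz (fieldInChart K φ z) v w
  rw [hext, hanti w, hext, neg_zero, mul_zero, mul_zero, add_zero, add_zero] at h3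
  have h4 : dualFormInChart g ζ φ z (fieldInChart K φ z) ≠ 0 := by
    rw [dualFormInChart, inChart_fieldInChart hφ.mem_atlas hz]
    exact hζ.val_ne_zero hK _
  exact sub_eq_zero.1 ((mul_eq_zero.1 h3).resolve_left h4)

/-- `R` is a parallel unit vector field orthogonal to `K`. -/
structure IsUnitParallel (g : LorentzMetric M) (K R : ∀ p : M, TangentSpace 𝓘(ℝ, Coord4) p) :
    Prop where
  parallel : IsParallel g K R
  orth : ∀ p, g.val p (R p) (K p) = 0
  unit : ∀ p, g.val p (R p) (R p) = 1

/-- The squared length is constant and positive at `p₀`, so a constant rescaling normalises the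
field everywhere. The term with coefficient `0` only matches the shape of `IsParallel.lincomb`. -/
theorem IsParallel.exists_isUnitParallel [PreconnectedSpace M] (hK : IsUltraStatic g K)
    (hX : IsParallel g K X) (horth : ∀ p, g.val p (X p) (K p) = 0) {p₀ : M} (hp₀ : X p₀ ≠ 0) :
    ∃ c : ℝ, IsUnitParallel g K (fun p ↦ c • X p + (0 : ℝ) • X p) := by
  obtain ⟨h1, h2⟩ := hK.val_nonneg (horth p₀)
  have hpos : 0 < g.val p₀ (X p₀) (X p₀) := lt_of_le_of_ne h1 fun h ↦ hp₀ (h2 h.symm)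
  refine ⟨(√(g.val p₀ (X p₀) (X p₀)))⁻¹, hX.lincomb hX _ _, fun p ↦ ?_, fun p ↦ ?_⟩
  · rw [zero_smul, add_zero, map_smul, smul_apply, horth, smul_zero]
  · rw [zero_smul, add_zero, map_smul, map_smul, smul_apply, hX.val_eq hK hX p p₀, smul_eq_mul,
      smul_eq_mul, ← mul_assoc, ← mul_inv, Real.mul_self_sqrt hpos.le, inv_mul_cancel₀ hpos.ne']

theorem IsHSOTimelikeKilling.val_mlieBracket_self (hK : IsUltraStatic g K)
    (hζ : IsHSOTimelikeKilling g ζ) (hX : IsParallel g K X) (p : M) :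
    g.val p (VectorField.mlieBracket 𝓘(ℝ, Coord4) ζ X p) (X p) = 0 := by
  have h := IsParallel.val_mlieBracket_add hK hX hX hζ.smooth hζ.killing p
  rw [g.symm p (X p)] at h
  linarith

/-- A static Killing field other than the constant multiples of `K` yields a parallel unit
field orthogonal to `K`. -/
theorem exists_isUnitParallel [ConnectedSpace M] (hK : IsUltraStatic g K)
    (hξ : IsHSOTimelikeKilling g ξ) (hne : ¬ ∃ c : ℝ, ∀ p, ξ p = c • K p) :
    ∃ R, IsUnitParallel g K R := by
  have pK := isParallel_of_isUltraStatic hK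
  by_cases hcomm : ∀ p, VectorField.mlieBracket 𝓘(ℝ, Coord4) ξ K p = 0
  · have pξ := hξ.isParallel hK hcomm
    obtain ⟨p₀⟩ : Nonempty M := inferInstance
    -- As `g(K, K) = -1`, the projection of `ξ` orthogonal to `K` is `ξ + cK`.
    set c := g.val p₀ (ξ p₀) (K p₀) with hc
    have pS := pξ.lincomb pK 1 c
    have horth : ∀ p, g.val p ((1 : ℝ) • ξ p + c • K p) (K p) = 0 := fun p ↦ by
      rw [one_smul, map_add, add_apply, map_smul, smul_apply, hK.val_self, hc,
        pξ.val_eq hK pK p p₀, smul_eq_mul]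
      ring
    have hex : ∃ p, (1 : ℝ) • ξ p + c • K p ≠ 0 := by
      by_contra! hall
      refine hne ⟨-c, fun p ↦ ?_⟩
      have := hall p
      rw [one_smul] at this
      rw [neg_smul]
      exact eq_neg_of_add_eq_zero_left this
    obtain ⟨p₁, hp₁⟩ := hex
    obtain ⟨c', hc'⟩ := pS.exists_isUnitParallel hK horth hp₁
    exact ⟨_, hc'⟩
  · push Not at hcomm
    obtain ⟨p₀, hp₀⟩ := hcomm
    obtain ⟨c, hc⟩ := (IsParallel.mlieBracket hξ.smooth hξ.killing pK).exists_isUnitParallel hK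
      (hξ.val_mlieBracket_self hK pK) hp₀
    exact ⟨_, hc⟩

/-- If there are no two orthonormal parallel fields orthogonal to `K`, then all the parallel fields
are combinations of `K` and `R`. -/
theorem IsParallel.eq_lincomb [PreconnectedSpace M] (hK : IsUltraStatic g K)
    (hR : IsUnitParallel g K R)
    (hdim : ∀ S, IsUnitParallel g K S → ∃ p, g.val p (S p) (R p) ≠ 0)
    (hX : IsParallel g K X) (p : M) :
    X p = (-g.val p (X p) (K p)) • K p + g.val p (X p) (R p) • R p := by
  have pK := isParallel_of_isUltraStatic hK
  set a := g.val p (X p) (K p) with ha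
  set b := g.val p (X p) (R p) with hb
  -- `X + aK - bR` is `X` minus its projection to the span of `K` and `R`. If it were nonzero at
  -- `p`, normalising it would contradict `hdim`.
  have pS := (hX.lincomb pK 1 a).lincomb hR.parallel 1 (-b)
  have hRK : ∀ q, g.val q (K q) (R q) = 0 := fun q ↦ by rw [g.symm, hR.orth]
  have hSK : ∀ q, g.val q ((1 : ℝ) • ((1 : ℝ) • X q + a • K q) + (-b) • R q) (K q) = 0 :=
    fun q ↦ by
      rw [one_smul, one_smul, map_add, map_add, map_smul, map_smul, add_apply, add_apply,
        smul_apply, smul_apply, hK.val_self, hR.orth, hX.val_eq hK pK q p, ← ha]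
      simp
  have hSR : ∀ q, g.val q ((1 : ℝ) • ((1 : ℝ) • X q + a • K q) + (-b) • R q) (R q) = 0 :=
    fun q ↦ by
      rw [one_smul, one_smul, map_add, map_add, map_smul, map_smul, add_apply, add_apply,
        smul_apply, smul_apply, hRK, hR.unit, hX.val_eq hK hR.parallel q p, ← hb]
      simp
  have hS0 : (1 : ℝ) • ((1 : ℝ) • X p + a • K p) + (-b) • R p = 0 := by
    by_contra hne
    obtain ⟨c, hc⟩ := pS.exists_isUnitParallel hK hSK hne
    obtain ⟨q, hq⟩ := hdim _ hc
    rw [zero_smul, add_zero, map_smul, smul_apply, hSR, smul_zero] at hq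
    exact hq rfl
  rw [one_smul, one_smul] at hS0
  have : X p = -(a • K p) + b • R p := by
    rw [← sub_eq_zero, ← hS0, neg_smul]
    abel
  rw [this, neg_smul]

end UnitParallel

end

/-! ### Operations on static charts -/

noncomputable section
set_option linter.unusedSectionVars false

section StaticCharts

open Set
open scoped Topology

theorem OpenPartialHomeomorph.fderiv_fderiv_symm {E : Type*} [NormedAddCommGroup E]
    [NormedSpace ℝ E] {e : OpenPartialHomeomorph E E} (he : ContDiffOn ℝ ∞ e e.source)
    (he' : ContDiffOn ℝ ∞ e.symm e.target) {z : E} (hz : z ∈ e.target) (u : E) :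
    fderiv ℝ e (e.symm z) (fderiv ℝ e.symm z u) = u := by
  have h1 := (he.hasFDerivAt_of_isOpen e.open_source (e.map_target hz)).comp z
    (he'.hasFDerivAt_of_isOpen e.open_target hz)
  have h2 : HasFDerivAt (e ∘ e.symm) (ContinuousLinearMap.id ℝ E) z := by
    refine (hasFDerivAt_id z).congr_of_eventuallyEq ?_
    filter_upwards [e.open_target.mem_nhds hz] with y hy using e.right_inv hy
  exact DFunLike.congr_fun (h1.unique h2) u

/-- A function whose derivative in the direction `w` vanishes on an open convex set is constant
in that direction. -/
theorem Convex.eq_of_fderiv_apply_eq_zero {E F : Type*} [NormedAddCommGroup E] [NormedSpace ℝ E]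
    [NormedAddCommGroup F] [NormedSpace ℝ F] {U : Set E} (hc : Convex ℝ U) (hU : IsOpen U)
    {f : E → F} (hf : DifferentiableOn ℝ f U) {w : E} (hw : ∀ z ∈ U, fderiv ℝ f z w = 0) {z : E}
    (hz : z ∈ U) {s : ℝ} (hs : z + s • w ∈ U) : f (z + s • w) = f z := by
  set J : Set ℝ := (fun s : ℝ ↦ z + s • w) ⁻¹' U with hJ
  have hJo : IsOpen J := hU.preimage (by fun_prop)
  have hJc : Convex ℝ J := by
    intro a ha b hb c d hc' hd hcd
    have := hc ha hb hc' hd hcd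
    rw [hJ, mem_preimage]
    obtain rfl : d = 1 - c := by linarith
    convert this using 1
    module
  have hd : ∀ a ∈ J, HasDerivAt (fun s : ℝ ↦ f (z + s • w)) 0 a := by
    intro a ha
    have h1 : HasDerivAt (fun s : ℝ ↦ z + s • w) w a := by
      simpa using ((hasDerivAt_id a).smul_const w).const_add z
    have h2 := (hf.differentiableAt (hU.mem_nhds ha)).hasFDerivAt.comp_hasDerivAt a h1
    rw [hw _ ha] at h2
    exact h2
  have := hJo.is_const_of_deriv_eq_zero hJc.isPreconnected
    (fun a ha ↦ (hd a ha).differentiableAt.differentiableWithinAt) (fun a ha ↦ (hd a ha).deriv)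
    (show s ∈ J from hs) (show (0 : ℝ) ∈ J by simpa [hJ] using hz)
  simpa using this

variable {M : Type*} [TopologicalSpace M] [ChartedSpace Coord4 M]
  [IsManifold 𝓘(ℝ, Coord4) ∞ M] {φ : OpenPartialHomeomorph M Coord4} {g : LorentzMetric M}
  {K R X Y ζ ξ : ∀ p : M, TangentSpace 𝓘(ℝ, Coord4) p} {V : Coord3 → ℝ}
  {h h' : Coord3 → Coord3 →L[ℝ] Coord3 →L[ℝ] ℝ}

theorem IsRiemannianOn.congr {F : Type*} [NormedAddCommGroup F] [NormedSpace ℝ F]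
    {h h' : F → F →L[ℝ] F →L[ℝ] ℝ} {Ω : Set F} (hh : IsRiemannianOn h Ω) (heq : EqOn h' h Ω) :
    IsRiemannianOn h' Ω :=
  ⟨fun x hx u v ↦ by rw [heq hx]; exact hh.symm x hx u v,
    fun x hx u hu ↦ by rw [heq hx]; exact hh.pos x hx u hu, hh.smooth.congr heq⟩

theorem IsStaticChart.congr_metric (hφ : IsStaticChart g K φ V h)
    (heq : EqOn h' h (Prod.snd '' φ.target)) : IsStaticChart g K φ V h' :=
  ⟨hφ.mem_atlas, hφ.field_eq, fun z hz u v ↦ by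
    rw [heq (mem_image_of_mem _ hz), hφ.metric_eq z hz], hφ.potential_pos, hφ.potential_smooth,
    hφ.riemannian.congr heq⟩

/-- Restriction of a static chart to a ball. -/
theorem IsStaticChart.exists_ball (hφ : IsStaticChart g K φ V h) {p : M} (hp : p ∈ φ.source) :
    ∃ (ψ : OpenPartialHomeomorph M Coord4) (ε : ℝ), 0 < ε ∧ ψ.target = Metric.ball (φ p) ε ∧
      p ∈ ψ.source ∧ ψ.source ⊆ φ.source ∧ ψ.target ⊆ φ.target ∧ (∀ q, ψ q = φ q) ∧
      IsStaticChart g K ψ V h ∧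
      ∀ X : ∀ p : M, TangentSpace 𝓘(ℝ, Coord4) p,
        EqOn (fieldInChart X ψ) (fieldInChart X φ) ψ.target := by
  obtain ⟨ε, hε, hball⟩ := Metric.isOpen_iff.1 φ.open_target _ (φ.map_source hp)
  set e := OpenPartialHomeomorph.ofSet (Metric.ball (φ p) ε) Metric.isOpen_ball with he
  have hes : ContDiffOn ℝ ∞ e e.source := contDiffOn_id
  have hes' : ContDiffOn ℝ ∞ e.symm e.target := contDiffOn_id
  have hid : ∀ z, fderiv ℝ e z = ContinuousLinearMap.id ℝ Coord4 := fun z ↦ fderiv_id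
  have hid' : ∀ z, fderiv ℝ e.symm z = ContinuousLinearMap.id ℝ Coord4 := fun z ↦ fderiv_id
  have htarget : (φ.trans e).target = Metric.ball (φ p) ε := by
    rw [OpenPartialHomeomorph.trans_target]
    exact inter_eq_left.2 fun z hz ↦ hball hz
  have hsub : (φ.trans e).target ⊆ φ.target := htarget ▸ hball
  have hfield : ∀ X : ∀ p : M, TangentSpace 𝓘(ℝ, Coord4) p,
      EqOn (fieldInChart X (φ.trans e)) (fieldInChart X φ) (φ.trans e).target := fun X z hz ↦ by
    rw [fieldInChart_trans hφ.mem_atlas hes hz, hid]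
    rfl
  refine ⟨φ.trans e, ε, hε, htarget, ⟨hp, Metric.mem_ball_self hε⟩, fun q hq ↦ hq.1, hsub,
    fun q ↦ rfl,
    ⟨trans_mem_maximalAtlas hφ.mem_atlas hes hes', fun z hz ↦ ?_, fun z hz u v ↦ ?_,
      fun z hz ↦ hφ.potential_pos z (hsub hz), hφ.potential_smooth.mono (image_mono hsub),
      ⟨fun x hx ↦ hφ.riemannian.symm x (image_mono hsub hx),
        fun x hx ↦ hφ.riemannian.pos x (image_mono hsub hx),
        hφ.riemannian.smooth.mono (image_mono hsub)⟩⟩, hfield⟩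
  · rw [hfield K hz, hφ.field_eq z (hsub hz)]
  · rw [inChart_trans hφ.mem_atlas hes' hz, hid']
    exact hφ.metric_eq z (hsub hz) u v

/-- The change `(t, X) ↦ (t, e X)` of the spatial coordinates. -/
def spatialChange (e : OpenPartialHomeomorph Coord3 Coord3) :
    OpenPartialHomeomorph Coord4 Coord4 :=
  (OpenPartialHomeomorph.refl ℝ).prod e

variable {e : OpenPartialHomeomorph Coord3 Coord3}

theorem contDiffOn_spatialChange (he : ContDiffOn ℝ ∞ e e.source) :
    ContDiffOn ℝ ∞ (spatialChange e) (spatialChange e).source :=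
  contDiffOn_fst.prodMk (he.comp contDiffOn_snd fun _ hz ↦ hz.2)

theorem contDiffOn_spatialChange_symm (he' : ContDiffOn ℝ ∞ e.symm e.target) :
    ContDiffOn ℝ ∞ (spatialChange e).symm (spatialChange e).target :=
  contDiffOn_fst.prodMk (he'.comp contDiffOn_snd fun _ hz ↦ hz.2)

theorem fderiv_spatialChange (he : ContDiffOn ℝ ∞ e e.source) {z : Coord4} (hz : z.2 ∈ e.source)
    (u : Coord4) : fderiv ℝ (spatialChange e) z u = (u.1, fderiv ℝ e z.2 u.2) := by
  have h1 : HasFDerivAt (spatialChange e) _ z := hasFDerivAt_fst.prodMk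
    ((he.hasFDerivAt_of_isOpen e.open_source hz).comp z hasFDerivAt_snd)
  rw [h1.fderiv]
  rfl

theorem fderiv_spatialChange_symm (he' : ContDiffOn ℝ ∞ e.symm e.target) {z : Coord4}
    (hz : z.2 ∈ e.target) (u : Coord4) :
    fderiv ℝ (spatialChange e).symm z u = (u.1, fderiv ℝ e.symm z.2 u.2) := by
  have h1 : HasFDerivAt (spatialChange e).symm _ z := hasFDerivAt_fst.prodMk
    ((he'.hasFDerivAt_of_isOpen e.open_target hz).comp z hasFDerivAt_snd)
  rw [h1.fderiv]
  rfl

theorem IsStaticChart.trans_spatialChange (hφ : IsStaticChart g K φ (fun _ ↦ 1) h)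
    (he : ContDiffOn ℝ ∞ e e.source) (he' : ContDiffOn ℝ ∞ e.symm e.target) :
    IsStaticChart g K (φ.trans (spatialChange e)) (fun _ ↦ 1)
      (fun Y ↦ (h (e.symm Y)).bilinearComp (fderiv ℝ e.symm Y) (fderiv ℝ e.symm Y)) := by
  have hs := contDiffOn_spatialChange he
  have hs' := contDiffOn_spatialChange_symm he'
  have himage : ∀ Y ∈ Prod.snd '' (φ.trans (spatialChange e)).target,
      Y ∈ e.target ∧ e.symm Y ∈ Prod.snd '' φ.target := by
    rintro _ ⟨z, hz, rfl⟩
    exact ⟨hz.1.2, ⟨_, hz.2, rfl⟩⟩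
  refine ⟨trans_mem_maximalAtlas hφ.mem_atlas hs hs', fun z hz ↦ ?_, fun z hz u v ↦ ?_,
    fun _ _ ↦ one_pos, contDiffOn_const, fun Y hY u v ↦ ?_, fun Y hY u hu ↦ ?_, ?_⟩
  · rw [fieldInChart_trans hφ.mem_atlas hs hz, hφ.field_eq _ hz.2,
      fderiv_spatialChange he ((spatialChange e).map_target hz.1).2]
    simp
  · rw [inChart_trans hφ.mem_atlas hs' hz, hφ.metric_eq _ hz.2,
      fderiv_spatialChange_symm he' hz.1.2, fderiv_spatialChange_symm he' hz.1.2]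
    rfl
  · exact hφ.riemannian.symm _ (himage Y hY).2 _ _
  · refine hφ.riemannian.pos _ (himage Y hY).2 _ fun h0 ↦ hu ?_
    rw [← OpenPartialHomeomorph.fderiv_fderiv_symm he he' (himage Y hY).1 u]
    exact (congrArg _ h0).trans (map_zero _)
  · refine contDiffOn_clm_apply.2 fun u ↦ contDiffOn_clm_apply.2 fun v ↦ ?_
    have hsub : Prod.snd '' (φ.trans (spatialChange e)).target ⊆ e.target :=
      fun Y hY ↦ (himage Y hY).1
    have h1 : ContDiffOn ℝ ∞ (fderiv ℝ e.symm) (Prod.snd '' (φ.trans (spatialChange e)).target) :=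
      (he'.smooth_fderiv e.open_target).mono hsub
    exact ((hφ.riemannian.smooth.comp (he'.mono hsub) fun Y hY ↦ (himage Y hY).2).clm_apply
      (h1.clm_apply contDiffOn_const)).clm_apply (h1.clm_apply contDiffOn_const)

end StaticCharts

end

/-! ### Splitting off the direction `R` -/

noncomputable section
set_option linter.unusedSectionVars false

section SplitCharts

open Set
open scoped Topology

/-- The Poincaré lemma for closed one-forms on open convex sets. -/
theorem Convex.exists_contDiffOn_primitive {E : Type*} [NormedAddCommGroup E] [NormedSpace ℝ E]
    {U : Set E} (hc : Convex ℝ U) (hU : IsOpen U) {α : E → E →L[ℝ] ℝ} (hα : ContDiffOn ℝ ∞ α U)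
    (hcl : ∀ z ∈ U, ∀ u v, fderiv ℝ α z u v = fderiv ℝ α z v u) :
    ∃ ρ : E → ℝ, ContDiffOn ℝ ∞ ρ U ∧ ∀ z ∈ U, HasFDerivAt ρ (α z) z := by
  obtain ⟨ρ, hρ⟩ := hc.exists_forall_hasFDerivAt_of_fderiv_symmetric hU
    (hα.differentiableOn (by simp)) hcl
  refine ⟨ρ, (contDiffOn_infty_iff_fderiv_of_isOpen hU).2
    ⟨fun z hz ↦ (hρ z hz).differentiableAt.differentiableWithinAt,
      hα.congr fun z hz ↦ (hρ z hz).fderiv⟩, hρ⟩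

theorem KillingOn.fderiv_eq_zero_of_const {E : Type*} [NormedAddCommGroup E] [NormedSpace ℝ E]
    {B : E → E →L[ℝ] E →L[ℝ] ℝ} {X : E → E} {U : Set E} (kX : KillingOn B X U) (hU : IsOpen U)
    {w : E} (hX : ∀ z ∈ U, X z = w) {z : E} (hz : z ∈ U) (u v : E) : fderiv ℝ B z w u v = 0 := by
  have h1 : X =ᶠ[𝓝 z] fun _ ↦ w := by
    filter_upwards [hU.mem_nhds hz] with y hy using hX y hy
  have h2 := kX z hz u v
  rw [h1.fderiv_eq, hX z hz] at h2
  simpa using h2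

variable {M : Type*} [TopologicalSpace M] [ChartedSpace Coord4 M]
  [IsManifold 𝓘(ℝ, Coord4) ∞ M] {φ : OpenPartialHomeomorph M Coord4} {g : LorentzMetric M}
  {K R X Y ζ ξ : ∀ p : M, TangentSpace 𝓘(ℝ, Coord4) p}

/-- Parallel fields commute, and the bracket with a field of constant components is a directional
derivative. -/
theorem IsParallel.fderiv_eq_zero_of_const (hφ : IsUltraStaticChart g K φ) (hX : IsParallel g K X)
    (hY : IsParallel g K Y) {w : Coord4} (hXw : ∀ z ∈ φ.target, fieldInChart X φ z = w)
    {z : Coord4} (hz : z ∈ φ.target) : fderiv ℝ (fieldInChart Y φ) z w = 0 := by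
  have h1 := KillingOn.lieBracket_eq_zero hφ.symmFieldOn (hX.contDiffOn hφ) (hY.contDiffOn hφ)
    (hX.killing φ hφ) (hY.killing φ hφ) (hX.closed φ hφ) (hY.closed φ hφ) hz (hφ.nondegenerate hz)
  have h2 : fieldInChart X φ =ᶠ[𝓝 z] fun _ ↦ w := by
    filter_upwards [φ.open_target.mem_nhds hz] with y hy using hXw y hy
  rw [VectorField.lieBracket, h2.fderiv_eq, hXw z hz] at h1
  simpa using h1

/-- `φ = (t, r, x, y)` is a chart in which `K = ∂/∂t`, `R = ∂/∂r` and
`g = -dt² + dr² + γ(x, y)`. -/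
structure IsSplitChart (g : LorentzMetric M) (K R : ∀ p : M, TangentSpace 𝓘(ℝ, Coord4) p)
    (φ : OpenPartialHomeomorph M Coord4) (γ : Coord2 → Coord2 →L[ℝ] Coord2 →L[ℝ] ℝ) : Prop where
  static : IsStaticChart g K φ (fun _ ↦ 1) (productMetric γ)
  field_eq : ∀ z ∈ φ.target, fieldInChart R φ z = (0, 1, 0)
  riemannian : IsRiemannianOn γ ((fun z : Coord4 ↦ z.2.2) '' φ.target)
  convex : Convex ℝ φ.target

/-- Coordinates of the space in which the parallel field `R` is the first coordinate field and the
dual form of `R` is the differential of the first coordinate. -/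
theorem exists_spatialChange {h : Coord3 → Coord3 →L[ℝ] Coord3 →L[ℝ] ℝ}
    (hφ : IsStaticChart g K φ (fun _ ↦ 1) h) (hK : IsParallel g K K) (hR : IsUnitParallel g K R)
    {c : Coord4} {ε : ℝ} (hε : 0 < ε) (htarget : φ.target = Metric.ball c ε) :
    ∃ e : OpenPartialHomeomorph Coord3 Coord3, c.2 ∈ e.source ∧
      ContDiffOn ℝ ∞ e e.source ∧ ContDiffOn ℝ ∞ e.symm e.target ∧
      (∀ z ∈ (φ.trans (spatialChange e)).target,
        fieldInChart R (φ.trans (spatialChange e)) z = (0, 1, 0)) ∧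
      ∀ z ∈ (φ.trans (spatialChange e)).target, ∀ v : Coord4,
        g.inChart (φ.trans (spatialChange e)) z (0, 1, 0) v = v.2.1 := by
  have hU : IsUltraStaticChart g K φ := ⟨h, hφ⟩
  have hc : Convex ℝ φ.target := htarget ▸ convex_ball c ε
  set R₀ := fieldInChart R φ with hR₀
  have hR₀s : ContDiffOn ℝ ∞ R₀ φ.target := hR.parallel.contDiffOn hU
  have hR₁ : ∀ z ∈ φ.target, (R₀ z).1 = 0 := fun z hz ↦ by
    have h1 := inChart_fieldInChart (X := R) (Y := K) (g := g) hφ.mem_atlas hz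
    rw [hφ.field_eq z hz, hU.inChart_right hz, hR.orth] at h1
    linarith
  have hRR : ∀ z ∈ φ.target, g.inChart φ z (R₀ z) (R₀ z) = 1 := fun z hz ↦ by
    rw [hR₀, inChart_fieldInChart hφ.mem_atlas hz, hR.unit]
  -- Balls of `Coord4` are products, the norm being the sup norm, so the slice `t = c.1` runs over
  -- the full spatial ball.
  have hmem : ∀ X ∈ Metric.ball c.2 ε, (c.1, X) ∈ φ.target := fun X hX ↦ by
    rw [htarget, Metric.mem_ball, Prod.dist_eq]
    exact max_lt (by simpa using hε) hX
  have hmem' : ∀ z ∈ φ.target, z.2 ∈ Metric.ball c.2 ε := fun z hz ↦ by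
    rw [htarget, Metric.mem_ball, Prod.dist_eq] at hz
    exact (max_lt_iff.1 hz).2
  -- Since `R` commutes with `K = ∂/∂t`, its components do not depend on `t`, and the problem
  -- descends to the spatial coordinates.
  have hRt : ∀ z ∈ φ.target, R₀ z = R₀ (c.1, z.2) := fun z hz ↦ by
    have hz' : z = (c.1, z.2) + (z.1 - c.1) • ((1, 0) : Coord4) := by simp
    have h1 := hc.eq_of_fderiv_apply_eq_zero φ.open_target (hR₀s.differentiableOn (by simp))
      (fun y hy ↦ hK.fderiv_eq_zero_of_const hU hR.parallel hφ.field_eq hy)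
      (hmem _ (hmem' z hz)) (hz' ▸ hz)
    rw [← h1, ← hz']
  -- Here `R♭ = dρ`, so `dρ(R) = g(R, R) = 1`, as `exists_straightening` requires.
  obtain ⟨ρ, hρs, hρ⟩ := hc.exists_contDiffOn_primitive φ.open_target
    (hU.symmFieldOn.smooth.clm_apply hR₀s) (hR.parallel.closed φ hU)
  have hι : ContDiff ℝ ∞ (fun X : Coord3 ↦ ((c.1, X) : Coord4)) :=
    contDiff_const.prodMk contDiff_id
  set R₃ : Coord3 → Coord3 := fun X ↦ (R₀ (c.1, X)).2 with hR₃
  set ρ₃ : Coord3 → ℝ := fun X ↦ ρ (c.1, X) with hρ₃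
  have hRR₃ : ∀ z ∈ φ.target, R₀ z = (0, R₃ z.2) := fun z hz ↦ by
    rw [hRt z hz]
    exact Prod.ext (hR₁ _ (hmem _ (hmem' z hz))) rfl
  have hR₃s : ContDiffOn ℝ ∞ R₃ (Metric.ball c.2 ε) :=
    (hR₀s.comp hι.contDiffOn hmem).snd
  have hρ₃s : ContDiffOn ℝ ∞ ρ₃ (Metric.ball c.2 ε) := hρs.comp hι.contDiffOn hmem
  have hρ₃d : ∀ X ∈ Metric.ball c.2 ε, ∀ v, fderiv ℝ ρ₃ X v = h X (R₃ X) v := fun X hX v ↦ by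
    have h1 : HasFDerivAt ρ₃ _ X := (hρ _ (hmem X hX)).comp X
      ((hasFDerivAt_const c.1 X).prodMk (hasFDerivAt_id X))
    rw [h1.fderiv]
    change g.inChart φ (c.1, X) (R₀ (c.1, X)) (0, v) = _
    rw [hφ.metric_eq _ (hmem X hX)]
    simp [hR₃]
  have hρR : ∀ X ∈ Metric.ball c.2 ε, fderiv ℝ ρ₃ X (R₃ X) = 1 := fun X hX ↦ by
    rw [hρ₃d X hX, ← hRR _ (hmem X hX), hφ.metric_eq _ (hmem X hX), hR₁ _ (hmem X hX)]
    simp [hR₃]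
  obtain ⟨e, hce, heU, hes, hes', he1, heR⟩ := exists_straightening Metric.isOpen_ball hR₃s hρ₃s hρR
    (Metric.mem_ball_self hε)
  have hes4 := contDiffOn_spatialChange hes
  have hes4' := contDiffOn_spatialChange_symm hes'
  have hsymm : ∀ z ∈ (φ.trans (spatialChange e)).target,
      R₀ ((spatialChange e).symm z) = (0, fderiv ℝ e.symm z.2 (1, 0)) := fun z hz ↦ by
    rw [hRR₃ _ hz.2, heR _ hz.1.2]
    rfl
  refine ⟨e, hce, hes, hes', fun z hz ↦ ?_, fun z hz v ↦ ?_⟩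
  · rw [fieldInChart_trans hφ.mem_atlas hes4 hz, ← hR₀, hsymm z hz,
      fderiv_spatialChange hes ((spatialChange e).map_target hz.1).2]
    exact Prod.ext rfl (OpenPartialHomeomorph.fderiv_fderiv_symm hes hes' hz.1.2 _)
  · rw [inChart_trans hφ.mem_atlas hes4' hz, fderiv_spatialChange_symm hes' hz.1.2,
      fderiv_spatialChange_symm hes' hz.1.2, hφ.metric_eq _ hz.2]
    have h1 := (hρ₃s.hasFDerivAt_of_isOpen Metric.isOpen_ball
      (heU (e.map_target hz.1.2))).comp z.2 (hes'.hasFDerivAt_of_isOpen e.open_target hz.1.2)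
    have h2 : HasFDerivAt (ρ₃ ∘ e.symm) (ContinuousLinearMap.fst ℝ ℝ Coord2) z.2 := by
      refine hasFDerivAt_fst.congr_of_eventuallyEq ?_
      filter_upwards [e.open_target.mem_nhds hz.1.2] with y hy
      rw [Function.comp_apply, ← he1 _ (e.map_target hy), e.right_inv hy]
    have h3 := DFunLike.congr_fun (h1.unique h2) v.2
    have h4 : h (e.symm z.2) (fderiv ℝ e.symm z.2 (1, 0)) (fderiv ℝ e.symm z.2 v.2) = v.2.1 := by
      rw [heR _ hz.1.2, ← hρ₃d _ (heU (e.map_target hz.1.2))]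
      exact h3
    change 1 ^ 2 * (-(0 * v.1) + h (e.symm z.2) (fderiv ℝ e.symm z.2 (1, 0))
      (fderiv ℝ e.symm z.2 v.2)) = _
    rw [h4]
    ring

/-- Around every point there are coordinates `(t, r, x, y)` in which `K = ∂/∂t`, `R = ∂/∂r` and
`g = -dt² + dr² + γ(x, y)`. -/
theorem exists_isSplitChart (hK : IsUltraStatic g K) (hR : IsUnitParallel g K R) (p : M) :
    ∃ φ γ, p ∈ φ.source ∧ IsSplitChart g K R φ γ := by
  have pK := isParallel_of_isUltraStatic hK
  obtain ⟨φ₀, h₀, hp₀, hφ₀⟩ := hK p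
  obtain ⟨φ₁, ε₁, hε₁, ht₁, hp₁, -, -, hφφ, hφ₁, -⟩ := hφ₀.exists_ball hp₀
  obtain ⟨e, hce, hes, hes', heR, heg⟩ := exists_spatialChange hφ₁ pK hR hε₁ ht₁
  have hφ₂ := hφ₁.trans_spatialChange hes hes'
  set h := fun Y ↦ (h₀ (e.symm Y)).bilinearComp (fderiv ℝ e.symm Y) (fderiv ℝ e.symm Y) with hh
  have hp₂ : p ∈ (φ₁.trans (spatialChange e)).source := ⟨hp₁, by
    change φ₁ p ∈ univ ×ˢ e.source
    exact ⟨mem_univ _, hφφ p ▸ hce⟩⟩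
  -- The change of coordinates may destroy convexity of the target; a second restriction to a ball
  -- restores it.
  obtain ⟨φ, ε, hε, ht, hp, -, hsub, -, hφ, hfield⟩ := hφ₂.exists_ball hp₂
  set c := (φ₁.trans (spatialChange e)) p with hc
  have hU : IsUltraStaticChart g K φ := ⟨h, hφ⟩
  have hconv : Convex ℝ φ.target := ht ▸ convex_ball c ε
  have hRφ : ∀ z ∈ φ.target, fieldInChart R φ z = (0, 1, 0) := fun z hz ↦ by
    rw [hfield R hz, heR z (hsub hz)]
  have hgφ : ∀ z ∈ φ.target, ∀ v : Coord4, g.inChart φ z (0, 1, 0) v = v.2.1 := fun z hz v ↦ by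
    rw [hφ.metric_eq z hz, ← hφ₂.metric_eq z (hsub hz), heg z (hsub hz)]
  -- The `(x, y)` block of `h`, frozen at the central value of `r`.
  let γ : Coord2 → Coord2 →L[ℝ] Coord2 →L[ℝ] ℝ := fun w ↦
    (h (c.2.1, w)).bilinearComp (ContinuousLinearMap.inr ℝ ℝ Coord2)
      (ContinuousLinearMap.inr ℝ ℝ Coord2)
  have hmem : ∀ z ∈ φ.target, ((z.1, c.2.1, z.2.2) : Coord4) ∈ φ.target := fun z hz ↦ by
    rw [ht, Metric.mem_ball, Prod.dist_eq, Prod.dist_eq] at hz ⊢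
    obtain ⟨h1, h2⟩ := max_lt_iff.1 hz
    obtain ⟨h3, h4⟩ := max_lt_iff.1 h2
    exact max_lt h1 (max_lt (by simpa using hε) h4)
  have hγ : EqOn (productMetric γ) h (Prod.snd '' φ.target) := by
    rintro _ ⟨z, hz, rfl⟩
    refine ContinuousLinearMap.ext fun u ↦ ContinuousLinearMap.ext fun v ↦ ?_
    -- The field `R = ∂/∂r` is Killing, so the coefficients do not depend on `r`.
    have h1 : ∀ u v : Coord3, h z.2 u v = h (c.2.1, z.2.2) u v := fun u v ↦ by
      have hz' : z = (z.1, c.2.1, z.2.2) + (z.2.1 - c.2.1) • ((0, 1, 0) : Coord4) := by simp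
      have hBs : ContDiffOn ℝ ∞ (fun z ↦ g.inChart φ z (0, u) (0, v)) φ.target :=
        (hU.symmFieldOn.smooth.clm_apply contDiffOn_const).clm_apply contDiffOn_const
      have h2 := hconv.eq_of_fderiv_apply_eq_zero φ.open_target
        (hBs.differentiableOn (by simp)) (w := (0, 1, 0)) (fun y hy ↦ by
          have hB := hU.symmFieldOn.smooth.hasFDerivAt_of_isOpen φ.open_target hy
          have h3 := (hB.clm_apply (hasFDerivAt_const ((0, u) : Coord4) y)).clm_apply
            (hasFDerivAt_const ((0, v) : Coord4) y)
          rw [h3.fderiv]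
          have h4 := (hR.parallel.killing φ hU).fderiv_eq_zero_of_const φ.open_target hRφ hy
            (0, u) (0, v)
          simpa using h4) (hmem z hz) (hz' ▸ hz)
      rw [← hz', hφ.metric_eq z hz, hφ.metric_eq _ (hmem z hz)] at h2
      simpa using h2
    -- From `R♭ = dr`: the `r` direction has unit length and no cross terms with `(x, y)`.
    have h2 : ∀ v : Coord3, h z.2 (1, 0) v = v.1 := fun v ↦ by
      have := hgφ z hz (0, v)
      rw [hφ.metric_eq z hz] at this
      simpa using this
    have h3 : ∀ a : Coord3, a = a.1 • ((1, 0) : Coord3) + (0, a.2) := fun a ↦ by simp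
    have hs := hφ.riemannian.symm z.2 (mem_image_of_mem _ hz)
    rw [productMetric_apply]
    change u.1 * v.1 + h (c.2.1, z.2.2) (0, u.2) (0, v.2) = _
    rw [← h1]
    conv_rhs => rw [h3 u]
    rw [map_add, map_smul, add_apply, smul_apply, h2, hs (0, u.2) v]
    conv_rhs => rw [h3 v]
    rw [map_add, map_smul, add_apply, smul_apply, h2, hs (0, v.2)]
    simp
  refine ⟨φ, γ, hp, hφ.congr_metric hγ, hRφ, ?_, hconv⟩
  have himage : ∀ w ∈ (fun z : Coord4 ↦ z.2.2) '' φ.target, (c.2.1, w) ∈ Prod.snd '' φ.target := by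
    rintro _ ⟨z, hz, rfl⟩
    exact ⟨_, hmem z hz, rfl⟩
  refine ⟨fun w hw u v ↦ hφ.riemannian.symm _ (himage w hw) _ _, fun w hw u hu ↦
    hφ.riemannian.pos _ (himage w hw) _ fun h0 ↦ hu (congrArg Prod.snd h0), ?_⟩
  refine contDiffOn_clm_apply.2 fun u ↦ contDiffOn_clm_apply.2 fun v ↦ ?_
  exact ((hφ.riemannian.smooth.comp (contDiff_const.prodMk contDiff_id).contDiffOn himage).clm_apply
    contDiffOn_const).clm_apply contDiffOn_const

end SplitCharts

end

/-! ### Flat metrics on the plane -/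

noncomputable section
set_option linter.unusedSectionVars false

section FlatPlane

open Set
open scoped Topology

/-- The determinant of the Gram matrix of a bilinear form on the plane. -/
def gramDet (b : Coord2 →L[ℝ] Coord2 →L[ℝ] ℝ) : ℝ :=
  b (1, 0) (1, 0) * b (0, 1) (0, 1) - b (1, 0) (0, 1) * b (1, 0) (0, 1)

theorem Coord2.eq_smul_add_smul (u : Coord2) :
    u = u.1 • ((1, 0) : Coord2) + u.2 • ((0, 1) : Coord2) := by simp

theorem bilin_apply_eq {b : Coord2 →L[ℝ] Coord2 →L[ℝ] ℝ} (hb : ∀ u v, b u v = b v u)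
    (u v : Coord2) : b u v = u.1 * v.1 * b (1, 0) (1, 0) +
      (u.1 * v.2 + u.2 * v.1) * b (1, 0) (0, 1) + u.2 * v.2 * b (0, 1) (0, 1) := by
  conv_lhs => rw [Coord2.eq_smul_add_smul u, Coord2.eq_smul_add_smul v]
  simp only [map_add, map_smul, add_apply, smul_apply, smul_eq_mul]
  rw [hb (0, 1) (1, 0)]
  ring

theorem gramDet_pos {b : Coord2 →L[ℝ] Coord2 →L[ℝ] ℝ} (hb : ∀ u v, b u v = b v u)
    (hpos : ∀ u, u ≠ 0 → 0 < b u u) : 0 < gramDet b := by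
  have h1 : 0 < b (1, 0) (1, 0) := hpos _ (by simp)
  -- On this vector the quadratic form takes the value `b (1, 0) (1, 0) * gramDet b`.
  have h2 := hpos (-b (1, 0) (0, 1), b (1, 0) (1, 0)) fun h ↦ h1.ne' (congrArg Prod.snd h)
  rw [bilin_apply_eq hb] at h2
  refine (mul_pos_iff_of_pos_left h1).1 ?_
  rw [gramDet]
  linarith

/-- Lagrange's identity. -/
theorem lagrange_identity {b : Coord2 →L[ℝ] Coord2 →L[ℝ] ℝ} (hb : ∀ u v, b u v = b v u)
    (s u v : Coord2) :
    b s u * b s v + gramDet b * ((s.1 * u.2 - s.2 * u.1) * (s.1 * v.2 - s.2 * v.1)) =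
      b s s * b u v := by
  rw [bilin_apply_eq hb s u, bilin_apply_eq hb s v, bilin_apply_eq hb s s, bilin_apply_eq hb u v,
    gramDet]
  ring

variable {γ : Coord2 → Coord2 →L[ℝ] Coord2 →L[ℝ] ℝ} {Ω : Set Coord2} {S : Coord2 → Coord2}

theorem IsRiemannianOn.contDiffOn_gramDet (hγ : IsRiemannianOn γ Ω) :
    ContDiffOn ℝ ∞ (fun w ↦ gramDet (γ w)) Ω := by
  have h (u v : Coord2) : ContDiffOn ℝ ∞ (fun w ↦ γ w u v) Ω :=
    (hγ.smooth.clm_apply contDiffOn_const).clm_apply contDiffOn_const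
  exact ((h _ _).mul (h _ _)).sub ((h _ _).mul (h _ _))

/-- A Killing field of a plane metric preserves its area form. -/
theorem KillingOn.fderiv_gramDet (hΩ : IsOpen Ω) (hγ : IsRiemannianOn γ Ω)
    (kS : KillingOn γ S Ω) {w : Coord2} (hw : w ∈ Ω) :
    fderiv ℝ (fun w ↦ gramDet (γ w)) w (S w) =
      -2 * gramDet (γ w) * ((fderiv ℝ S w (1, 0)).1 + (fderiv ℝ S w (0, 1)).2) := by
  have hd (u v : Coord2) := ((hγ.smooth.hasFDerivAt_of_isOpen hΩ hw).clm_apply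
    (hasFDerivAt_const u w)).clm_apply (hasFDerivAt_const v w)
  have hD := ((hd (1, 0) (1, 0)).mul (hd (0, 1) (0, 1))).sub
    ((hd (1, 0) (0, 1)).mul (hd (1, 0) (0, 1)))
  have h1 := DFunLike.congr_fun hD.fderiv (S w)
  refine h1.trans ?_
  have hs := hγ.symm w hw
  have k11 := kS w hw (1, 0) (1, 0)
  have k12 := kS w hw (1, 0) (0, 1)
  have k22 := kS w hw (0, 1) (0, 1)
  rw [bilin_apply_eq hs (fderiv ℝ S w (1, 0)), bilin_apply_eq hs _ (fderiv ℝ S w _)] at k11 k12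
  rw [bilin_apply_eq hs (fderiv ℝ S w (0, 1)), bilin_apply_eq hs _ (fderiv ℝ S w _)] at k22
  simp only [mul_one, mul_zero, add_zero, zero_add, one_mul, zero_mul] at k11 k12 k22
  simp only [gramDet, zero_add, add_apply, sub_apply, smul_apply, smul_eq_mul,
    ContinuousLinearMap.flip_apply, ContinuousLinearMap.comp_zero]
  linear_combination γ w (0, 1) (0, 1) * k11 + γ w (1, 0) (1, 0) * k22
    - 2 * γ w (1, 0) (0, 1) * k12

/-- The one-form `√(det γ) (S¹ dy - S² dx)`, the Hodge dual of `S♭`. -/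
def hodgeDual (γ : Coord2 → Coord2 →L[ℝ] Coord2 →L[ℝ] ℝ) (S : Coord2 → Coord2) (w : Coord2) :
    Coord2 →L[ℝ] ℝ :=
  √(gramDet (γ w)) • ((S w).1 • ContinuousLinearMap.snd ℝ ℝ ℝ -
    (S w).2 • ContinuousLinearMap.fst ℝ ℝ ℝ)

theorem hodgeDual_apply (w u : Coord2) :
    hodgeDual γ S w u = √(gramDet (γ w)) * ((S w).1 * u.2 - (S w).2 * u.1) := by
  simp [hodgeDual]

theorem contDiffOn_hodgeDual (hγ : IsRiemannianOn γ Ω) (hS : ContDiffOn ℝ ∞ S Ω) :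
    ContDiffOn ℝ ∞ (hodgeDual γ S) Ω :=
  (hγ.contDiffOn_gramDet.sqrt fun w hw ↦ (gramDet_pos (hγ.symm w hw) (hγ.pos w hw)).ne').smul
    ((hS.fst.smul contDiffOn_const).sub (hS.snd.smul contDiffOn_const))

/-- The exterior derivative of the Hodge dual is the divergence of `S` times the area form, and a
Killing field is divergence-free (`KillingOn.fderiv_gramDet`). -/
theorem fderiv_hodgeDual_symm (hΩ : IsOpen Ω) (hγ : IsRiemannianOn γ Ω)
    (hS : ContDiffOn ℝ ∞ S Ω) (kS : KillingOn γ S Ω) {w : Coord2} (hw : w ∈ Ω) (u v : Coord2) :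
    fderiv ℝ (hodgeDual γ S) w u v = fderiv ℝ (hodgeDual γ S) w v u := by
  have hpos := gramDet_pos (hγ.symm w hw) (hγ.pos w hw)
  have hdiv := kS.fderiv_gramDet hΩ hγ hw
  have hD := hγ.contDiffOn_gramDet.hasFDerivAt_of_isOpen hΩ hw
  have hμ := hD.sqrt hpos.ne'
  have dS := hS.hasFDerivAt_of_isOpen hΩ hw
  have key : HasFDerivAt (hodgeDual γ S) _ w :=
    hμ.smul ((dS.fst.smul_const (ContinuousLinearMap.snd ℝ ℝ ℝ)).sub
    (dS.snd.smul_const (ContinuousLinearMap.fst ℝ ℝ ℝ)))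
  rw [key.fderiv]
  set D' := fderiv ℝ (fun w ↦ gramDet (γ w)) w
  set S' := fderiv ℝ S w
  set μ := √(gramDet (γ w)) with hμ'
  have hμ2 : gramDet (γ w) = μ * μ := (Real.mul_self_sqrt hpos.le).symm
  have hμ0 : 0 < μ := Real.sqrt_pos.2 hpos
  rw [hμ2] at hdiv
  have hlin (x : Coord2) : D' x = x.1 * D' (1, 0) + x.2 * D' (0, 1) := by
    conv_lhs => rw [Coord2.eq_smul_add_smul x]
    simp only [map_add, map_smul, smul_eq_mul]
  have hlin' (x : Coord2) : S' x = x.1 • S' (1, 0) + x.2 • S' (0, 1) := by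
    conv_lhs => rw [Coord2.eq_smul_add_smul x]
    simp only [map_add, map_smul]
  rw [hlin (S w)] at hdiv
  simp only [add_apply, smul_apply, sub_apply, ContinuousLinearMap.smulRight_apply, smul_eq_mul,
    ContinuousLinearMap.comp_apply, ContinuousLinearMap.coe_fst', ContinuousLinearMap.coe_snd']
  rw [hlin u, hlin v, hlin' u, hlin' v]
  simp only [Prod.fst_add, Prod.snd_add, Prod.smul_fst, Prod.smul_snd, smul_eq_mul]
  have h2 : (S w).1 * D' (1, 0) + (S w).2 * D' (0, 1) =
    -2 * (μ * μ) * ((S' (1, 0)).1 + (S' (0, 1)).2) := hdiv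
  field_simp
  linear_combination (u.1 * v.2 - u.2 * v.1) * h2

/-- A plane Riemannian metric with a unit Killing field whose dual form is closed is flat. -/
theorem exists_euclidean_coordinates (hΩ : IsOpen Ω) (hc : Convex ℝ Ω) (hγ : IsRiemannianOn γ Ω)
    (hS : ContDiffOn ℝ ∞ S Ω) (kS : KillingOn γ S Ω) (cS : ClosedOn γ S Ω)
    (hunit : ∀ w ∈ Ω, γ w (S w) (S w) = 1) {p : Coord2} (hp : p ∈ Ω) :
    ∃ e : OpenPartialHomeomorph Coord2 Coord2, p ∈ e.source ∧ e.source ⊆ Ω ∧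
      ContDiffOn ℝ ∞ e e.source ∧ ContDiffOn ℝ ∞ e.symm e.target ∧
      ∀ w ∈ e.source, ∀ u v, γ w u v = euclideanMetric2 0 (fderiv ℝ e w u) (fderiv ℝ e w v) := by
  obtain ⟨s, hs, hs'⟩ := hc.exists_contDiffOn_primitive hΩ (hγ.smooth.clm_apply hS) cS
  obtain ⟨t, ht, ht'⟩ := hc.exists_contDiffOn_primitive hΩ (contDiffOn_hodgeDual hγ hS)
    fun w hw u v ↦ fderiv_hodgeDual_symm hΩ hγ hS kS hw u v
  have hf : ∀ w ∈ Ω, HasFDerivAt (fun w ↦ (s w, t w)) ((γ w (S w)).prod (hodgeDual γ S w)) w :=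
    fun w hw ↦ (hs' w hw).prodMk (ht' w hw)
  -- With `S` of unit length, Lagrange's identity reads `γ = ds² + dt²`.
  have hmet : ∀ w ∈ Ω, ∀ u v, γ w u v =
      γ w (S w) u * γ w (S w) v + hodgeDual γ S w u * hodgeDual γ S w v := fun w hw u v ↦ by
    have h1 := lagrange_identity (hγ.symm w hw) (S w) u v
    have h2 := Real.mul_self_sqrt (gramDet_pos (hγ.symm w hw) (hγ.pos w hw)).le
    rw [hunit w hw, one_mul] at h1
    rw [← h1, hodgeDual_apply, hodgeDual_apply]
    linear_combination -((S w).1 * u.2 - (S w).2 * u.1) * ((S w).1 * v.2 - (S w).2 * v.1) * h2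
  set L := (γ p (S p)).prod (hodgeDual γ S p) with hL
  have hinj : Function.Injective (L : Coord2 →ₗ[ℝ] Coord2) := by
    rw [← LinearMap.ker_eq_bot, LinearMap.ker_eq_bot']
    intro u hu
    by_contra hne
    have h1 := hγ.pos p hp u hne
    have h2 : γ p (S p) u = 0 := congrArg Prod.fst hu
    have h3 : hodgeDual γ S p u = 0 := congrArg Prod.snd hu
    rw [hmet p hp, h2, h3] at h1
    simp at h1
  set L' : Coord2 ≃L[ℝ] Coord2 := (LinearEquiv.ofInjectiveEndo _ hinj).toContinuousLinearEquiv
  have hL' : (L' : Coord2 →L[ℝ] Coord2) = L := ContinuousLinearMap.ext fun u ↦ rfl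
  obtain ⟨e, hpe, heΩ, hef, hes⟩ := exists_openPartialHomeomorph_of_contDiffOn hΩ
    (hs.prodMk ht) hp L' (hL' ▸ hf p hp)
  refine ⟨e, hpe, heΩ, hef ▸ (hs.prodMk ht).mono heΩ, hes, fun w hw u v ↦ ?_⟩
  rw [hef, (hf w (heΩ hw)).fderiv, hmet w (heΩ hw)]
  rfl

end FlatPlane

end

/-! ### Two orthonormal parallel fields give Minkowski space -/

noncomputable section
set_option linter.unusedSectionVars false

section FlatSpace

open Set
open scoped Topology

variable {M : Type*} [TopologicalSpace M] [ChartedSpace Coord4 M]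
  [IsManifold 𝓘(ℝ, Coord4) ∞ M] {φ : OpenPartialHomeomorph M Coord4} {g : LorentzMetric M}
  {K R S : ∀ p : M, TangentSpace 𝓘(ℝ, Coord4) p}
  {γ : Coord2 → Coord2 →L[ℝ] Coord2 →L[ℝ] ℝ}

theorem IsRiemannianOn.mono {F : Type*} [NormedAddCommGroup F] [NormedSpace ℝ F]
    {h : F → F →L[ℝ] F →L[ℝ] ℝ} {Ω Ω' : Set F} (hh : IsRiemannianOn h Ω) (hsub : Ω' ⊆ Ω) :
    IsRiemannianOn h Ω' :=
  ⟨fun x hx ↦ hh.symm x (hsub hx), fun x hx ↦ hh.pos x (hsub hx), hh.smooth.mono hsub⟩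

/-- A parallel unit field orthogonal to `K` and `R` gives, in a chart adapted to `K` and `R`,
a unit Killing field with closed dual form for the plane metric `γ`. -/
theorem exists_plane_unitKilling (hφ : IsStaticChart g K φ (fun _ ↦ 1) (productMetric γ))
    (hRφ : ∀ z ∈ φ.target, fieldInChart R φ z = (0, 1, 0)) (hS : IsUnitParallel g K S)
    (hSR : ∀ p, g.val p (S p) (R p) = 0) {a b : ℝ} {Ω : Set Coord2} (hΩ : IsOpen Ω)
    (hmem : ∀ w ∈ Ω, (a, b, w) ∈ φ.target) (hγ : IsRiemannianOn γ Ω) :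
    ∃ S₂ : Coord2 → Coord2, ContDiffOn ℝ ∞ S₂ Ω ∧ KillingOn γ S₂ Ω ∧ ClosedOn γ S₂ Ω ∧
      ∀ w ∈ Ω, γ w (S₂ w) (S₂ w) = 1 := by
  have hU : IsUltraStaticChart g K φ := ⟨_, hφ⟩
  set S₀ := fieldInChart S φ with hS₀
  have hS₀s : ContDiffOn ℝ ∞ S₀ φ.target := hS.parallel.contDiffOn hU
  set ι : Coord2 → Coord4 := fun w ↦ (a, b, w) with hι
  have hιs : ContDiff ℝ ∞ ι := contDiff_const.prodMk (contDiff_const.prodMk contDiff_id)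
  set J : Coord2 →L[ℝ] Coord4 := (ContinuousLinearMap.inr ℝ ℝ Coord3).comp
    (ContinuousLinearMap.inr ℝ ℝ Coord2) with hJ
  have hιd : ∀ w, HasFDerivAt ι J w := fun w ↦ by
    exact ((hasFDerivAt_const a w).prodMk ((hasFDerivAt_const b w).prodMk
      (hasFDerivAt_id w))).congr_fderiv (ContinuousLinearMap.ext fun u ↦ rfl)
  have hmet : ∀ z ∈ φ.target, ∀ u v : Coord4, g.inChart φ z u v =
      -(u.1 * v.1) + (u.2.1 * v.2.1 + γ z.2.2 u.2.2 v.2.2) := fun z hz u v ↦ by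
    rw [hφ.metric_eq z hz, productMetric_apply]
    ring
  -- Orthogonality to `K = ∂/∂t` and `R = ∂/∂r` leaves only the `(x, y)` component, which is then
  -- restricted to the slice `t = a`, `r = b`.
  have hS₀0 : ∀ z ∈ φ.target, S₀ z = (0, 0, (S₀ z).2.2) := fun z hz ↦ by
    have h1 := inChart_fieldInChart (X := S) (Y := K) (g := g) hφ.mem_atlas hz
    have h2 := inChart_fieldInChart (X := S) (Y := R) (g := g) hφ.mem_atlas hz
    rw [hφ.field_eq z hz, hS.orth, hmet z hz] at h1
    rw [hRφ z hz, hSR, hmet z hz] at h2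
    refine Prod.ext ?_ (Prod.ext ?_ rfl)
    · simpa using h1
    · simpa using h2
  set S₂ : Coord2 → Coord2 := fun w ↦ (S₀ (ι w)).2.2 with hS₂
  have hS₂d : ∀ w ∈ Ω, ∀ u, fderiv ℝ S₂ w u = (fderiv ℝ S₀ (ι w) (J u)).2.2 := fun w hw u ↦ by
    have h1 := ((hS₀s.hasFDerivAt_of_isOpen φ.open_target (hmem w hw)).comp w (hιd w)).snd.snd
    exact DFunLike.congr_fun h1.fderiv u
  have hγd : ∀ w ∈ Ω, ∀ x u v, fderiv ℝ γ w x u v =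
      fderiv ℝ (g.inChart φ) (ι w) (J x) (J u) (J v) := fun w hw x u v ↦ by
    have h1 := ((hγ.smooth.hasFDerivAt_of_isOpen hΩ hw).clm_apply
      (hasFDerivAt_const u w)).clm_apply (hasFDerivAt_const v w)
    have h2 := (((hU.symmFieldOn.smooth.hasFDerivAt_of_isOpen φ.open_target (hmem w hw)).comp w
      (hιd w)).clm_apply (hasFDerivAt_const (J u) w)).clm_apply (hasFDerivAt_const (J v) w)
    have h3 := h1.unique (h2.congr_of_eventuallyEq (by
      filter_upwards [hΩ.mem_nhds hw] with y hy
      rw [Function.comp_apply, hmet _ (hmem y hy)]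
      simp [hJ]))
    simpa using DFunLike.congr_fun h3 x
  have hJS : ∀ w ∈ Ω, J (S₂ w) = S₀ (ι w) := fun w hw ↦ (hS₀0 _ (hmem w hw)).symm
  have hBγ : ∀ w ∈ Ω, ∀ (x : Coord4) (v : Coord2), γ w x.2.2 v = g.inChart φ (ι w) x (J v) :=
    fun w hw x v ↦ by
      rw [hmet _ (hmem w hw)]
      simp [hJ]
  have hBγ' : ∀ w ∈ Ω, ∀ (x : Coord4) (v : Coord2), γ w v x.2.2 = g.inChart φ (ι w) (J v) x :=
    fun w hw x v ↦ by rw [hγ.symm w hw, hBγ w hw, g.inChart_symm]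
  have hS₂s : ContDiffOn ℝ ∞ S₂ Ω := (hS₀s.comp hιs.contDiffOn hmem).snd.snd
  have hγΩ : SymmFieldOn γ Ω := ⟨hΩ, hγ.smooth, hγ.symm⟩
  refine ⟨S₂, hS₂s, fun w hw u v ↦ ?_, fun w hw u v ↦ ?_, fun w hw ↦ ?_⟩
  · rw [hγd w hw, hJS w hw, hS₂d w hw, hS₂d w hw, hBγ w hw, hBγ' w hw]
    exact hS.parallel.killing φ hU _ (hmem w hw) _ _
  · have h1 := hS.parallel.closed φ hU _ (hmem w hw) (J u) (J v)
    rw [hU.symmFieldOn.fderiv_dual hS₀s (hmem w hw), hU.symmFieldOn.fderiv_dual hS₀s (hmem w hw)]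
      at h1
    rw [hγΩ.fderiv_dual hS₂s hw, hγΩ.fderiv_dual hS₂s hw, hγd w hw, hγd w hw, hJS w hw,
      hS₂d w hw, hS₂d w hw, hBγ w hw, hBγ w hw]
    exact h1
  · rw [hBγ w hw, hJS w hw, hS₀, inChart_fieldInChart hφ.mem_atlas (hmem w hw), hS.unit]

/-- In a split chart for `K` and `R`, the field `S` flattens the plane factor `γ`; only the
coordinates `(x, y)` need changing. -/
theorem isLocallyMinkowski_of_isUnitParallel (hK : IsUltraStatic g K) (hR : IsUnitParallel g K R)
    (hS : IsUnitParallel g K S) (hSR : ∀ p, g.val p (S p) (R p) = 0) :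
    IsLocallyMinkowski g K := fun p ↦ by
  obtain ⟨φ₀, γ, hp₀, hφ₀⟩ := exists_isSplitChart hK hR p
  obtain ⟨φ, ε, hε, ht, hp, -, hsub, hφφ, hφ, hfield⟩ := hφ₀.static.exists_ball hp₀
  set c := φ₀ p with hc
  have hmem : ∀ w ∈ Metric.ball c.2.2 ε, (c.1, c.2.1, w) ∈ φ.target := fun w hw ↦ by
    rw [ht, Metric.mem_ball, Prod.dist_eq, Prod.dist_eq]
    exact max_lt (by simpa using hε) (max_lt (by simpa using hε) hw)
  have hγ : IsRiemannianOn γ (Metric.ball c.2.2 ε) :=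
    hφ₀.riemannian.mono fun w hw ↦ ⟨_, hsub (hmem w hw), rfl⟩
  obtain ⟨S₂, hS₂, kS, cS, uS⟩ := exists_plane_unitKilling hφ
    (fun z hz ↦ by rw [hfield R hz, hφ₀.field_eq z (hsub hz)]) hS hSR Metric.isOpen_ball hmem hγ
  obtain ⟨e, hpe, heΩ, hes, hes', hmet⟩ := exists_euclidean_coordinates Metric.isOpen_ball
    (convex_ball _ _) hγ hS₂ kS cS uS (Metric.mem_ball_self hε)
  set e₃ : OpenPartialHomeomorph Coord3 Coord3 := (OpenPartialHomeomorph.refl ℝ).prod e with he₃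
  have hes₃ : ContDiffOn ℝ ∞ e₃ e₃.source :=
    contDiffOn_fst.prodMk (hes.comp contDiffOn_snd fun _ hz ↦ hz.2)
  have hes₃' : ContDiffOn ℝ ∞ e₃.symm e₃.target :=
    contDiffOn_fst.prodMk (hes'.comp contDiffOn_snd fun _ hz ↦ hz.2)
  refine ⟨φ.trans (spatialChange e₃), ⟨hp, ⟨mem_univ _, mem_univ _, ?_⟩⟩,
    (hφ.trans_spatialChange hes₃ hes₃').congr_metric ?_⟩
  · change (φ p).2.2 ∈ e.source
    rw [hφφ]
    exact hpe
  · rintro _ ⟨z, hz, rfl⟩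
    have hz2 : z.2.2 ∈ e.target := hz.1.2.2
    have h1 : HasFDerivAt e₃.symm _ z.2 := hasFDerivAt_fst.prodMk
      ((hes'.hasFDerivAt_of_isOpen e.open_target hz2).comp z.2 hasFDerivAt_snd)
    refine ContinuousLinearMap.ext fun u ↦ ContinuousLinearMap.ext fun v ↦ ?_
    rw [ContinuousLinearMap.bilinearComp_apply, h1.fderiv]
    change u.1 * v.1 + euclideanMetric2 0 u.2 v.2 = u.1 * v.1 +
      γ (e.symm z.2.2) (fderiv ℝ e.symm z.2.2 u.2) (fderiv ℝ e.symm z.2.2 v.2)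
    rw [hmet _ (e.map_target hz2), OpenPartialHomeomorph.fderiv_fderiv_symm hes hes' hz2,
      OpenPartialHomeomorph.fderiv_fderiv_symm hes hes' hz2]

end FlatSpace

end

/-! ### Static Killing fields in a split chart -/

noncomputable section
set_option linter.unusedSectionVars false

section Boosts

open Set
open scoped Topology

variable {M : Type*} [TopologicalSpace M] [ChartedSpace Coord4 M]
  [IsManifold 𝓘(ℝ, Coord4) ∞ M] {φ : OpenPartialHomeomorph M Coord4} {g : LorentzMetric M}
  {K R ζ : ∀ p : M, TangentSpace 𝓘(ℝ, Coord4) p}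
  {γ : Coord2 → Coord2 →L[ℝ] Coord2 →L[ℝ] ℝ}

theorem IsRiemannianOn.productMetric {Ω : Set Coord2} {Ω' : Set Coord3} (hγ : IsRiemannianOn γ Ω)
    (hsub : ∀ X ∈ Ω', X.2 ∈ Ω) : IsRiemannianOn (productMetric γ) Ω' := by
  refine ⟨fun X hX u v ↦ ?_, fun X hX u hu ↦ ?_,
    contDiffOn_clm_apply.2 fun u ↦ contDiffOn_clm_apply.2 fun v ↦ ?_⟩
  · rw [productMetric_apply, productMetric_apply, hγ.symm _ (hsub X hX), mul_comm]
  · rw [productMetric_apply]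
    by_cases h : u.2 = 0
    · have h1 : u.1 ≠ 0 := fun h1 ↦ hu (Prod.ext h1 h)
      rw [h, map_zero, add_zero]
      exact mul_self_pos.2 h1
    · exact add_pos_of_nonneg_of_pos (mul_self_nonneg _) (hγ.pos _ (hsub X hX) _ h)
  · exact contDiffOn_const.add
      (((hγ.smooth.comp contDiffOn_snd hsub).clm_apply contDiffOn_const).clm_apply contDiffOn_const)

theorem IsRiemannianOn.boostOpticalMetric {Ω : Set Coord2} {Ω' : Set Coord3}
    (hγ : IsRiemannianOn γ Ω) (hsub : ∀ X ∈ Ω', X.2 ∈ Ω) (hpos : ∀ X ∈ Ω', 0 < X.1) :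
    IsRiemannianOn (boostOpticalMetric γ) Ω' := by
  have h := hγ.productMetric hsub
  refine ⟨fun X hX u v ↦ ?_, fun X hX u hu ↦ ?_, ?_⟩
  · rw [_root_.boostOpticalMetric, smul_apply, smul_apply, smul_apply, smul_apply, h.symm X hX]
  · exact mul_pos (inv_pos.2 (pow_pos (hpos X hX) 2)) (h.pos X hX u hu)
  · refine contDiffOn_clm_apply.2 fun u ↦ contDiffOn_clm_apply.2 fun v ↦ ?_
    exact ((contDiffOn_fst.pow 2).inv fun X hX ↦ (pow_pos (hpos X hX) 2).ne').mul
      ((h.smooth.clm_apply contDiffOn_const).clm_apply contDiffOn_const)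

/-- In a chart adapted to `K` and `R`, a static Killing field is a combination of translations and
boosts in the coordinates `(t, r)`. -/
theorem IsHSOTimelikeKilling.exists_fieldInChart_eq [PreconnectedSpace M] [Nonempty M]
    (hK : IsUltraStatic g K)
    (hR : IsUnitParallel g K R)
    (hdim : ∀ S, IsUnitParallel g K S → ∃ p, g.val p (S p) (R p) ≠ 0)
    (hφ : IsSplitChart g K R φ γ) (hζ : IsHSOTimelikeKilling g ζ) :
    ∃ a b c : ℝ, ∀ z ∈ φ.target, fieldInChart ζ φ z = (a * z.2.1 + b, a * z.1 + c, 0) := by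
  have pK := isParallel_of_isUltraStatic hK
  have hU : IsUltraStaticChart g K φ := ⟨_, hφ.static⟩
  obtain ⟨p₀⟩ : Nonempty M := inferInstance
  have pZK := IsParallel.mlieBracket hζ.smooth hζ.killing pK
  have pZR := IsParallel.mlieBracket hζ.smooth hζ.killing hR.parallel
  -- The bracket and `R` are both parallel, so their inner product is constant. The sign makes the
  -- components of `ζ` come out as `a r + b` and `a t + c`.
  obtain ⟨a, ha⟩ : ∃ a : ℝ, ∀ p,
      g.val p (VectorField.mlieBracket 𝓘(ℝ, Coord4) ζ K p) (R p) = -a :=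
    ⟨-g.val p₀ (VectorField.mlieBracket 𝓘(ℝ, Coord4) ζ K p₀) (R p₀), fun p ↦ by
      rw [neg_neg, pZK.val_eq hK hR.parallel p p₀]⟩
  have hZK : ∀ p, VectorField.mlieBracket 𝓘(ℝ, Coord4) ζ K p = (-a) • R p := fun p ↦ by
    have h1 := pZK.eq_lincomb hK hR hdim p
    rwa [ha, hζ.val_mlieBracket_self hK pK, neg_zero, zero_smul, zero_add] at h1
  -- Skewness of the bracket on parallel fields ties this coefficient to the same constant `a`.
  have hZR : ∀ p, VectorField.mlieBracket 𝓘(ℝ, Coord4) ζ R p = (-a) • K p := fun p ↦ by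
    have h1 := pZR.eq_lincomb hK hR hdim p
    have h2 := pK.val_mlieBracket_add hK hR.parallel hζ.smooth hζ.killing p
    rw [ha, g.symm p (K p)] at h2
    have h3 : -g.val p (VectorField.mlieBracket 𝓘(ℝ, Coord4) ζ R p) (K p) = -a := by linarith
    rwa [h3, hζ.val_mlieBracket_self hK hR.parallel, zero_smul, add_zero] at h1
  set Z := fieldInChart ζ φ with hZ
  have hZs : ContDiffOn ℝ ∞ Z φ.target :=
    IsSmoothField.contDiffOn_fieldInChart hζ.smooth hφ.static.mem_atlas
  have hmet : ∀ z ∈ φ.target, ∀ u v : Coord4, g.inChart φ z u v =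
      -(u.1 * v.1) + (u.2.1 * v.2.1 + γ z.2.2 u.2.2 v.2.2) := fun z hz u v ↦ by
    rw [hφ.static.metric_eq z hz, productMetric_apply]
    ring
  have bK : ∀ z ∈ φ.target,
      VectorField.lieBracket ℝ Z (fieldInChart K φ) z = (0, -a, 0) := fun z hz ↦ by
    rw [hZ, ← fieldInChart_mlieBracket hζ.smooth pK.smooth hφ.static.mem_atlas hz, funext hZK,
      fieldInChart_smul, hφ.field_eq z hz]
    simp
  have bR : ∀ z ∈ φ.target,
      VectorField.lieBracket ℝ Z (fieldInChart R φ) z = (-a, 0, 0) := fun z hz ↦ by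
    rw [hZ, ← fieldInChart_mlieBracket hζ.smooth hR.parallel.smooth hφ.static.mem_atlas hz,
      funext hZR, fieldInChart_smul, hφ.static.field_eq z hz]
    simp [Prod.zero_eq_mk]
  have kZ : KillingOn (g.inChart φ) Z φ.target := hζ.killing φ hφ.static.mem_atlas
  -- As `g(ζ, K) = -ζᵗ`, the identity `[ζ, K]♭ = d(g(ζ, K))` becomes `dζᵗ = a dr`; the same argument
  -- with `R` gives `dζʳ = a dt`.
  have d1 : ∀ z ∈ φ.target, ∀ u, fderiv ℝ (fun z ↦ (Z z).1) z u = a * u.2.1 := fun z hz u ↦ by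
    have h1 := kZ.dual_lieBracket hU.symmFieldOn hZs (pK.contDiffOn hU) (pK.closed φ hU) hz u
    have h2 : (fun z ↦ g.inChart φ z (Z z) (fieldInChart K φ z)) =ᶠ[𝓝 z] fun z ↦ -(Z z).1 := by
      filter_upwards [φ.open_target.mem_nhds hz] with y hy
      rw [hφ.static.field_eq y hy, hU.inChart_right hy]
    rw [bK z hz, h2.fderiv_eq, fderiv_fun_neg, hmet z hz] at h1
    simp only [neg_apply, zero_mul, map_zero, zero_apply] at h1
    linarith
  have d2 : ∀ z ∈ φ.target, ∀ u, fderiv ℝ (fun z ↦ (Z z).2.1) z u = a * u.1 := fun z hz u ↦ by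
    have h1 := kZ.dual_lieBracket hU.symmFieldOn hZs (hR.parallel.contDiffOn hU)
      (hR.parallel.closed φ hU) hz u
    have h2 : (fun z ↦ g.inChart φ z (Z z) (fieldInChart R φ z)) =ᶠ[𝓝 z] fun z ↦ (Z z).2.1 := by
      filter_upwards [φ.open_target.mem_nhds hz] with y hy
      rw [hφ.field_eq y hy, hmet y hy]
      simp
    rw [bR z hz, h2.fderiv_eq, hmet z hz] at h1
    simp only [zero_mul, map_zero, zero_apply] at h1
    linarith
  have hconst : ∀ {f : Coord4 → ℝ} {L : Coord4 →L[ℝ] ℝ}, ContDiffOn ℝ ∞ f φ.target →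
      (∀ z ∈ φ.target, ∀ u, fderiv ℝ f z u = L u) →
      ∃ b, ∀ z ∈ φ.target, f z = L z + b := fun {f L} hf hd ↦ by
    obtain ⟨b, hb⟩ := φ.open_target.exists_is_const_of_fderiv_eq_zero
      hφ.convex.isPreconnected (f := fun z ↦ f z - L z)
      ((hf.differentiableOn (by simp)).sub L.differentiableOn) (fun z hz ↦ by
        have h1 := (hf.hasFDerivAt_of_isOpen φ.open_target hz).sub L.hasFDerivAt
        refine h1.fderiv.trans (ContinuousLinearMap.ext fun u ↦ ?_)
        rw [sub_apply, hd z hz, sub_self]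
        rfl)
    exact ⟨b, fun z hz ↦ by rw [← hb z hz]; ring⟩
  obtain ⟨b, hb⟩ := hconst (f := fun z ↦ (Z z).1)
    (L := a • (ContinuousLinearMap.fst ℝ ℝ Coord2).comp (ContinuousLinearMap.snd ℝ ℝ Coord3))
    hZs.fst d1
  obtain ⟨c, hc⟩ := hconst (f := fun z ↦ (Z z).2.1)
    (L := a • ContinuousLinearMap.fst ℝ ℝ Coord3) hZs.snd.fst d2
  refine ⟨a, b, c, fun z hz ↦ Prod.ext (hb z hz) (Prod.ext (hc z hz) ?_)⟩
  change (Z z).2.2 = 0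
  by_cases ha0 : a = 0
  · have pζ := hζ.isParallel hK fun p ↦ by rw [hZK, ha0, neg_zero, zero_smul]
    have h1 : ζ = fun p ↦ (-g.val p₀ (ζ p₀) (K p₀)) • K p + g.val p₀ (ζ p₀) (R p₀) • R p :=
      funext fun p ↦ by
        rw [pζ.val_eq hK pK p₀ p, pζ.val_eq hK hR.parallel p₀ p]
        exact pζ.eq_lincomb hK hR hdim p
    rw [hZ, h1, fieldInChart_lincomb]
    simp only
    rw [hφ.static.field_eq z hz, hφ.field_eq z hz]
    simp
  -- Let `W` be the `(x, y)` part of `ζ`. Evaluating `ζ♭ ∧ dζ♭` on `(∂_t, ∂_r, W)` leaves `2a γ(W,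
  -- W) = 0`, which contradicts positivity of `γ` if `W ≠ 0`.
  · by_contra hne
    have hso := hζ.hypersurfaceOrthogonal φ hφ.static.mem_atlas z hz (1, 0) (0, 1, 0)
      (0, 0, (Z z).2.2)
    have e1 : ∀ v : Coord4, extDerivOneForm (dualFormInChart g ζ φ) z (1, 0) v = 2 * a * v.2.1 :=
      fun v ↦ by
        have h1 := kZ.extDeriv_dual hU.symmFieldOn hZs (pK.contDiffOn hU) (pK.killing φ hU)
          (pK.closed φ hU) hz v
        rw [bK z hz, hφ.static.field_eq z hz, hmet z hz] at h1
        simp only [zero_mul, map_zero, zero_apply] at h1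
        refine h1.trans ?_
        ring
    have e2 : ∀ v : Coord4, extDerivOneForm (dualFormInChart g ζ φ) z (0, 1, 0) v =
        -2 * a * v.1 := fun v ↦ by
      have h1 := kZ.extDeriv_dual hU.symmFieldOn hZs (hR.parallel.contDiffOn hU)
        (hR.parallel.killing φ hU) (hR.parallel.closed φ hU) hz v
      rw [bR z hz, hφ.field_eq z hz, hmet z hz] at h1
      simp only [zero_mul, map_zero, zero_apply] at h1
      refine h1.trans ?_
      ring
    have e3 : extDerivOneForm (dualFormInChart g ζ φ) z (0, 0, (Z z).2.2) (1, 0) = 0 := by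
      have h1 := e1 (0, 0, (Z z).2.2)
      rw [extDerivOneForm] at h1 ⊢
      linarith
    rw [e1, e2, e3] at hso
    simp only [mul_zero, zero_add, mul_one, mul_eq_zero, or_false, OfNat.ofNat_ne_zero,
      ha0] at hso
    change g.inChart φ z (Z z) (0, 0, (Z z).2.2) = 0 at hso
    rw [hmet z hz] at hso
    simp only [mul_zero, neg_zero, zero_add] at hso
    exact (hφ.riemannian.pos _ ⟨z, hz, rfl⟩ _ hne).ne' hso

/-- Construction of static charts by a change of coordinates. -/
theorem isStaticChart_trans (hφ : φ ∈ IsManifold.maximalAtlas 𝓘(ℝ, Coord4) ∞ M)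
    {e : OpenPartialHomeomorph Coord4 Coord4} (he : ContDiffOn ℝ ∞ e e.source)
    (he' : ContDiffOn ℝ ∞ e.symm e.target) {c : ℝ} {V : Coord3 → ℝ}
    {h : Coord3 → Coord3 →L[ℝ] Coord3 →L[ℝ] ℝ}
    (hfield : ∀ z ∈ (φ.trans e).target,
      c • fieldInChart ζ φ (e.symm z) = fderiv ℝ e.symm z (1, 0))
    (hmet : ∀ z ∈ (φ.trans e).target, ∀ u v : Coord4,
      g.inChart φ (e.symm z) (fderiv ℝ e.symm z u) (fderiv ℝ e.symm z v) =
        V z.2 ^ 2 * (-(u.1 * v.1) + h z.2 u.2 v.2))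
    (hV : ∀ z ∈ (φ.trans e).target, 0 < V z.2)
    (hVs : ContDiffOn ℝ ∞ V (Prod.snd '' (φ.trans e).target))
    (hh : IsRiemannianOn h (Prod.snd '' (φ.trans e).target)) :
    IsStaticChart g (fun q ↦ c • ζ q) (φ.trans e) V h := by
  refine ⟨trans_mem_maximalAtlas hφ he he', fun z hz ↦ ?_, fun z hz u v ↦ ?_, hV, hVs, hh⟩
  · rw [fieldInChart_trans hφ he hz, fieldInChart_smul, hfield z hz]
    exact OpenPartialHomeomorph.fderiv_fderiv_symm he he' hz.1 _
  · rw [inChart_trans hφ he' hz, hmet z hz]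

end Boosts

end

/-! ### Lorentz boosts and Rindler coordinates -/

noncomputable section
set_option linter.unusedSectionVars false

section BoostCharts

open Set
open scoped Topology

/-- The linear map `(t, r, x, y) ↦ (A t + B r, A r + B t, x, y)`. -/
def boostMap (A B : ℝ) : Coord4 →L[ℝ] Coord4 :=
  (A • ContinuousLinearMap.fst ℝ ℝ Coord3 +
    B • (ContinuousLinearMap.fst ℝ ℝ Coord2).comp (ContinuousLinearMap.snd ℝ ℝ Coord3)).prod
  ((A • (ContinuousLinearMap.fst ℝ ℝ Coord2).comp (ContinuousLinearMap.snd ℝ ℝ Coord3) +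
    B • ContinuousLinearMap.fst ℝ ℝ Coord3).prod
  ((ContinuousLinearMap.snd ℝ ℝ Coord2).comp (ContinuousLinearMap.snd ℝ ℝ Coord3)))

theorem boostMap_apply (A B : ℝ) (z : Coord4) :
    boostMap A B z = (A * z.1 + B * z.2.1, A * z.2.1 + B * z.1, z.2.2) := rfl

/-- The Lorentz boost `(t, r, x, y) ↦ (A t - B r, A r - B t, x, y)`, where `A² - B² = 1`. -/
def lorentzBoost {A B : ℝ} (h : A ^ 2 - B ^ 2 = 1) : Coord4 ≃L[ℝ] Coord4 :=
  ContinuousLinearEquiv.equivOfInverse (boostMap A (-B)) (boostMap A B)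
    (fun z ↦ by
      rw [boostMap_apply, boostMap_apply]
      refine Prod.ext ?_ (Prod.ext ?_ rfl)
      · linear_combination z.1 * h
      · linear_combination z.2.1 * h)
    (fun z ↦ by
      rw [boostMap_apply, boostMap_apply]
      refine Prod.ext ?_ (Prod.ext ?_ rfl)
      · linear_combination z.1 * h
      · linear_combination z.2.1 * h)

theorem sq_sub_sq_pos_of_abs_lt {σ a b : ℝ} (hσ : σ * σ = 1) (h : |a| < σ * b) :
    0 < b ^ 2 - a ^ 2 := by
  have h1 := sq_lt_sq' (neg_lt_of_abs_lt h) (lt_of_abs_lt h)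
  linear_combination h1 + b ^ 2 * hσ

/-- Rindler coordinates `(τ, ρ, x, y)` with `t + t₀ = σ ρ sinh τ`, `r + r₀ = σ ρ cosh τ`. -/
def rindler {σ : ℝ} (hσ : σ * σ = 1) (t₀ r₀ : ℝ) : OpenPartialHomeomorph Coord4 Coord4 where
  toFun z := (Real.arsinh (σ * (z.1 + t₀) / √((z.2.1 + r₀) ^ 2 - (z.1 + t₀) ^ 2)),
    √((z.2.1 + r₀) ^ 2 - (z.1 + t₀) ^ 2), z.2.2)
  invFun z := (σ * (z.2.1 * Real.sinh z.1) - t₀, σ * (z.2.1 * Real.cosh z.1) - r₀, z.2.2)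
  -- The wedge to the right of the centre `(-t₀, -r₀)` for `σ = 1`, to the left for `σ = -1`.
  source := {z | |z.1 + t₀| < σ * (z.2.1 + r₀)}
  target := {z | 0 < z.2.1}
  map_source' z hz := Real.sqrt_pos.2 (sq_sub_sq_pos_of_abs_lt hσ hz)
  map_target' z hz := by
    have h1 : |Real.sinh z.1| < Real.cosh z.1 := abs_lt_of_sq_lt_sq
      (by linarith [Real.cosh_sq z.1]) (Real.cosh_pos _).le
    have h2 : |σ| = 1 := by
      rw [← sq_eq_sq₀ (abs_nonneg _) zero_le_one, sq_abs, sq, hσ, one_pow]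
    have h3 : (0 : ℝ) < z.2.1 := hz
    change |σ * (z.2.1 * Real.sinh z.1) - t₀ + t₀| < σ * (σ * (z.2.1 * Real.cosh z.1) - r₀ + r₀)
    rw [sub_add_cancel, sub_add_cancel, abs_mul, h2, one_mul, abs_mul, abs_of_pos h3, ← mul_assoc,
      hσ, one_mul]
    exact mul_lt_mul_of_pos_left h1 h3
  left_inv' z hz := by
    have h2 : 0 < (z.2.1 + r₀) ^ 2 - (z.1 + t₀) ^ 2 := sq_sub_sq_pos_of_abs_lt hσ hz
    have h3 : 0 < σ * (z.2.1 + r₀) := (abs_nonneg _).trans_lt hz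
    set ρ := √((z.2.1 + r₀) ^ 2 - (z.1 + t₀) ^ 2) with hρ
    have hρ0 : 0 < ρ := Real.sqrt_pos.2 h2
    have hρ2 : ρ ^ 2 = (z.2.1 + r₀) ^ 2 - (z.1 + t₀) ^ 2 := Real.sq_sqrt h2.le
    -- Recovers `r` from `cosh (arsinh x) = √(1 + x²)`; the positive root is correct because `σ (r +
    -- r₀) > 0` in the wedge.
    have h4 : ρ * √(1 + (σ * (z.1 + t₀) / ρ) ^ 2) = σ * (z.2.1 + r₀) := by
      have h5 : 1 + (σ * (z.1 + t₀) / ρ) ^ 2 = (σ * (z.2.1 + r₀) / ρ) ^ 2 := by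
        field_simp
        linear_combination hρ2 - ((z.2.1 + r₀) ^ 2 - (z.1 + t₀) ^ 2) * hσ
      rw [h5, Real.sqrt_sq (div_nonneg h3.le hρ0.le), mul_div_cancel₀ _ hρ0.ne']
    refine Prod.ext ?_ (Prod.ext ?_ rfl)
    · change σ * (ρ * Real.sinh (Real.arsinh (σ * (z.1 + t₀) / ρ))) - t₀ = z.1
      rw [Real.sinh_arsinh, mul_div_cancel₀ _ hρ0.ne']
      linear_combination (z.1 + t₀) * hσ
    · change σ * (ρ * Real.cosh (Real.arsinh (σ * (z.1 + t₀) / ρ))) - r₀ = z.2.1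
      rw [Real.cosh_arsinh, h4]
      linear_combination (z.2.1 + r₀) * hσ
  right_inv' z hz := by
    have h1 : √((σ * (z.2.1 * Real.cosh z.1) - r₀ + r₀) ^ 2 -
        (σ * (z.2.1 * Real.sinh z.1) - t₀ + t₀) ^ 2) = z.2.1 := by
      refine Eq.trans (congrArg _ ?_) (Real.sqrt_sq (le_of_lt hz))
      linear_combination z.2.1 ^ 2 * (Real.cosh z.1 ^ 2 - Real.sinh z.1 ^ 2) * hσ +
        z.2.1 ^ 2 * Real.cosh_sq z.1
    have h2 : (0 : ℝ) < z.2.1 := hz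
    refine Prod.ext ?_ (Prod.ext h1 rfl)
    change Real.arsinh (σ * (σ * (z.2.1 * Real.sinh z.1) - t₀ + t₀) / √(_)) = z.1
    rw [h1, sub_add_cancel, ← mul_assoc, hσ, one_mul, mul_div_cancel_left₀ _ h2.ne',
      Real.arsinh_sinh]
  open_source := isOpen_lt (by fun_prop) (by fun_prop)
  open_target := isOpen_lt (by fun_prop) (by fun_prop)
  continuousOn_toFun := by
    refine (ContinuousOn.prodMk ?_ (ContinuousOn.prodMk (by fun_prop) (by fun_prop)))
    refine Real.continuous_arsinh.comp_continuousOn (ContinuousOn.div (by fun_prop) (by fun_prop)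
      fun z hz ↦ (Real.sqrt_pos.2 (sq_sub_sq_pos_of_abs_lt hσ hz)).ne')
  continuousOn_invFun := by fun_prop

theorem contDiffOn_rindler {σ : ℝ} (hσ : σ * σ = 1) (t₀ r₀ : ℝ) :
    ContDiffOn ℝ ∞ (rindler hσ t₀ r₀) (rindler hσ t₀ r₀).source := by
  have hpos : ∀ z ∈ (rindler hσ t₀ r₀).source, 0 < (z.2.1 + r₀) ^ 2 - (z.1 + t₀) ^ 2 :=
    fun z hz ↦ sq_sub_sq_pos_of_abs_lt hσ hz
  have h1 : ContDiffOn ℝ ∞ (fun z : Coord4 ↦ √((z.2.1 + r₀) ^ 2 - (z.1 + t₀) ^ 2))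
      (rindler hσ t₀ r₀).source :=
    ContDiffOn.sqrt (by fun_prop) fun z hz ↦ (hpos z hz).ne'
  refine ContDiffOn.prodMk ?_ (h1.prodMk (by fun_prop))
  exact Real.contDiff_arsinh.comp_contDiffOn
    (ContDiffOn.div (by fun_prop) h1 fun z hz ↦ (Real.sqrt_pos.2 (hpos z hz)).ne')

theorem contDiff_rindler_symm {σ : ℝ} (hσ : σ * σ = 1) (t₀ r₀ : ℝ) :
    ContDiff ℝ ∞ (rindler hσ t₀ r₀).symm := by
  change ContDiff ℝ ∞ fun z : Coord4 ↦
    (σ * (z.2.1 * Real.sinh z.1) - t₀, σ * (z.2.1 * Real.cosh z.1) - r₀, z.2.2)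
  have := Real.contDiff_sinh (n := ∞)
  have := Real.contDiff_cosh (n := ∞)
  fun_prop

theorem fderiv_rindler_symm {σ : ℝ} (hσ : σ * σ = 1) (t₀ r₀ : ℝ) (z u : Coord4) :
    fderiv ℝ (rindler hσ t₀ r₀).symm z u =
      (σ * (z.2.1 * Real.cosh z.1 * u.1 + Real.sinh z.1 * u.2.1),
        σ * (z.2.1 * Real.sinh z.1 * u.1 + Real.cosh z.1 * u.2.1), u.2.2) := by
  have ht : HasFDerivAt (𝕜 := ℝ) (fun z : Coord4 ↦ z.1) _ z := hasFDerivAt_fst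
  have hr : HasFDerivAt (𝕜 := ℝ) (fun z : Coord4 ↦ z.2.1) _ z :=
    (hasFDerivAt_snd (𝕜 := ℝ) (p := z)).fst
  have hx : HasFDerivAt (𝕜 := ℝ) (fun z : Coord4 ↦ z.2.2) _ z :=
    (hasFDerivAt_snd (𝕜 := ℝ) (p := z)).snd
  have h1 : HasFDerivAt (rindler hσ t₀ r₀).symm _ z :=
    ((((hr.mul ht.sinh).const_mul σ).sub_const t₀).prodMk
      ((((hr.mul ht.cosh).const_mul σ).sub_const r₀).prodMk hx))
  rw [h1.fderiv]
  refine Prod.ext ?_ (Prod.ext ?_ rfl)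
  · change σ * (z.2.1 * (Real.cosh z.1 * u.1) + Real.sinh z.1 * u.2.1) = _
    ring
  · change σ * (z.2.1 * (Real.sinh z.1 * u.1) + Real.cosh z.1 * u.2.1) = _
    ring

variable {M : Type*} [TopologicalSpace M] [ChartedSpace Coord4 M]
  [IsManifold 𝓘(ℝ, Coord4) ∞ M] {φ : OpenPartialHomeomorph M Coord4} {g : LorentzMetric M}
  {K R ζ : ∀ p : M, TangentSpace 𝓘(ℝ, Coord4) p}
  {γ : Coord2 → Coord2 →L[ℝ] Coord2 →L[ℝ] ℝ}

theorem IsSplitChart.inChart_eq (hφ : IsSplitChart g K R φ γ) {z : Coord4} (hz : z ∈ φ.target)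
    (u v : Coord4) : g.inChart φ z u v =
      -(u.1 * v.1) + (u.2.1 * v.2.1 + γ z.2.2 u.2.2 v.2.2) := by
  rw [hφ.static.metric_eq z hz, productMetric_apply]
  ring

/-- The static chart of a timelike combination of translations. -/
theorem IsSplitChart.exists_translationChart (hφ : IsSplitChart g K R φ γ) {b c : ℝ}
    (hlt : c ^ 2 < b ^ 2) (hζ : ∀ z ∈ φ.target, fieldInChart ζ φ z = (b, c, 0)) :
    ∃ (k : ℝ) (ψ : OpenPartialHomeomorph M Coord4), k ≠ 0 ∧ ψ.source = φ.source ∧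
      (∀ q, (ψ q).2.2 = (φ q).2.2) ∧
      IsStaticChart g (fun q ↦ k • ζ q) ψ (fun _ ↦ 1) (productMetric γ) := by
  have hpos : 0 < b ^ 2 - c ^ 2 := sub_pos.2 hlt
  -- This factor makes `(kb, kc)` a unit timelike vector, so it is the image of `∂/∂t` under a
  -- boost. `kb` may be negative; the boost then reverses both `t` and `r`.
  set k := (√(b ^ 2 - c ^ 2))⁻¹ with hk
  have hk0 : 0 < k := inv_pos.2 (Real.sqrt_pos.2 hpos)
  have hk2 : (k * b) ^ 2 - (k * c) ^ 2 = 1 := by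
    rw [mul_pow, mul_pow, ← mul_sub, hk, inv_pow, Real.sq_sqrt hpos.le, inv_mul_cancel₀ hpos.ne']
  set e := (lorentzBoost hk2).toHomeomorph.toOpenPartialHomeomorph with he
  have hd : ∀ z u, fderiv ℝ e.symm z u = boostMap (k * b) (k * c) u := fun z u ↦
    DFunLike.congr_fun (boostMap (k * b) (k * c)).fderiv u
  have himage : ∀ X ∈ Prod.snd '' (φ.trans e).target,
      X.2 ∈ (fun z : Coord4 ↦ z.2.2) '' φ.target := by
    rintro _ ⟨z, hz, rfl⟩
    exact ⟨e.symm z, hz.2, rfl⟩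
  refine ⟨k, φ.trans e, hk0.ne', by simp [he], fun q ↦ rfl, isStaticChart_trans hφ.static.mem_atlas
    (lorentzBoost hk2).contDiff.contDiffOn (lorentzBoost hk2).symm.contDiff.contDiffOn
    (fun z hz ↦ ?_) (fun z hz u v ↦ ?_) (fun _ _ ↦ one_pos) contDiffOn_const
    (hφ.riemannian.productMetric himage)⟩
  · rw [hζ _ hz.2, hd, boostMap_apply]
    simp
  · rw [hφ.inChart_eq hz.2, hd, hd, boostMap_apply, boostMap_apply, productMetric_apply]
    change _ + (_ + γ z.2.2 u.2.2 v.2.2) = _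
    linear_combination (u.2.1 * v.2.1 - u.1 * v.1) * hk2

/-- The static chart of a timelike boost. -/
theorem IsSplitChart.exists_boostChart (hφ : IsSplitChart g K R φ γ) {a b c : ℝ} (ha : a ≠ 0)
    (hζ : ∀ z ∈ φ.target, fieldInChart ζ φ z = (a * z.2.1 + b, a * z.1 + c, 0)) {p : M}
    (hp : p ∈ φ.source) (hlt : (a * (φ p).1 + c) ^ 2 < (a * (φ p).2.1 + b) ^ 2) :
    ∃ (k : ℝ) (ψ : OpenPartialHomeomorph M Coord4), k ≠ 0 ∧ p ∈ ψ.source ∧ ψ.source ⊆ φ.source ∧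
      (∀ q, (ψ q).2.2 = (φ q).2.2) ∧
      IsStaticChart g (fun q ↦ k • ζ q) ψ (fun X ↦ X.1) (boostOpticalMetric γ) := by
  -- The boost is centred at `t = -c/a`, `r = -b/a`. Timelikeness at `p` says that `p` lies in the
  -- left or right wedge of this centre.
  have h1 : |(φ p).1 + c / a| < |(φ p).2.1 + b / a| := by
    rw [← sq_lt_sq]
    refine lt_of_mul_lt_mul_left (a := a ^ 2) ?_ (sq_nonneg a)
    rw [← mul_pow, ← mul_pow, mul_add, mul_add, mul_div_cancel₀ _ ha, mul_div_cancel₀ _ ha]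
    exact hlt
  -- The sign `σ` selects the wedge containing `p`.
  obtain ⟨σ, hσ, hσp⟩ : ∃ σ : ℝ, σ * σ = 1 ∧
      |(φ p).2.1 + b / a| = σ * ((φ p).2.1 + b / a) := by
    rcases abs_choice ((φ p).2.1 + b / a) with h | h
    · exact ⟨1, by norm_num, by rw [h, one_mul]⟩
    · exact ⟨-1, by norm_num, by rw [h, neg_one_mul]⟩
  set e := rindler hσ (c / a) (b / a) with he
  have himage : ∀ X ∈ Prod.snd '' (φ.trans e).target,
      X.2 ∈ (fun z : Coord4 ↦ z.2.2) '' φ.target := by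
    rintro _ ⟨z, hz, rfl⟩
    exact ⟨e.symm z, hz.2, rfl⟩
  have hpos : ∀ z ∈ (φ.trans e).target, 0 < z.2.1 := fun z hz ↦ hz.1
  -- Division by `a` gives the standard boost `(r + b/a) ∂_t + (t + c/a) ∂_r`, which is `∂/∂τ` in
  -- Rindler coordinates for either sign `σ`.
  refine ⟨a⁻¹, φ.trans e, inv_ne_zero ha, ⟨hp, ?_⟩, fun q hq ↦ hq.1, fun q ↦ rfl,
    isStaticChart_trans hφ.static.mem_atlas (contDiffOn_rindler hσ _ _)
    (contDiff_rindler_symm hσ _ _).contDiffOn (fun z hz ↦ ?_) (fun z hz u v ↦ ?_) hpos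
    contDiffOn_fst (hφ.riemannian.boostOpticalMetric himage ?_)⟩
  · change |(φ p).1 + c / a| < σ * ((φ p).2.1 + b / a)
    rwa [← hσp]
  · rw [hζ _ hz.2, fderiv_rindler_symm]
    change a⁻¹ • ((a * (σ * (z.2.1 * Real.cosh z.1) - b / a) + b,
      a * (σ * (z.2.1 * Real.sinh z.1) - c / a) + c, 0) : Coord4) = _
    refine Prod.ext ?_ (Prod.ext ?_ (smul_zero _))
    · simp
      field_simp
      ring
    · simp
      field_simp
      ring
  · rw [hφ.inChart_eq hz.2, fderiv_rindler_symm, fderiv_rindler_symm]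
    change _ + (_ + γ z.2.2 u.2.2 v.2.2) = z.2.1 ^ 2 * (-(u.1 * v.1) +
      (z.2.1 ^ 2)⁻¹ * (u.2.1 * v.2.1 + γ z.2.2 u.2.2 v.2.2))
    have h2 := mul_inv_cancel_left₀ (pow_pos (hpos z hz) 2).ne'
      (u.2.1 * v.2.1 + γ z.2.2 u.2.2 v.2.2)
    rw [mul_add (z.2.1 ^ 2), h2]
    linear_combination (u.2.1 * v.2.1 - z.2.1 ^ 2 * (u.1 * v.1)) *
      (Real.cosh z.1 ^ 2 - Real.sinh z.1 ^ 2) * hσ +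
      (u.2.1 * v.2.1 - z.2.1 ^ 2 * (u.1 * v.1)) * Real.cosh_sq z.1
  · rintro _ ⟨z, hz, rfl⟩
    exact hpos z hz

end BoostCharts

end

/-! ### The dichotomy -/

theorem mainTheorem8 {M : Type*} [TopologicalSpace M] [ChartedSpace Coord4 M]
    [IsManifold 𝓘(ℝ, Coord4) ∞ M] [ConnectedSpace M]
    (g : LorentzMetric M) (K ξ : ∀ p : M, TangentSpace 𝓘(ℝ, Coord4) p)
    (hK : IsUltraStatic g K)
    (hξ : IsHSOTimelikeKilling g ξ)
    (hne : ¬ ∃ c : ℝ, ∀ p, ξ p = c • K p) :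
    IsLocallyMinkowski g K ∨
    ∀ p : M, ∃ (φ : OpenPartialHomeomorph M Coord4) (γ : Coord2 → Coord2 →L[ℝ] Coord2 →L[ℝ] ℝ),
      p ∈ φ.source ∧
      IsRiemannianOn γ ((fun z : Coord4 ↦ z.2.2) '' φ.target) ∧
      -- `g = -dt² + dr² + γ` in the coordinates `φ`, with `K = ∂/∂t`
      IsStaticChart g K φ (fun _ ↦ 1) (productMetric γ) ∧
      -- every static Killing field, suitably rescaled, has one of the two optical metrics
      ∀ ζ : ∀ p : M, TangentSpace 𝓘(ℝ, Coord4) p, IsHSOTimelikeKilling g ζ →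
        ∃ (c : ℝ) (ψ : OpenPartialHomeomorph M Coord4), c ≠ 0 ∧
          p ∈ ψ.source ∧ ψ.source ⊆ φ.source ∧
          (∀ q ∈ ψ.source, (ψ q).2.2 = (φ q).2.2) ∧
          (IsStaticChart g (fun q ↦ c • ζ q) ψ (fun _ ↦ 1) (productMetric γ) ∨
            IsStaticChart g (fun q ↦ c • ζ q) ψ (fun X ↦ X.1) (boostOpticalMetric γ)) := by
  obtain ⟨R, hR⟩ := exists_isUnitParallel hK hξ hne
  refine or_iff_not_imp_left.2 fun hflat p ↦ ?_
  -- Away from the flat case no parallel unit field is orthogonal to both `K` and `R`.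
  have hdim : ∀ S, IsUnitParallel g K S → ∃ p, g.val p (S p) (R p) ≠ 0 := fun S hS ↦ by
    by_contra! h
    exact hflat (isLocallyMinkowski_of_isUnitParallel hK hR hS h)
  obtain ⟨φ, γ, hp, hφ⟩ := exists_isSplitChart hK hR p
  refine ⟨φ, γ, hp, hφ.riemannian, hφ.static, fun ζ hζ ↦ ?_⟩
  obtain ⟨a, b, c, habc⟩ := hζ.exists_fieldInChart_eq hK hR hdim hφ
  -- Timelikeness at `p`: the `(x, y)` component vanishes, so `g(ζ, ζ)` is `-(a r + b)² + (a t +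
  -- c)²`. For `a = 0` this is a condition on constants, valid on the whole chart; otherwise the
  -- chart shrinks to the wedge containing `p`.
  have hlt : (a * (φ p).1 + c) ^ 2 < (a * (φ p).2.1 + b) ^ 2 := by
    have h1 := hζ.timelike p
    rw [val_eq_inChart hφ.static.mem_atlas hp, habc _ (φ.map_source hp),
      hφ.inChart_eq (φ.map_source hp)] at h1
    simp only [map_zero, add_zero] at h1
    linarith
  by_cases ha : a = 0
  · subst ha
    obtain ⟨k, ψ, hk, hψφ, hψ, hs⟩ := hφ.exists_translationChart (ζ := ζ) (b := b) (c := c)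
      (by simpa using hlt) fun z hz ↦ by rw [habc z hz]; simp
    exact ⟨k, ψ, hk, hψφ ▸ hp, hψφ.subset, fun q _ ↦ hψ q, Or.inl hs⟩
  · obtain ⟨k, ψ, hk, hpψ, hψφ, hψ, hs⟩ := hφ.exists_boostChart ha habc hp hlt
    exact ⟨k, ψ, hk, hpψ, hψφ, fun q _ ↦ hψ q, Or.inr hs⟩
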